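/- For a finite group $G$ and a subgroup $H\le G$ let $R[H\backslash G]$ denote the permutation $R[G]$-module on the right cosets of $H$. Subgroups $H_1,H_2\le G$ are locally integrally equivalent if $\mathbf Z_p[H_1\backslash G]\simeq\mathbf Z_p[H_2\backslash G]$ as $\mathbf Z_p[G]$-modules for every prime $p$, and integrally equivalent if $\mathbf Z[H_1\backslash G]\simeq\mathbf Z[H_2\backslash G]$ as $\mathbf Z[G]$-modules. If the indices are equal, then after ordering the cosets each $M\in\operatorname{Hom}_{\mathbf Z[G]}(\mathbf Z[H_1\backslash G],\mathbf Z[H_2\backslash G])$ is an integer matrix, and $d(H_1,H_2)$ is the gcd of the determinants of all such $M$. Let $G\le S_{32}$ (the transitive group 32T9403) be generated by $$\sigma_0=(3,4,5,6,7,8)(9,10,11,12,13,14)(15,16,17,18,19,20)(21,22,23)(24,25,26)(27,28)(29,30)(31,32),$$ $$\sigma_1=(3,5)(6,8)(9,10)(11,14)(12,13)(15,17)(18,20)(21,24)(22,26)(23,25)(27,31)(28,32),$$ $$\sigma_2=(1,2)(3,17)(4,16)(5,15)(6,20)(7,19)(8,18)(9,13)(10,12)(22,23)(25,26)(29,30),$$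 $$\sigma_3=(1,3,2,15)(4,9,16,12)(5,24,17,21)(6,30,18,29)(7,22,19,25)(8,14,20,11)(10,32,13,28)(23,27,26,31),$$ and put $H_1=\langle\sigma_0,\sigma_1\rangle$, $H_2=\langle\sigma_0,\sigma_2\rangle$. Then: (a) $G$ is transitive of order $384$. The subgroups $H_1,H_2$ have index $32$ and trivial normal core in $G$, are isomorphic to the dihedral group $D_6$ of order $12$, and are not conjugate in $G$; every subgroup of $G$ of index $32$ with trivial normal core is conjugate in $G$ to $H_1$ or to $H_2$. (b) There are eight double cosets in $H_1\backslash G/H_2$; for a suitable numbering they consist of $2,2,2,2,3,3,6,12$ right cosets of $H_1$, respectively. For either sign $s\in\{1,-1\}$ the cosets of $H_1$ and of $H_2$ can be ordered, and the double cosets so numbered, that the matrices of the elements of $\operatorname{Hom}_{\mathbf Z[G]}(\mathbf Z[H_1\backslash G],\mathbf Z[H_2\backslash G])$ are exactly the matrices $M=M(x_1,\dots,x_8)$ with $x_1,\dots,x_8\in\mathbf Z$ whose entry at a pair of cosets is $x_k$ when that pair determines the $k$-th double coset, and $\det M=s\,F(x_1,\dots,x_8)$ with $$\begin{aligned}F=\;&(2(x_2-x_3)^2+3(x_5-x_6)^2)^8\,(2(x_1-x_4)+(x_5+x_6-2x_7))^6\\&\cdot(2(x_1+x_2+x_3+x_4)-(x_5+x_6+2x_7+4x_8))^3\,(2(x_1-x_2-x_3+x_4)-(x_5+x_6+2x_7-4x_8))^3\\&\cdot(2(x_1-x_4)-3(x_5+x_6-2x_7))^2\,(2(x_1+x_2+x_3+x_4)+3(x_5+x_6+2x_7+4x_8))\\&\cdot(2(x_1-x_2-x_3+x_4)+3(x_5+x_6+2x_7-4x_8)).\end{aligned}$$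 (c) $F(1,1,0,-1,0,0,0,0)=2^{32}$ and $F(0,0,0,0,1,0,0,0)=3^{12}$. Hence, for suitable orderings, there are homomorphisms of determinants $2^{32}$ and $3^{12}$, so $d(H_1,H_2)=1$, and $H_1$ and $H_2$ are locally integrally equivalent. On the other hand $F(x_1,\dots,x_8)\neq\pm1$ for all $x_1,\dots,x_8\in\mathbf Z$, and $H_1$ and $H_2$ are not integrally equivalent. In particular, locally integrally equivalent subgroups of a finite group need not be integrally equivalent (a negative answer to Question 2.10 of Guralnick and Weiss). (d) The polynomials $$f_1=x^{32}+12x^{28}+72x^{24}+120x^{20}-234x^{16}+108x^{12}+396x^{8}-432x^{4}+81,$$ $$f_2=x^{32}-12x^{28}+72x^{24}-120x^{20}-234x^{16}-108x^{12}+396x^{8}+432x^{4}+81$$ are irreducible over $\mathbf Q$, and the number fields $K_i=\mathbf Q[x]/(f_i)$ of degree $32$ are not isomorphic. They have the same Galois closure $L$, a common splitting field of $f_1$ and $f_2$ of degree $384$ over $\mathbf Q$. There are a numbering of the roots of $f_1$ in $L$ by $1,\dots,32$ under which $\operatorname{Gal}(L/\mathbf Q)$ acts on the roots as the permutation group $G$,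 and embeddings of $K_1$ and $K_2$ in $L$, such that $\operatorname{Gal}(L/K_1)$ and $\operatorname{Gal}(L/K_2)$ correspond to $H_1$ and $H_2$, respectively. -/

import Mathlib

open scoped Polynomial MonoidAlgebra

namespace IntegralEquivalence

noncomputable section

/-- The permutation module `R[H\G]` as a module over the group ring `R[G]`.
Right cosets with right multiplication are identified with left cosets with left multiplication
through `H g ↦ g⁻¹ H`, so that the right `R[G]`-module becomes a left one. -/
abbrev PermModule (R : Type*) [CommRing R] {G : Type*} [Group G] (H : Subgroup G) : Type _ :=
  (Representation.ofMulAction R G (G ⧸ H)).asModule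

/-- `ℤ_p[H₁\G] ≃ ℤ_p[H₂\G]` as `ℤ_p[G]`-modules for every prime `p`. -/
def LocallyIntegrallyEquivalent {G : Type*} [Group G] (H₁ H₂ : Subgroup G) : Prop :=
  ∀ (p : ℕ) [Fact p.Prime],
    Nonempty (PermModule ℤ_[p] H₁ ≃ₗ[MonoidAlgebra ℤ_[p] G] PermModule ℤ_[p] H₂)

/-- `ℤ[H₁\G] ≃ ℤ[H₂\G]` as `ℤ[G]`-modules. -/
def IntegrallyEquivalent {G : Type*} [Group G] (H₁ H₂ : Subgroup G) : Prop :=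
  Nonempty (PermModule ℤ H₁ ≃ₗ[MonoidAlgebra ℤ G] PermModule ℤ H₂)

/-- `Hom_{ℤ[G]}(ℤ[H₁\G], ℤ[H₂\G])`. -/
abbrev PermHom {G : Type*} [Group G] (H₁ H₂ : Subgroup G) : Type _ :=
  PermModule ℤ H₁ →ₗ[MonoidAlgebra ℤ G] PermModule ℤ H₂

/-- The basis element of `ℤ[H\G]` given by a coset. -/
def cosetVec {G : Type*} [Group G] (H : Subgroup G) (a : G ⧸ H) : PermModule ℤ H :=
  (Representation.ofMulAction ℤ G (G ⧸ H)).asModuleEquiv.symm (MonoidAlgebra.single a 1)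

/-- The coefficient of an element of `ℤ[H\G]` at a coset. -/
def cosetCoeff {G : Type*} [Group G] (H : Subgroup G) (v : PermModule ℤ H) (a : G ⧸ H) : ℤ :=
  ((Representation.ofMulAction ℤ G (G ⧸ H)).asModuleEquiv v).coeff a

/-- The matrix of a homomorphism after ordering the two coset spaces: row `i` holds the
coordinates of the image of the `i`-th coset of `H₁`. -/
def homMatrix {G : Type*} [Group G] {H₁ H₂ : Subgroup G} {n : ℕ}
    (e₁ : G ⧸ H₁ ≃ Fin n) (e₂ : G ⧸ H₂ ≃ Fin n) (φ : PermHom H₁ H₂) :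
    Matrix (Fin n) (Fin n) ℤ :=
  Matrix.of fun i j => cosetCoeff H₂ (φ (cosetVec H₁ (e₁.symm i))) (e₂.symm j)

/-- `d(H₁, H₂)`: the nonnegative greatest common divisor of the determinants of all
`ℤ[G]`-homomorphisms `ℤ[H₁\G] → ℤ[H₂\G]`. All orderings of the two coset spaces are admitted;
another ordering changes a determinant at most by a sign. The value is `0` if the indices differ. -/
def detGcd {G : Type*} [Group G] (H₁ H₂ : Subgroup G) : ℕ :=
  (Submodule.IsPrincipal.generator (Ideal.span {t : ℤ | ∃ (n : ℕ) (e₁ : G ⧸ H₁ ≃ Fin n)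
    (e₂ : G ⧸ H₂ ≃ Fin n) (φ : PermHom H₁ H₂), t = (homMatrix e₁ e₂ φ).det})).natAbs

/-- The cycle on `{1, …, 32}` with the listed entries; the point `m` is the element `m - 1`
of `Fin 32`. -/
def cyc (l : List ℕ) : Equiv.Perm (Fin 32) :=
  (l.map fun m => Fin.ofNat 32 (m - 1)).formPerm

def σ₀ : Equiv.Perm (Fin 32) :=
  cyc [3, 4, 5, 6, 7, 8] * cyc [9, 10, 11, 12, 13, 14] * cyc [15, 16, 17, 18, 19, 20] *
    cyc [21, 22, 23] * cyc [24, 25, 26] * cyc [27, 28] * cyc [29, 30] * cyc [31, 32]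

def σ₁ : Equiv.Perm (Fin 32) :=
  cyc [3, 5] * cyc [6, 8] * cyc [9, 10] * cyc [11, 14] * cyc [12, 13] * cyc [15, 17] *
    cyc [18, 20] * cyc [21, 24] * cyc [22, 26] * cyc [23, 25] * cyc [27, 31] * cyc [28, 32]

def σ₂ : Equiv.Perm (Fin 32) :=
  cyc [1, 2] * cyc [3, 17] * cyc [4, 16] * cyc [5, 15] * cyc [6, 20] * cyc [7, 19] *
    cyc [8, 18] * cyc [9, 13] * cyc [10, 12] * cyc [22, 23] * cyc [25, 26] * cyc [29, 30]

def σ₃ : Equiv.Perm (Fin 32) :=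
  cyc [1, 3, 2, 15] * cyc [4, 9, 16, 12] * cyc [5, 24, 17, 21] * cyc [6, 30, 18, 29] *
    cyc [7, 22, 19, 25] * cyc [8, 14, 20, 11] * cyc [10, 32, 13, 28] * cyc [23, 27, 26, 31]

/-- The transitive permutation group 32T9403. -/
def G32T9403 : Subgroup (Equiv.Perm (Fin 32)) := Subgroup.closure {σ₀, σ₁, σ₂, σ₃}

/-- `⟨σ₀, σ₁⟩`, as a subgroup of 32T9403. -/
def subH₁ : Subgroup G32T9403 := (Subgroup.closure {σ₀, σ₁}).subgroupOf G32T9403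

/-- `⟨σ₀, σ₂⟩`, as a subgroup of 32T9403. -/
def subH₂ : Subgroup G32T9403 := (Subgroup.closure {σ₀, σ₂}).subgroupOf G32T9403

/-- The number of right cosets of `H₁` in a double coset in `H₁\G/H₂`. -/
def numRightCosets {G : Type*} [Group G] {H₁ H₂ : Subgroup G}
    (D : DoubleCoset.Quotient (H₁ : Set G) (H₂ : Set G)) : ℕ :=
  (Quotient.mk (QuotientGroup.rightRel H₁) '' DoubleCoset.quotToDoubleCoset H₁ H₂ D).ncard

/-- The factored determinant; the variables `x₁, …, x₈` are `x 0, …, x 7`. -/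
def detForm (x : Fin 8 → ℤ) : ℤ :=
  (2 * (x 1 - x 2) ^ 2 + 3 * (x 4 - x 5) ^ 2) ^ 8 *
  (2 * (x 0 - x 3) + (x 4 + x 5 - 2 * x 6)) ^ 6 *
  (2 * (x 0 + x 1 + x 2 + x 3) - (x 4 + x 5 + 2 * x 6 + 4 * x 7)) ^ 3 *
  (2 * (x 0 - x 1 - x 2 + x 3) - (x 4 + x 5 + 2 * x 6 - 4 * x 7)) ^ 3 *
  (2 * (x 0 - x 3) - 3 * (x 4 + x 5 - 2 * x 6)) ^ 2 *
  (2 * (x 0 + x 1 + x 2 + x 3) + 3 * (x 4 + x 5 + 2 * x 6 + 4 * x 7)) *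
  (2 * (x 0 - x 1 - x 2 + x 3) + 3 * (x 4 + x 5 + 2 * x 6 - 4 * x 7))

open Polynomial in
def f₁ : ℚ[X] :=
  X ^ 32 + 12 * X ^ 28 + 72 * X ^ 24 + 120 * X ^ 20 - 234 * X ^ 16 + 108 * X ^ 12
    + 396 * X ^ 8 - 432 * X ^ 4 + 81

open Polynomial in
def f₂ : ℚ[X] :=
  X ^ 32 - 12 * X ^ 28 + 72 * X ^ 24 - 120 * X ^ 20 - 234 * X ^ 16 - 108 * X ^ 12
    + 396 * X ^ 8 + 432 * X ^ 4 + 81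

end

end IntegralEquivalence

open IntegralEquivalence

namespace IntegralEquivalence

/-! A homomorphism between the two permutation lattices is a matrix that is constant on the eight
double cosets, so its determinant is a form in eight integer variables. On an orthogonal basis of
rational vectors this form splits: six blocks of total rank 16 give powers of linear forms, and a
block of rank 16 gives the eighth power of `2u² + 3v²`. That binary form of discriminant -24 is not
equivalent to the principal form `u² + 6v²`: it represents 2 and 3, but neither 1 nor -1. Hence no
homomorphism is invertible over `ℤ` (`detForm_ne`), although there are homomorphisms whose
determinants are a power of 2 and a power of 3. In each local ring `ℤ_p` one of these two numbers is
a unit, which gives local equivalence.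

The determinant formula is proved without expanding a determinant. Let `P` have the orthogonal
vectors `v i` as rows and let `A` be the generic invariant matrix. The rows of `P A` are `L w i + L'
w' i` with linear forms `L`, `L'` and explicit vectors, and they are again orthogonal. Comparing `(P
A)(P A)ᵀ` with `P Pᵀ` gives `det A ^ 2 = F ^ 2`, and a single sign is extracted in the polynomial
ring, which is a domain (`exists_det_indexMatrix`).

The group is enumerated by 384 natural numbers that encode permutations, so that finite checks are
kernel arithmetic. The first subgroup is the stabilizer of a point and the second one the stabilizer
of an unordered pair of points; double cosets are then orbits on points times pairs. A core-free
subgroup of order 12 avoids the central involution `σ₃ ^ 2`. This forces it, up to conjugation, to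
contain `σ₀ ^ 2`, then `σ₀`, and then to be one of the two subgroups (`exists_conj_eq`).

On the side of fields, a root `x` of `f₁` satisfies `x⁴ k² = 6 (r - 1)` with `r² = 2` and `k⁴ - 4k³
+ 12k - 12 = 0`, and the resolvent cubic of the quartic is `c³ = 6`. A `RootData` is a system of
such generators. There are at most `2·2·3·2·2·2·4 = 384` of them in a field, and an automorphism of
the splitting field is determined by the system to which it moves a given one. So the degree is at
most 384. Conversely a tower of real fields of degree 64, followed by `I` and the cube root of 6,
shows that 384 divides the degree. Hence the Galois group acts simply transitively on the systems of
generators. Four explicit new systems (`rotate`, `conjugate` with either sign, `exchange`) therefore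
come from automorphisms, and these permute the roots as `σ₀`, `σ₁`, `σ₂`, `σ₃`. The roots of `f₂`
are those of `f₁` times an eighth root of unity, and one of them is fixed by the second subgroup. -/

/-! ### Permutations of 32 points as base-32 numbers -/

/-- The `i`-th base-32 digit of `n`. -/
def digit (n i : ℕ) : ℕ := Nat.mod (Nat.div n (Nat.pow 32 i)) 32

lemma digit_eq (n i : ℕ) : digit n i = n / 32 ^ i % 32 := rfl

/-- `n` lists the values of the permutation `g` as its base-32 digits. -/
def Encodes (n : ℕ) (g : Equiv.Perm (Fin 32)) : Prop := ∀ i : Fin 32, (g i : ℕ) = digit n i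

/-- The number whose first `k` digits are those of the composition of `m` after `n`. -/
def compDigits (m n : ℕ) : ℕ → ℕ
  | 0 => 0
  | k + 1 => Nat.add (compDigits m n k) (Nat.mul (Nat.pow 32 k) (digit m (digit n k)))

/-- The composition of encoded permutations. -/
def comp (m n : ℕ) : ℕ := compDigits m n 32

lemma compDigits_succ (m n k : ℕ) :
    compDigits m n (k + 1) = compDigits m n k + 32 ^ k * digit m (digit n k) := rfl

lemma digit_lt (n i : ℕ) : digit n i < 32 := Nat.mod_lt _ (by norm_num)

lemma compDigits_lt (m n k : ℕ) : compDigits m n k < 32 ^ k := by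
  induction k with
  | zero => simp [compDigits]
  | succ k ih =>
    have h := digit_lt m (digit n k)
    rw [compDigits_succ, pow_succ]
    nlinarith [Nat.mul_le_mul_left (32 ^ k) (Nat.succ_le_of_lt h)]

/-- A later summand is a multiple of `32 ^ (i + 1)` and does not touch digit `i`; for the last
digit, the part below it is less than `32 ^ i` and disappears in the division. -/
lemma digit_compDigits (m n k i : ℕ) (h : i < k) :
    digit (compDigits m n k) i = digit m (digit n i) := by
  induction k with
  | zero => omega
  | succ k ih =>
    rw [compDigits_succ]
    rcases Nat.lt_succ_iff_lt_or_eq.1 h with h | rfl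
    · rw [← ih h]
      generalize digit m (digit n k) = D
      obtain ⟨j, rfl⟩ := Nat.exists_eq_add_of_lt h
      have : 32 ^ (i + j + 1) * D = 32 ^ i * (32 * (32 ^ j * D)) := by ring
      rw [digit_eq, digit_eq, this, Nat.add_mul_div_left _ _ (by positivity), Nat.add_mul_mod_self_left]
    · rw [digit_eq, Nat.add_mul_div_left _ _ (by positivity),
        Nat.div_eq_of_lt (compDigits_lt m n i), zero_add, Nat.mod_eq_of_lt (digit_lt _ _)]

lemma Encodes.mul {m n : ℕ} {g h : Equiv.Perm (Fin 32)} (hm : Encodes m g) (hn : Encodes n h) :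
    Encodes (comp m n) (g * h) := fun i => by
  rw [comp, digit_compDigits _ _ _ _ i.2, ← hn i, ← hm, Equiv.Perm.mul_apply]

lemma Encodes.ext {n : ℕ} {g h : Equiv.Perm (Fin 32)} (hg : Encodes n g) (hh : Encodes n h) :
    g = h := Equiv.ext fun i => Fin.ext ((hg i).trans (hh i).symm)


/-! ### Enumeration of the group -/

/-- The four generators of 32T9403. -/
noncomputable def sigma : Fin 4 → Equiv.Perm (Fin 32) := ![σ₀, σ₁, σ₂, σ₃]

/-- Their codes. -/
def sigmaCode : Fin 4 → ℕ :=
  ![1415692895526175341022664909220841223442924702752,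
    1271584308031579665997187135160304367573946961952,
    1459937616237568649455590174988071789243042086913,
    580228184876501022251173269854312155136614729154]

/-- The product of the generators named by a word. -/
noncomputable def wordPerm : List (Fin 4) → Equiv.Perm (Fin 32)
  | [] => 1
  | i :: w => sigma i * wordPerm w

/-- The code of `wordPerm`. -/
def wordCode : List (Fin 4) → ℕ
  | [] => 1459980823972598128486511383358617792788444579872
  | i :: w => comp (sigmaCode i) (wordCode w)

/-- Words for a transversal of the stabilizer of the point `0`. -/
def transWords : List (List (Fin 4)) :=
  [[], [2], [3], [3, 2], [0, 3], [1, 3], [2, 3], [0, 3, 2], [3, 0, 3], [0, 1, 3], [3, 1, 3], [0, 2,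
  3], [3, 2, 3], [3, 0, 3, 2], [0, 3, 0, 3], [2, 3, 0, 3], [0, 0, 1, 3], [1, 0, 1, 3], [2, 0, 1, 3],
  [3, 0, 1, 3], [0, 3, 1, 3], [0, 0, 2, 3], [3, 0, 2, 3], [0, 3, 2, 3], [0, 0, 3, 0, 3], [3, 0, 3,
  0, 3], [0, 2, 3, 0, 3], [3, 2, 3, 0, 3], [0, 0, 3, 1, 3], [1, 0, 3, 1, 3], [0, 3, 0, 3, 0, 3], [0,
  3, 2, 3, 0, 3]]

/-- Words for the elements of `⟨σ₀, σ₁⟩`. -/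
def words₁ : List (List (Fin 4)) :=
  [[], [0], [1], [0, 0], [1, 0], [0, 1], [0, 0, 0], [1, 0, 0], [0, 0, 1], [1, 0, 1], [0, 0, 0, 0],
  [1, 0, 0, 0]]

/-- Words for the elements of `⟨σ₀, σ₂⟩`. -/
def words₂ : List (List (Fin 4)) :=
  [[], [0], [2], [0, 0], [2, 0], [0, 2], [0, 0, 0], [2, 0, 0], [0, 0, 2], [2, 0, 2], [0, 0, 0, 0],
  [2, 0, 0, 0]]

/-- The codes of the elements of 32T9403. -/
def elementCodes : List ℕ :=
  [1459980823972598128486511383358617792788444579872,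
  1415692895526175341022664909220841223442924702752,
  1271584308031579665997187135160304367573946961952,
  1459980823928815345108284857926419550015125098528,
  1227296379625076475149891066786053100737217498144,
  1227296379708778854906976490420061886693357261856,
  1415692895609877720772329946166928680214200521760,
  1271584308071499262376053279833266912551472695328,
  1271584307987796882856412983741588658716273711136,
  1415692895566094937639208068512998357971965647904,
  1459980823888895748729186826169459463500572366880,
  1227296379668859258283005698189969428484776467488,
  1459937616237568649455590174988071789243042086913,
  1415736103218709764772967557529044352728556846081,
  1271541100378964837882027977223690803247070033921,
  1459937616277488245834456319668167818327020386305,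
  1227339587320186356582854954215574919787459394561,
  1227339587360105953199398113286594047016470793217,
  1415736103262492547906082188711822673176086268929,
  1271541100335182054503801452019764051880232665089,
  1271541100295262458124703420041665958065650386945,
  1415736103302412144530052980934781647278214497281,
  1459937616193785866314816023348218073085339289601,
  1227339587403888736332519991168795860665187779585,
  580228184876501022251173269854312155136614729154,
  1022157151845662449790949038638808433590326239682,
  447494275555524338155410344104445531635135569346,
  580228183869516814090702853035262063687862508994,
  1154891060156747486927340803509749638338513510850,
  1154891061073601045418815999154799604176933090754,
  1022157152409698719912065555282093737540318852546,
  447494275867175798936747016394344731641164236226,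
  447494274950322240515484088998530785570921043394,
  1022157151402714511922657757341473372700944676290,
  580228184312464753630046131854702073497733486018,
  1154891060761949583011107864337769585234356647362,
  579709691561679497072342127323162180842078720078,
  1022675644140623422434151411438068055318456183886,
  446975783559337223750356666301493064762036420686,
  579709692563511531231512306018911022311866171470,
  1155409552492915783243432309356001318935259130958,
  1155409553059485699032891691732643146757477247054,
  1022675643746608867205496683975892029913699199054,
  446975783201328778526231002636182688396817092686,
  446975782634758864407823619018116387946866499662,
  1022675644748440902991038327005920997288017817678,
  579709691955694050744837659860674181426764996686,
  1155409553417494144085954737071179900745650303054,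
  623091651822443220789113779068825194852824417763,
  932286456784909884761746464459307710826205160931,
  490357742501466536693349645575964431161782231523,
  623091650815459012627405423540749534239612887523,
  1065020365095994921937752272734732053151062468067,
  1065020366012848480429188820610671089280115044835,
  932286457348946154922438376516813717745164841443,
  490357742813117997474687525830009276468304283107,
  490357741896264439052186659497316695162024253923,
  932286456341961946933069226573157348268189983203,
  623091651258406952167985433540670917174663338467,
  1065020365701197017981905289943818918326595953123,
  537502695498386257692466360460223210980196517380,
  1112165571383990592314942588273420324667433559556,
  396205308363403361181620563064095886792761594372,
  537502694658796434353923133818333031450263081476,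
  970868184037872025836748871677694238088671307268,
  970868185207110077626138167126406434544259069444,
  1112165571868197729706384539443291337837834466820,
  396205308837298605612219988134115216912148661764,
  396205307668060553774320397581971508615434921476,
  1112165571028607906416351608209194659109548370436,
  537502695014179121804843548042484802177398564356,
  970868184733214831691719603294743187696094325252,
  395686816532035488104780457148593765320427438224,
  971386676379190923325504808132286652586448892048,
  536984202348383973841848789816523582086425500816,
  395686816001481742463141250875078856144132660368,
  1112684063684102166130809391681020680296595468432,
  1112684064204364454983846688056281302430407979152,
  971386677553578634087352634362994056850107494544,
  536984203182821308756169863301107672550597886096,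
  536984202662559020092067399688130683110548199568,
  971386677023024888739328369886888995858589693072,
  395686815357647778839092251241230883995498502288,
  1112684063369927118320601826471930183853934326928,
  622573158507621695530821152523050734042558649455,
  932804949079870857442079747029562021808312430703,
  489839250505279422050535316720757755636658602095,
  622573159509453729769375217528529053128922071151,
  1065538857432163218206799677089149085269838442607,
  1065538857998733134040827273802206637472603974767,
  932804948685856302176291684646752409443123375215,
  489839250147270977062701383826440424232901858415,
  489839249580701062866534531516229716356001817711,
  932804949687688337993983505864896959313424872559,
  622573158901636249043855667258803352529071432815,
  1065538858356741579096320302389798951740631741551,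
  874575620633600946719838387878440180313773554024,
  210776200877622953532693287195741193757621714280,
  343639985196805156696966204157967651726378899816,
  874575620695412092892152723193329654131912251752,
  741711836263787604675518723310049490704241491304,
  741711835438358398677443039267251959672536765800,
  210776200198984627137949572385439736356652520808,
  343639985180064523955043655511878498973930469736,
  343639986005493729439931483970386842463863236968,
  210776200260795772858352213860869447696537566568,
  874575621312239274317126779875959126606536501608,
  741711835455099030722349246288479945876112751976,
  584371937884002922222068477190674532694700131877,
  1159034813769607257038785235475818819411461712421,
  443074550749020025948673845836980072090833344037,
  584371937044413099123449878744431579809057756709,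
  1017737426423488690607625948965370464277279844901,
  1017737427592726742270830023064762074308377506341,
  1159034814253814394477338912497042489098209325605,
  443074551222915270383216559074165670604705203749,
  443074550053677218306398391958327034730434682405,
  1159034813414224571068509745075525346676214640165,
  584371937399795786575842534475225097209728327205,
  1017737427118831496423105827191191655314436632101,
  146044077849252950752014828067709014184630925975,
  278907861880193682540506658630472634400723074711,
  711233625112378072058987358680115391027938824855,
  146044077652238128817774394590485710249264714391,
  844097409225730862083161579479632083322389626519,
  844097410088514503433422319000528224962017904279,
  278907862937414173408837239927375293930889234071,
  711233625000353280694898358098326044032895269527,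
  711233624137569639423785994351160744000237402775,
  278907862740399351556298355707196802137067036311,
  146044076792032459881131073282736728048922786455,
  844097410200539294715809770472698098015537143447,
  442556058917652152871989690169382763342290387121,
  1018255918764807588056772677718758199715082024113,
  583853444734000638529906023832509438661015036081,
  442556058387098407232900034000679687389946241201,
  1159553306069718830899217842445043833712595186865,
  1159553306589981119635966181869165982402656105649,
  1018255919939195298858314258610479654450701694129,
  583853445568437973527089289662293967719010402481,
  583853445048175684861829806049415495885698027697,
  1018255919408641553389010633758198647182073012401,
  442556057743264443530863301833298019245973852337,
  1159553305755543783051985639600289146518397132977,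
  711363248111437425689019574563055149745070508788,
  843967786141689180706392679374816464931772722932,
  146173700765897653466284993516716333683237044980,
  711363248166802067852213037914614934201799197428,
  278778238793576543481076519404338326245496418036,
  278778239828905328818015972353817284086599259892,
  843967787036665729851821633630718319530161805044,
  146173700903677024573512363962025729401303960308,
  146173699868348239315721286781521957096203152116,
  843967787092030372096716646091897577928414809844,
  711363247216460876541037446971264662812127521524,
  278778239691125957629087052651463076226988330740,
  874445997593341812925750381213247076153969985803,
  210905823960377141858563606426662708922817801483,
  343510362074131371987130640008279596043913234699,
  874445997571450579511810024537567868551614793995,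
  741841459343966334843359281460097140712416046347,
  741841458562319912065445258158951133662978051339,
  210905823321658411610340009221068751324659518731,
  343510362141093119158268980321492671824111651083,
  343510362922739541359165812289461756423269644555,
  210905823299767177647467368815317886436212557067,
  874445998232060543904181574175915047473759451403,
  741841458495358164753882380267732090750374987019,
  647689016396671964998273700667961784038751944073,
  249357920661807042978558436843247660583654521225,
  116753380967760680290387853161222397498029448585,
  647689016211246625281028382445753252176962198921,
  780293555963152685399872952301075194924897925513,
  780293555220135850923471279446868291061331237257,
  249357919975445172468967087722568330046748858761,
  116753380948452449066788143960555697356072828297,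
  116753381691469283109150337001826427249353780617,
  249357919790019832381511624844232178748239626633,
  647689017083033836707856553563879473997403417993,
  780293555239444081368353097839341681612881248649,
  249487542850882549725363172201440012179956797740,
  647559393995128968569411524242006263874360802604,
  780423178279710760456258790236640754487276849452,
  249487543083953782112120955777267081312979241260,
  116623758608715330811396307882145772047942450476,
  116623757909473263430629267790878511366938381612,
  647559393109176423988191341646011347044149316908,
  780423178344089583472089297359276106212456894764,
  780423179043331651350725153012367275772254742828,
  647559393342247656842179859768577930421729365292,
  249487543736835093578928932452340044758585043244,
  116623757845094440636924847429581269815697149228,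
  627235404736896321517642766365688809434093291078,
  1069164118705946917033258716920083760304315117126,
  485938017437084123650184862150620139199017638470,
  627235403735052654501438478685778676886895778374,
  927866731354677434966899034352956141802870582854,
  927866732446651751547418432231850933055144031814,
  1069164119100013030237995469021414697045953640006,
  485938018083535042949618053341900169231112472134,
  485938016991560726194206276466606957376983458374,
  1069164118098169363155408673210237239141602472518,
  627235404342830210058000040448518211773637485126,
  927866731800200830629273298739866160348064920134,
  533082970854125728897541222256853840222714496615,
  975011937740872505719396967349242697568731575911,
  400349061450734394123471035351171623027528361575,
  533082969762151412144601699785079290279098213991,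
  1107745846049382085101319792749542026381415724647,
  1107745847051225752065141753671041986830851175015,
  975011938387323426677233440232937037822583009895,
  400349061844800505586825162137283713873813571175,
  400349060842956838569386558984031993691492995687,
  975011937295349109977910559688552258651330490983,
  533082970207674809601820639677509443566012093031,
  1107745846657159638939671736590091264748591657575,
  399830569536961930396647474125170591323992162547,
  1108264338388125839171877827298346077959784966387,
  532564477456889552961174882729215112452617099507,
  399830569093963376817814261370929201648202864883,
  975530430033258020605654527682839407118175447283,
  975530430726065609637371332715897826282155242739,
  1108264339395118850858550259896552241236044150003,
  532564478541136238119197568052187680851874840819,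
  532564477848328648798972168045677672434355854579,
  1108264338952120297085675867556068959935254242547,
  399830568529968920300602078084025429291662892275,
  975530429641818923141485778612286761812539188467,
  1275962217106071686026089056736589979144950102941,
  1408739249326312264428055817840204931326587510685,
  1452940762262639432628059382571046527364562668445,
  1275962217273468664693687203417825662516850772893,
  1231760704084512967668613093431992184110358929309,
  1231760704251909946098534225608169023633985443741,
  1408739249246480616726471446188912225979333089181,
  1452940762342471080574755648247054405684351318941,
  1452940762175074101899729868520881137036122309533,
  1408739249413877595156624465556088868636775092125,
  1275962217185903333972778075937879113616807019421,
  1231760704172078298159497480168098533724340621213,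
  193180929049600661302514415391575292113768627896,
  325785466998735396666613206333364370077972101816,
  758370476436347758983122775106376859441908618936,
  193180928978783273498852212788107559986001417912,
  890975014348135762970944246841973668702289656504,
  890975015124641566802070814285795433788918123192,
  325785467974828965700517903919705600736608897720,
  758370476199413262485768875007936730176242663096,
  758370475422907458567834411561580219178952523448,
  325785467904011577822813672516268452177471048376,
  193180928073507092508608018379091237368650366648,
  890975015361576063143681136400934003581679274680,
  485419525770545552167641577270443554091767693522,
  928385223701147248051248584098212094170750558418,
  626716911422064736310645429334005021036993864914,
  485419525077737962848573197042683522956581037266,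
  1069682611000907575260966814994749996090304504018,
  1069682611443906128912561846952355770359287181522,
  928385224785393934626398457731747385476220907730,
  626716912429057746331252642725276815187005178066,
  626716911986059192749869879872925153247912416466,
  928385224092586345478392695526398987970153555154,
  485419524686298867092481084078221480136049743058,
  1069682610436913117265583169236315162453325030610,
  1452983970038868690871369372053166499428334930876,
  1231717496393266036939469432166835356199619350460,
  1276005424964715595185146603703204902731384462268,
  1452983969951310905436857543735107077814486604732,
  1408696041637640791856941917655921968572869463996,
  1408696041550083006184753074832803703110746982332,
  1231717496560663251397506854454253055687030622140,
  1276005424797318380972221075440502376216507419580,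
  1276005424884876166399305270713624212554027406268,
  1231717496473105465725549898822134593358723628988,
  1452983969871471476658436597315745229065526154172,
  1408696041717480220405338123331443618035767852988,
  758240853148852217745498809088217165976676667157,
  891104637423163813326519579800321965171059256085,
  193051305926934421896400057291842989389724337941,
  758240853330414294039270503387245191341014206229,
  325915090078914362862879539493905221468372986645,
  325915091027965310680684820363931974720991828757,
  891104638237013440637522650421752888033413012245,
  193051305939804087870362528146788933737159003925,
  193051304990753139965749351264716122431941734165,
  891104638418575516857252315625960820566340516629,
  758240852335002590674494039345005407569817595669,
  325915091015095644550978771230833794500612963093,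
  694696244387909686057038839988801299304640659882,
  296365148815293656275225405643591716820141309354,
  163760609214293007365384199516513429389176703402,
  694696244454871512041935131869361211928557619626,
  827300784209682654409466902552293235908805164458,
  827300783466660554271005351241662275381376392618,
  296365147966682893292530797576239554738524069290,
  163760609194977152486120546855853686167163158954,
  163760609937999252356498890132191888277422467498,
  296365148033644719062960522931398745598646044074,
  694696245236520449997173477693374521153449159082,
  827300783485976408445593142041523463644373665194, 42764549007924756452915695022184507214736863103,
  1325688533160819334994616679828144075693595483007,
  87009184595110045144982063073800791131390949247, 42764548840519997176074031754610051900447045503,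
  1281443896349940493337270390232038236315768445823,
  1281443896437506059844904976742085522449681012607,
  1325688533240658527997449993495515097144609789823,
  87009184762514804533245470316333075104452456319, 87009184674949238021781123688317094559517157247,
  1325688533073253768724438090345909335822797493119,
  42764548928085563568804945011843006127595464575,
  1281443896270101300337919005842523718331984565119,
  296494771089356678002373608200646354268921468237,
  694566622156341719591648658563549283449068714317,
  827430406526235542239673902231997823956245499213,
  296494771072616123852307565076846987472136523085,
  163630986855245064268312831881047960808432269645,
  163630986156005747696773504710405444293672679757,
  694566621347650552262958079798326938992768825677,
  827430406590622067658775682942361646238002189645,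
  827430407289861384814991721682118473613185609037,
  694566621330909998654164800168661841071931822413,
  296494771898047844363411463894735644289131507021,
  163630986091619222655541388892106629858779304269,
  1325861363851117838847976774819637828610037276667,
  42591718147646035409788589475097960904355755003,
  1281616727210219214376567501904015186380283339771,
  1325861364018522598117278484849997797896230364155,
  86836353904811541291621734325166136174154855419, 86836353817245974898883574596565218476432305147,
  42591718067806842525561895708419100137745067003,
  1281616727042814454865871337885207590226967683067,
  1281616727130380021373502301152869333870896834555,
  42591718235211601921245689631745977978716922875,
  1325861363930957031847096272125377515535448958971,
  86836353984650734168304851183345079922811773947, 231762648830007231819211378004242899619051193049,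
  98898862727120572588093340972405582172985196249, 796952196093132353363636282408777636892931758809,
  231762648634280138963753937990592470831621315289,
  664088410072657752138168648502569042358107143897,
  664088410894234068023127976122144377256834977497, 98898863741846009164632664065468260693206585049,
  796952195982395290841109788582214179967234851545,
  796952195160818974790194188958101766144392821465, 98898863546118916153431645766532111926379941593,
  231762647815281795485223528980240507724342885081,
  664088411004971130471612441082159232757603962585, 99028486658490711878910075985627581986518155062,
  231633024728664656188109128884897615522925112118,
  664218034004030484101637410486813505573577629494, 99028486797557811901741982207270291505331904310,
  796822572076777293651109549943632739099996580662,
  796822572985911159504172228368447984096575212342,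
  231633025583719016276913564520675208530766973750,
  664218034060682855187870289097506598405308301110,
  664218033151548989247999714441885116091585883958,
  231633025722786116225703441714077010211727971126, 99028485803436352030103940930840648998647394102,
  796822572929258788262195771781586815898392302390, 41383297752008072213195815660804614013707760478,
  1280062645873275344910826425448807703112839353182,
  88482426249590297572237958725828850338610422622, 41383297839573638598390398702057119591812506462,
  1327161774291018377389475257235492106649363436382,
  1327161774123613618116227843766427532739842693982,
  1280062645705870585637579011758591624092388252510,
  88482426169751104569292324752254395093697082206, 88482426337155863957432541760379795162018818910,
  1280062645793436152149155678692811038431222585182,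
  41383297919412831601336032890081518980365462366,
  1327161774203452810877898590307974253271176271710,
  1280235476563573848760240590106854168552053072858,
  41210467146699676950823889760340842913195669466,
  1327334604896326772406495688045166886949422032858,
  1280235476483734655761117469779880444247588333530,
  88309595559291793711334046199594498202592360410, 88309595479452600715808798692364692681949753306,
  41210467059134110558208920044995304221876924378,
  1327334604983892338917840467895611470229884167130,
  1327334605063731531917195475520809969743004295130,
  41210466979294917555256039600052885506389452762,
  1280235476651139415034132996165170187098736877530,
  88309595391887034323186582498949629765360527322]

/-- The codes of the elements of `⟨σ₀, σ₁⟩`. -/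
def codes₁ : List ℕ :=
  [1459980823972598128486511383358617792788444579872,
  1415692895526175341022664909220841223442924702752,
  1271584308031579665997187135160304367573946961952,
  1459980823928815345108284857926419550015125098528,
  1227296379625076475149891066786053100737217498144,
  1227296379708778854906976490420061886693357261856,
  1415692895609877720772329946166928680214200521760,
  1271584308071499262376053279833266912551472695328,
  1271584307987796882856412983741588658716273711136,
  1415692895566094937639208068512998357971965647904,
  1459980823888895748729186826169459463500572366880,
  1227296379668859258283005698189969428484776467488]

/-- The codes of the elements of `⟨σ₀, σ₂⟩`. -/
def codes₂ : List ℕ :=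
  [1459980823972598128486511383358617792788444579872,
  1415692895526175341022664909220841223442924702752,
  1459937616237568649455590174988071789243042086913,
  1459980823928815345108284857926419550015125098528,
  1415736103218709764772967557529044352728556846081,
  1415736103302412144530052980934781647278214497281,
  1415692895609877720772329946166928680214200521760,
  1459937616277488245834456319668167818327020386305,
  1459937616193785866314816023348218073085339289601,
  1415692895566094937639208068512998357971965647904,
  1459980823888895748729186826169459463500572366880,
  1415736103262492547906082188711822673176086268929]

/-- Orbit and stabilizer: a transversal word moves the point `0` to each of the 32 points, and the
twelve words in `σ₀`, `σ₁` run through its stabilizer. Thus each listed code is the code of a word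
in the generators. -/
lemma elementCodes_eq :
    elementCodes = transWords.flatMap fun v => words₁.map fun w => wordCode (v ++ w) := by
  decide +kernel

lemma codes₁_eq : codes₁ = words₁.map wordCode := by decide +kernel

lemma codes₂_eq : codes₂ = words₂.map wordCode := by decide +kernel

lemma encodes_sigma (i : Fin 4) : Encodes (sigmaCode i) (sigma i) := by
  unfold Encodes; revert i; decide +kernel

lemma encodes_one : Encodes (wordCode []) 1 := by unfold Encodes; decide +kernel

lemma encodes_wordPerm (w : List (Fin 4)) : Encodes (wordCode w) (wordPerm w) := by
  induction w with
  | nil => exact encodes_one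
  | cons i w ih => exact (encodes_sigma i).mul ih

lemma range_sigma : Set.range sigma = {σ₀, σ₁, σ₂, σ₃} := by
  ext g
  simp only [sigma, Set.mem_range, Fin.exists_fin_succ, Matrix.cons_val_zero, Matrix.cons_val_succ,
    Set.mem_insert_iff, Set.mem_singleton_iff, IsEmpty.exists_iff, or_false, @eq_comm _ g]

lemma sigma_mem (i : Fin 4) : sigma i ∈ G32T9403 :=
  Subgroup.subset_closure (range_sigma ▸ Set.mem_range_self i)

lemma wordPerm_mem (w : List (Fin 4)) (K : Subgroup (Equiv.Perm (Fin 32)))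
    (h : ∀ i ∈ w, sigma i ∈ K) : wordPerm w ∈ K := by
  induction w with
  | nil => exact K.one_mem
  | cons i w ih =>
    exact K.mul_mem (h i (by simp)) (ih fun j hj => h j (by simp [hj]))

/-- `withValue n k` is `k n`; in kernel computations `n` is evaluated once. -/
def withValue (n : ℕ) (k : ℕ → Bool) : Bool := Nat.rec (k 0) (fun m _ => k (Nat.succ m)) n

lemma withValue_eq (n : ℕ) (k : ℕ → Bool) : withValue n k = k n := by cases n <;> rfl

/-- Closure of the list under left multiplication by generators is what bounds the group from above.
-/
lemma all_comp_sigmaCode : (List.finRange 4).all (fun i => elementCodes.all fun n =>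
    withValue (comp (sigmaCode i) n) fun m => elementCodes.any (Nat.beq m)) = true := by
  decide +kernel

lemma comp_sigmaCode_mem (i : Fin 4) (n : ℕ) (hn : n ∈ elementCodes) :
    comp (sigmaCode i) n ∈ elementCodes := by
  have h := List.all_eq_true.1 (List.all_eq_true.1 all_comp_sigmaCode i (List.mem_finRange i)) n hn
  rw [withValue_eq, List.any_eq_true] at h
  obtain ⟨m, hm, e⟩ := h
  rwa [Nat.eq_of_beq_eq_true e]

/-- In a finite group inverses are positive powers, so the generators span the group as a monoid and
left multiplication by them suffices. -/
lemma exists_encodes {g : Equiv.Perm (Fin 32)} (hg : g ∈ G32T9403) :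
    ∃ n ∈ elementCodes, Encodes n g := by
  have hg' : g ∈ (Subgroup.closure (Set.range sigma)).toSubmonoid := by
    rw [range_sigma]; exact hg
  rw [Subgroup.closure_toSubmonoid_of_finite] at hg'
  induction hg' using Submonoid.closure_induction_left with
  | one => exact ⟨_, by decide +kernel, encodes_one⟩
  | mul_left x hx y hy ih =>
    obtain ⟨i, rfl⟩ := hx
    have hyG : y ∈ G32T9403 := by
      simpa using G32T9403.mul_mem (G32T9403.inv_mem (sigma_mem i)) hg
    obtain ⟨n, hn, he⟩ := ih hyG
    exact ⟨_, comp_sigmaCode_mem i n hn, (encodes_sigma i).mul he⟩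

lemma exists_of_mem_elementCodes {n : ℕ} (hn : n ∈ elementCodes) :
    ∃ g ∈ G32T9403, Encodes n g := by
  rw [elementCodes_eq] at hn
  simp only [List.mem_flatMap, List.mem_map] at hn
  obtain ⟨v, -, w, -, rfl⟩ := hn
  exact ⟨_, wordPerm_mem _ _ fun i _ => sigma_mem i, encodes_wordPerm _⟩


/-- `Encodes` ignores digits beyond the 32nd, so a permutation has many codes. Composing with the
code of the identity truncates to 32 digits; the listed codes are already truncated, which makes
them unique. -/
lemma comp_one_elementCodes : elementCodes.all (fun n => Nat.beq (comp (wordCode []) n) n) = true := by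
  decide +kernel

lemma compDigits_congr {m n n' : ℕ} (k : ℕ) (h : ∀ i < k, digit n i = digit n' i) :
    compDigits m n k = compDigits m n' k := by
  induction k with
  | zero => rfl
  | succ k ih =>
    rw [compDigits_succ, compDigits_succ, ih fun i hi => h i (by omega), h k (by omega)]

lemma Encodes.unique {n n' : ℕ} {g : Equiv.Perm (Fin 32)} (hn : n ∈ elementCodes)
    (hn' : n' ∈ elementCodes) (h : Encodes n g) (h' : Encodes n' g) : n = n' := by
  have key := List.all_eq_true.1 comp_one_elementCodes
  rw [← Nat.eq_of_beq_eq_true (key n hn), ← Nat.eq_of_beq_eq_true (key n' hn'), comp, comp]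
  exact compDigits_congr 32 fun i hi => (h ⟨i, hi⟩).symm.trans (h' ⟨i, hi⟩)

lemma nodup_elementCodes : elementCodes.Nodup := by decide +kernel

lemma card_G32T9403 : Nat.card G32T9403 = 384 := by
  choose f hf he using fun g : G32T9403 => exists_encodes g.2
  have hb : Function.Bijective fun g : G32T9403 => (⟨f g, List.mem_toFinset.2 (hf g)⟩ :
      elementCodes.toFinset) := by
    refine ⟨fun g g' h => Subtype.ext ((he g).ext ?_), fun n => ?_⟩
    · rw [show f g = f g' from congrArg Subtype.val h]
      exact he g'
    · have hn := List.mem_toFinset.1 n.2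
      obtain ⟨g, hg, hng⟩ := exists_of_mem_elementCodes hn
      exact ⟨⟨g, hg⟩, Subtype.ext ((he ⟨g, hg⟩).unique (hf _) hn hng)⟩
  rw [Nat.card_congr (Equiv.ofBijective _ hb), Nat.card_eq_fintype_card, Fintype.card_coe,
    List.toFinset_card_of_nodup nodup_elementCodes]
  decide +kernel

instance : Finite G32T9403 := inferInstance

/-- A property of codes that is checked on the list holds for the elements of the group. -/
lemma forall_mem_of_all {P : ℕ → Bool} (h : elementCodes.all P = true)
    {g : Equiv.Perm (Fin 32)} (hg : g ∈ G32T9403) : ∃ n ∈ elementCodes, Encodes n g ∧ P n = true :=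
  let ⟨n, hn, he⟩ := exists_encodes hg
  ⟨n, hn, he, List.all_eq_true.1 h n hn⟩

lemma exists_apply_zero (a : Fin 32) : ∃ g ∈ G32T9403, g 0 = a := by
  have h : ∀ a : Fin 32, ∃ n ∈ elementCodes, digit n 0 = a := by decide +kernel
  obtain ⟨n, hn, ha⟩ := h a
  obtain ⟨g, hg, he⟩ := exists_of_mem_elementCodes hn
  exact ⟨g, hg, Fin.ext ((he 0).trans ha)⟩

/-! ### Points and pairs as models of the two coset spaces -/

/-- The orbit of the pair `{30, 31}`. -/
def pair : Fin 32 → Sym2 (Fin 32) :=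
  ![
    s(30, 31), s(26, 27), s(12, 22), s(9, 25), s(13, 20), s(11, 24), s(8, 21), s(10, 23), s(4,
    19), s(12, 25), s(3, 6), s(9, 22), s(15, 18), s(7, 16), s(5, 14), s(2, 17), s(13, 23), s(11,
    21), s(8, 24), s(27, 30), s(4, 7), s(10, 20), s(26, 31), s(16, 19), s(6, 15), s(0, 29), s(3,
    18), s(1, 28), s(2, 5), s(14, 17), s(0, 28), s(1, 29)]

/-- The action of the generators on the orbit of pairs. -/
def sigmaPair : Fin 4 → Fin 32 → Fin 32 :=
  ![![0, 1, 4, 7, 6, 9, 11, 5, 14, 16, 20, 21, 23, 15, 24, 26, 18, 2, 3, 22, 28, 17, 19, 29, 13, 30, 8, 31, 10, 12, 25, 27],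
    ![1, 0, 5, 6, 7, 2, 3, 4, 15, 17, 10, 18, 12, 14, 13, 8, 21, 9, 11, 22, 28, 16, 19, 29, 24, 25, 26, 27, 20, 23, 30, 31],
    ![0, 1, 6, 5, 4, 3, 2, 7, 14, 18, 12, 17, 10, 15, 8, 13, 16, 11, 9, 19, 29, 21, 22, 28, 26, 27, 24, 25, 23, 20, 31, 30],
    ![2, 3, 1, 0, 8, 10, 12, 13, 7, 19, 6, 22, 5, 4, 25, 27, 23, 26, 24, 11, 16, 20, 9, 21, 17, 15, 18, 14, 31, 30, 28, 29]]

lemma pair_injective : Function.Injective pair := by unfold Function.Injective; decide +kernel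

lemma map_sigma_pair : ∀ i b, (pair b).map (sigma i) = pair (sigmaPair i b) := by decide +kernel

/-- The rows of the table of double coset indices, as numbers in base 8. -/
def indexRow : Fin 32 → ℕ :=
  ![
    21902782670797221232935698395, 13099422042152465618142494683, 46149496440568903303571891967,
    68077535982728543384029052351, 47039262876064232203099171199, 67189603635411494304162205759,
    47037726333885062121887501119, 68079370080213198987579116991, 79053454204320861543115096054,
    78008945918628345343721337526, 79052848512514637677564243958, 79053156768891033674599432182,
    78008648335897064007505278070, 79052848595380620682271367158, 54679677014546666984746411775,
    68080213564540093012370996671, 55704842571142095285433264959, 67056584016306228752763535423,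
    55703009099794303190886943103, 68081749563777676975949241791, 78858498485885739060229545957,
    78724939979653620030845059045, 78531513030363170060608992357, 78723099392454880008637231084,
    78860339671434695832070848492, 78531512441220281282611638956, 34645131224082713773499377994,
    1228117137919238485632048522, 22093519867435178774065315776, 13430022156056492599897227200,
    34645131288502484318383434513, 1228117064292139969111870865]

/-- The index of the double coset determined by a point and a pair. -/
def pairIndex (a b : Fin 32) : Fin 8 := Fin.ofNat 8 (indexRow a / 8 ^ (b : ℕ))

/-- Double cosets correspond to orbits of the group on points times pairs; invariance of the table
under the generators makes it constant on these orbits. -/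
lemma pairIndex_sigma : ∀ i a b, pairIndex (sigma i a) (sigmaPair i b) = pairIndex a b := by
  decide +kernel

lemma induction_G32T9403 {P : Equiv.Perm (Fin 32) → Prop} (one : P 1)
    (mul : ∀ i g, P g → P (sigma i * g)) {g : Equiv.Perm (Fin 32)} (hg : g ∈ G32T9403) : P g := by
  have hg' : g ∈ (Subgroup.closure (Set.range sigma)).toSubmonoid := by
    rw [range_sigma]; exact hg
  rw [Subgroup.closure_toSubmonoid_of_finite] at hg'
  induction hg' using Submonoid.closure_induction_left with
  | one => exact one
  | mul_left x hx y hy ih =>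
    obtain ⟨i, rfl⟩ := hx
    refine mul i y (ih ?_)
    simpa using G32T9403.mul_mem (G32T9403.inv_mem (sigma_mem i)) hg

lemma exists_map_pair {g : Equiv.Perm (Fin 32)} (hg : g ∈ G32T9403) (b : Fin 32) :
    ∃ b', (pair b).map g = pair b' ∧ ∀ a, pairIndex (g a) b' = pairIndex a b := by
  refine induction_G32T9403 (P := fun g => ∃ b', (pair b).map g = pair b' ∧
    ∀ a, pairIndex (g a) b' = pairIndex a b) ?_ (fun i g ih => ?_) hg
  · exact ⟨b, by simp, fun a => rfl⟩
  · obtain ⟨b', h, h'⟩ := ih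
    refine ⟨sigmaPair i b', ?_, fun a => ?_⟩
    · rw [← map_sigma_pair, ← h, Sym2.map_map]; rfl
    · rw [Equiv.Perm.mul_apply, pairIndex_sigma, h']

lemma mem_closure_of_codes {S : Set (Equiv.Perm (Fin 32))} {W : List (List (Fin 4))}
    (hW : ∀ w ∈ W, ∀ i ∈ w, sigma i ∈ S) {n : ℕ} (hn : n ∈ W.map wordCode)
    {g : Equiv.Perm (Fin 32)} (h : Encodes n g) : g ∈ Subgroup.closure S := by
  obtain ⟨w, hw, rfl⟩ := List.mem_map.1 hn
  rw [h.ext (encodes_wordPerm w)]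
  exact wordPerm_mem _ _ fun i hi => Subgroup.subset_closure (hW w hw i hi)

lemma sigma_zero_mem_G : σ₀ ∈ G32T9403 := sigma_mem 0
lemma sigma_one_mem_G : σ₁ ∈ G32T9403 := sigma_mem 1
lemma sigma_two_mem_G : σ₂ ∈ G32T9403 := sigma_mem 2

/-- Both generators fix the point `0`, and among the 384 codes only those of the twelve words in
`σ₀`, `σ₁` do so. -/
lemma mem_closure₁_iff {g : Equiv.Perm (Fin 32)} (hg : g ∈ G32T9403) :
    g ∈ Subgroup.closure {σ₀, σ₁} ↔ g 0 = 0 := by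
  constructor
  · have : Subgroup.closure {σ₀, σ₁} ≤ MulAction.stabilizer (Equiv.Perm (Fin 32)) (0 : Fin 32) := by
      rw [Subgroup.closure_le]
      rintro _ (rfl | rfl) <;> · change _ = _; decide +kernel
    exact fun h => this h
  · intro h
    have key : ∀ n ∈ elementCodes, digit n 0 = 0 → n ∈ codes₁ := by decide +kernel
    obtain ⟨n, hn, he⟩ := exists_encodes hg
    have := key n hn ((he 0).symm.trans (by simp [h]))
    rw [codes₁_eq] at this
    refine mem_closure_of_codes ?_ this he
    have : ∀ w ∈ words₁, ∀ i ∈ w, i = 0 ∨ i = 1 := by decide +kernel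
    intro w hw i hi
    rcases this w hw i hi with rfl | rfl <;> simp [sigma]

/-- `σ₀` interchanges 30 and 31 and `σ₂` fixes both, while the codes that preserve this pair are
those of the twelve words in `σ₀`, `σ₂`. Pairs thus play for the second subgroup the role of points
for the first. -/
lemma mem_closure₂_iff {g : Equiv.Perm (Fin 32)} (hg : g ∈ G32T9403) :
    g ∈ Subgroup.closure {σ₀, σ₂} ↔ (pair 0).map g = pair 0 := by
  constructor
  · intro h
    clear hg
    induction h using Subgroup.closure_induction with
    | mem x hx =>
      rcases hx with rfl | rfl
      · exact map_sigma_pair 0 0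
      · exact map_sigma_pair 2 0
    | one => simp
    | mul x y hx hy ihx ihy => rw [Equiv.Perm.coe_mul, ← Sym2.map_map, ihy, ihx]
    | inv x hx ih =>
      rw [← ih, Sym2.map_map, ← Equiv.Perm.coe_mul, inv_mul_cancel, Equiv.Perm.coe_one,
        Sym2.map_id, ih]
      rfl
  · intro h
    have key : ∀ n ∈ elementCodes, (digit n 30 = 30 ∧ digit n 31 = 31 ∨
        digit n 30 = 31 ∧ digit n 31 = 30) → n ∈ codes₂ := by decide +kernel
    obtain ⟨n, hn, he⟩ := exists_encodes hg
    have h30 := he 30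
    have h31 := he 31
    have := key n hn (by
      rw [show pair 0 = s(30, 31) from rfl, Sym2.map_mk, Sym2.eq_iff] at h
      rcases h with ⟨h1, h2⟩ | ⟨h1, h2⟩
      · left; rw [h1] at h30; rw [h2] at h31; exact ⟨h30.symm, h31.symm⟩
      · right; rw [h1] at h30; rw [h2] at h31; exact ⟨h30.symm, h31.symm⟩)
    rw [codes₂_eq] at this
    refine mem_closure_of_codes ?_ this he
    have : ∀ w ∈ words₂, ∀ i ∈ w, i = 0 ∨ i = 2 := by decide +kernel
    intro w hw i hi
    rcases this w hw i hi with rfl | rfl <;> simp [sigma]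


/-! ### Indices, cores and non-conjugacy -/

instance : MulAction.IsPretransitive G32T9403 (Fin 32) := by
  refine ⟨fun a b => ?_⟩
  obtain ⟨g, hg, rfl⟩ := exists_apply_zero a
  obtain ⟨h, hh, rfl⟩ := exists_apply_zero b
  exact ⟨⟨h * g⁻¹, G32T9403.mul_mem hh (G32T9403.inv_mem hg)⟩, by
    change (h * g⁻¹) (g 0) = h 0
    simp⟩

lemma exists_equiv_quotient {G α : Type*} [Group G] (H : Subgroup G) (f : G → α)
    (hf : ∀ g g', f g = f g' ↔ g⁻¹ * g' ∈ H) (hs : Function.Surjective f) :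
    ∃ e : G ⧸ H ≃ α, ∀ g : G, e g = f g := by
  refine ⟨Equiv.ofBijective
    (Quotient.lift f fun g g' h => (hf g g').2 (QuotientGroup.leftRel_apply.1 h)) ⟨?_, ?_⟩,
    fun g => rfl⟩
  · rintro ⟨g⟩ ⟨g'⟩ h
    exact QuotientGroup.eq.2 ((hf g g').1 h)
  · intro a
    obtain ⟨g, rfl⟩ := hs a
    exact ⟨g, rfl⟩

lemma mem_subH₁_iff (g : G32T9403) : g ∈ subH₁ ↔ (g : Equiv.Perm (Fin 32)) 0 = 0 :=
  Subgroup.mem_subgroupOf.trans (mem_closure₁_iff g.2)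

lemma mem_subH₂_iff (g : G32T9403) :
    g ∈ subH₂ ↔ (pair 0).map (g : Equiv.Perm (Fin 32)) = pair 0 :=
  Subgroup.mem_subgroupOf.trans (mem_closure₂_iff g.2)

lemma exists_equiv₁ : ∃ e : G32T9403 ⧸ subH₁ ≃ Fin 32,
    ∀ g : G32T9403, e g = (g : Equiv.Perm (Fin 32)) 0 := by
  refine exists_equiv_quotient subH₁ _ (fun g g' => ?_) fun a => ?_
  · rw [mem_subH₁_iff, Subgroup.coe_mul, Subgroup.coe_inv, Equiv.Perm.mul_apply,
      Equiv.Perm.inv_eq_iff_eq, eq_comm]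
  · obtain ⟨g, hg, h⟩ := exists_apply_zero a
    exact ⟨⟨g, hg⟩, h⟩

/-- The position of the image of the pair `{30, 31}` in the orbit. -/
noncomputable def pairOf (g : G32T9403) (b : Fin 32) : Fin 32 := (exists_map_pair g.2 b).choose

lemma map_pair (g : G32T9403) (b : Fin 32) :
    (pair b).map (g : Equiv.Perm (Fin 32)) = pair (pairOf g b) :=
  (exists_map_pair g.2 b).choose_spec.1

lemma pairIndex_smul (g : G32T9403) (a b : Fin 32) :
    pairIndex ((g : Equiv.Perm (Fin 32)) a) (pairOf g b) = pairIndex a b :=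
  (exists_map_pair g.2 b).choose_spec.2 a

lemma pairOf_mul (g h : G32T9403) (b : Fin 32) : pairOf (g * h) b = pairOf g (pairOf h b) := by
  apply pair_injective
  rw [← map_pair, ← map_pair, ← map_pair, Sym2.map_map]
  rfl

lemma pairOf_one (b : Fin 32) : pairOf 1 b = b := by
  apply pair_injective
  rw [← map_pair]; simp

lemma mem_subH₂_iff_pairOf (g : G32T9403) : g ∈ subH₂ ↔ pairOf g 0 = 0 := by
  rw [mem_subH₂_iff, map_pair, pair_injective.eq_iff]

lemma exists_pairOf (b : Fin 32) : ∃ g : G32T9403, pairOf g 0 = b := by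
  have h : ∀ b : Fin 32, ∃ n ∈ elementCodes,
      s(Fin.ofNat 32 (digit n 30), Fin.ofNat 32 (digit n 31)) = pair b := by decide +kernel
  obtain ⟨n, hn, hb⟩ := h b
  obtain ⟨g, hg, he⟩ := exists_of_mem_elementCodes hn
  refine ⟨⟨g, hg⟩, pair_injective ?_⟩
  have h30 : (g 30 : ℕ) = digit n 30 := he 30
  have h31 : (g 31 : ℕ) = digit n 31 := he 31
  rw [← map_pair, ← hb, ← h30, ← h31, show pair 0 = s(30, 31) from rfl]
  simp

lemma exists_equiv₂ : ∃ e : G32T9403 ⧸ subH₂ ≃ Fin 32, ∀ g : G32T9403, e g = pairOf g 0 := by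
  refine exists_equiv_quotient subH₂ _ (fun g g' => ?_) exists_pairOf
  rw [mem_subH₂_iff_pairOf, pairOf_mul]
  constructor
  · intro h
    rw [← h, ← pairOf_mul, inv_mul_cancel, pairOf_one]
  · intro h
    have := congrArg (pairOf g) h
    rwa [← pairOf_mul, mul_inv_cancel, pairOf_one, eq_comm] at this

lemma index_subH₁ : subH₁.index = 32 := by
  obtain ⟨e, -⟩ := exists_equiv₁
  rw [Subgroup.index, Nat.card_congr e, Nat.card_fin]

lemma index_subH₂ : subH₂.index = 32 := by
  obtain ⟨e, -⟩ := exists_equiv₂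
  rw [Subgroup.index, Nat.card_congr e, Nat.card_fin]

lemma card_of_index {K : Subgroup G32T9403} (h : K.index = 32) : Nat.card K = 12 := by
  have := K.card_mul_index
  rw [h, card_G32T9403] at this
  omega

/-- The core lies in the stabilizer of every point, by transitivity. -/
lemma normalCore_subH₁ : subH₁.normalCore = ⊥ := by
  rw [eq_bot_iff]
  intro n hn
  rw [Subgroup.mem_bot]
  ext a
  obtain ⟨g, hg, rfl⟩ := exists_apply_zero a
  have := (mem_subH₁_iff _).1 (hn (⟨g, hg⟩⁻¹))
  simp only [inv_inv, Subgroup.coe_mul, Subgroup.coe_inv, Equiv.Perm.mul_apply,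
    Equiv.Perm.inv_eq_iff_eq] at this
  rw [this]; simp

lemma normalCore_subH₂ : subH₂.normalCore = ⊥ := by
  rw [eq_bot_iff]
  intro n hn
  rw [Subgroup.mem_bot]
  -- The core preserves every pair of the orbit, and only the identity does that.
  have key : ∀ m ∈ elementCodes, (∀ b, (pair b).map (fun i : Fin 32 => Fin.ofNat 32 (digit m i)) = pair b) →
      m = wordCode [] := by decide +kernel
  obtain ⟨m, hm, he⟩ := exists_encodes n.2
  have hfun : (fun i : Fin 32 => Fin.ofNat 32 (digit m i)) = (n : Equiv.Perm (Fin 32)) := by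
    funext i; rw [← he i]; simp
  have := key m hm fun b => by
    obtain ⟨g, rfl⟩ := exists_pairOf b
    have h := (mem_subH₂_iff_pairOf _).1 (hn g⁻¹)
    have h' := congrArg (pairOf g) h
    rw [inv_inv, ← pairOf_mul, ← mul_assoc, mul_inv_cancel_left, pairOf_mul] at h'
    rw [hfun, map_pair, h']
  rw [this] at he
  exact Subtype.ext (he.ext encodes_one)

/-- A conjugate of the first subgroup fixes a point, but `σ₀` and `σ₂` have no common fixed point.
-/
lemma not_conj_subH₁_subH₂ (g : G32T9403) : subH₁.map (MulAut.conj g).toMonoidHom ≠ subH₂ := by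
  intro h
  have fix : ∀ x ∈ subH₂, (x : Equiv.Perm (Fin 32)) ((g : Equiv.Perm (Fin 32)) 0) =
      (g : Equiv.Perm (Fin 32)) 0 := by
    intro x hx
    rw [← h] at hx
    obtain ⟨y, hy, rfl⟩ := hx
    have := (mem_subH₁_iff _).1 hy
    simp [this]
  have h0 := fix ⟨σ₀, sigma_zero_mem_G⟩
    (Subgroup.mem_subgroupOf.2 (Subgroup.subset_closure (by simp)))
  have h2 := fix ⟨σ₂, sigma_two_mem_G⟩
    (Subgroup.mem_subgroupOf.2 (Subgroup.subset_closure (by simp)))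
  have key : ∀ a, σ₀ a = a → σ₂ a ≠ a := by decide +kernel
  exact key _ h0 h2

/-! ### Recognition of dihedral groups -/

lemma pow_val_add_val {Γ : Type*} [Monoid Γ] {n : ℕ} [NeZero n] {r : Γ} (hr : r ^ n = 1)
    (i j : ZMod n) : r ^ (i + j).val = r ^ i.val * r ^ j.val := by
  rw [ZMod.val_add, ← pow_eq_pow_mod _ hr, pow_add]

/-- The homomorphism from a dihedral group given by a rotation and a reflection. -/
noncomputable def dihedralHom {Γ : Type*} [Group Γ] {n : ℕ} [NeZero n] (r s : Γ) (hr : r ^ n = 1)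
    (hs : s * s = 1) (hsr : s * r * s = r⁻¹) : DihedralGroup n →* Γ :=
  MonoidHom.mk' (fun
    | .r i => r ^ i.val
    | .sr i => s * r ^ i.val) <| by
    have hs' : s⁻¹ = s := inv_eq_of_mul_eq_one_left hs
    have hconj (k : ℕ) : r ^ k * s = s * (r ^ k)⁻¹ := by
      have : (s * r * s⁻¹) ^ k = s * r ^ k * s⁻¹ := conj_pow
      rw [hs', hsr, inv_pow] at this
      rw [this, ← mul_assoc, ← mul_assoc, hs, one_mul]
    have hneg (i j : ZMod n) : r ^ (j - i).val = (r ^ i.val)⁻¹ * r ^ j.val := by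
      rw [eq_inv_mul_iff_mul_eq, ← pow_val_add_val hr, add_sub_cancel]
    rintro (i | i) (j | j)
    · exact pow_val_add_val hr i j
    · change s * r ^ (j - i).val = r ^ i.val * (s * r ^ j.val)
      rw [hneg, ← mul_assoc, ← mul_assoc, hconj]
    · change s * r ^ (i + j).val = s * r ^ i.val * r ^ j.val
      rw [pow_val_add_val hr, mul_assoc]
    · change r ^ (j - i).val = s * r ^ i.val * (s * r ^ j.val)
      rw [hneg, mul_assoc s, ← mul_assoc _ s, hconj, mul_assoc s, ← mul_assoc s, hs, one_mul]

/-- The relations give a homomorphism from the dihedral group whose range contains `K`; since `K`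
already has order `2 * n`, it equals the range and the homomorphism is injective. -/
lemma nonempty_mulEquiv_dihedral {Γ : Type*} [Group Γ] {n : ℕ} [NeZero n] {r s : Γ}
    (hr : r ^ n = 1) (hs : s * s = 1) (hsr : s * r * s = r⁻¹) {K : Subgroup Γ}
    (hK : K ≤ Subgroup.closure {r, s}) (hcard : Nat.card K = 2 * n) :
    Nonempty (K ≃* DihedralGroup n) := by
  let φ := dihedralHom r s hr hs hsr
  have hle : K ≤ φ.range := by
    refine hK.trans ((Subgroup.closure_le _).2 ?_)
    rintro x (hx | hx)
    · rw [hx]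
      rcases Nat.lt_or_ge 1 n with h | h
      · have : Fact (1 < n) := ⟨h⟩
        refine ⟨.r 1, ?_⟩
        change r ^ (1 : ZMod n).val = r
        rw [ZMod.val_one, pow_one]
      -- In `ZMod 1` the residue `1` has value `0`, so this case is separate; here `r` is trivial.
      · obtain rfl : n = 1 := le_antisymm h (NeZero.pos n)
        rw [pow_one] at hr
        rw [hr]; exact φ.range.one_mem
    · rw [Set.mem_singleton_iff.1 hx]
      refine ⟨.sr 0, ?_⟩
      change s * r ^ (0 : ZMod n).val = s
      rw [ZMod.val_zero, pow_zero, mul_one]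
  have : Finite φ.range := Finite.of_surjective _ φ.rangeRestrict_surjective
  have hc : Nat.card φ.range ≤ 2 * n :=
    (Nat.card_le_card_of_surjective _ φ.rangeRestrict_surjective).trans_eq DihedralGroup.nat_card
  have hKr : K = φ.range := Subgroup.eq_of_le_of_card_ge hle (hcard ▸ hc)
  have hinj : Function.Bijective φ.rangeRestrict :=
    (Nat.bijective_iff_surjective_and_card _).2 ⟨φ.rangeRestrict_surjective, by
      rw [← hKr, hcard, DihedralGroup.nat_card]⟩
  exact ⟨(MulEquiv.subgroupCongr hKr).trans (MulEquiv.ofBijective _ hinj).symm⟩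

lemma subgroupOf_le_closure {Γ : Type*} [Group Γ] {K : Subgroup Γ} {x y : Γ} (hx : x ∈ K)
    (hy : y ∈ K) : (Subgroup.closure {x, y}).subgroupOf K ≤
      Subgroup.closure {(⟨x, hx⟩ : K), ⟨y, hy⟩} := by
  rw [← Subgroup.map_subtype_le_map_subtype, MonoidHom.map_closure, Subgroup.subgroupOf_map_subtype]
  refine inf_le_left.trans (Subgroup.closure_mono ?_)
  simp [Set.image_insert_eq]

lemma sigma_zero_pow : σ₀ ^ 6 = 1 := by ext i; revert i; decide +kernel
lemma sigma_one_mul_self : σ₁ * σ₁ = 1 := by ext i; revert i; decide +kernel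
lemma sigma_two_mul_self : σ₂ * σ₂ = 1 := by ext i; revert i; decide +kernel
lemma sigma_one_conj : σ₁ * σ₀ * σ₁ = σ₀⁻¹ := by ext i; revert i; decide +kernel
lemma sigma_two_conj : σ₂ * σ₀ * σ₂ = σ₀⁻¹ := by ext i; revert i; decide +kernel

lemma nonempty_subgroupOf_mulEquiv_dihedral {s : Equiv.Perm (Fin 32)} (hsG : s ∈ G32T9403)
    (hs : s * s = 1) (hsr : s * σ₀ * s = σ₀⁻¹)
    (hcard : Nat.card ((Subgroup.closure {σ₀, s}).subgroupOf G32T9403) = 12) :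
    Nonempty ((Subgroup.closure {σ₀, s}).subgroupOf G32T9403 ≃* DihedralGroup 6) := by
  refine nonempty_mulEquiv_dihedral (n := 6) ?_ ?_ ?_
    (subgroupOf_le_closure sigma_zero_mem_G hsG) hcard
  · rw [Subtype.ext_iff, Subgroup.coe_pow, Subgroup.coe_one, sigma_zero_pow]
  · rw [Subtype.ext_iff, Subgroup.coe_mul, Subgroup.coe_one, hs]
  · rw [Subtype.ext_iff, Subgroup.coe_mul, Subgroup.coe_mul, Subgroup.coe_inv, hsr]

lemma nonempty_subH₁_mulEquiv : Nonempty (subH₁ ≃* DihedralGroup 6) :=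
  nonempty_subgroupOf_mulEquiv_dihedral sigma_one_mem_G sigma_one_mul_self sigma_one_conj
    (card_of_index index_subH₁)

lemma nonempty_subH₂_mulEquiv : Nonempty (subH₂ ≃* DihedralGroup 6) :=
  nonempty_subgroupOf_mulEquiv_dihedral sigma_two_mem_G sigma_two_mul_self sigma_two_conj
    (card_of_index index_subH₂)


/-! ### Classification of the core-free subgroups of index 32 -/

/-- The code of the central involution `σ₃ ^ 2`. -/
def centralCode : ℕ := comp (sigmaCode 3) (sigmaCode 3)

/-- The group generated by the permutation with code `n` contains the central involution. -/
def reachesCentral (n : ℕ) : Bool :=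
  -- The group order is `2 ^ 7 * 3`. An involution among the powers of `g` is `g ^ 3`, `g ^ 6` or `g
  -- ^ 12` when the 2-part of the order of `g` is 2, 4 or 8.
  withValue (comp (comp n n) n) fun n₃ => n₃.beq centralCode ||
    withValue (comp n₃ n₃) fun n₆ => n₆.beq centralCode || (comp n₆ n₆).beq centralCode

/-- The code of `σ₀ ^ 2`. -/
def cubeCode : ℕ := comp (sigmaCode 0) (sigmaCode 0)

/-- One of the words in `u`, `b` generates a group containing the central involution. -/
def excludes (u b : ℕ) : Bool :=
  reachesCentral b || reachesCentral (comp u b) || withValue (comp u u) fun uu =>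
    reachesCentral (comp uu b) || withValue (comp u (comp b b)) fun ubb =>
      reachesCentral ubb || reachesCentral (comp u ubb) || reachesCentral (comp (comp u uu) b)

/-- With Cauchy's theorem, this single class of elements of order three allows the assumption that
`σ₀ ^ 2` lies in the subgroup. -/
lemma all_order_three : elementCodes.all (fun n =>
    !(comp n (comp n n)).beq (wordCode []) || n.beq (wordCode []) ||
      elementCodes.any fun s => (comp s cubeCode).beq (comp n s)) = true := by
  decide +kernel

/-- An element that does not normalize the group generated by `t = σ₀ ^ 2` generates the central
involution together with `t`. -/
lemma all_normalize : elementCodes.all (fun n => excludes cubeCode n ||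
    (comp n cubeCode).beq (comp cubeCode n) ||
      (comp n cubeCode).beq (comp (comp cubeCode cubeCode) n)) = true := by
  decide +kernel

/-- For `v` commuting with `t = σ₀ ^ 2` and outside the powers of `t`, one of `v`, `v ^ 5`, `v * t ^
2` is a square root of `t`. The root `t ^ 2` is ruled out because it is itself a power of `t`; the
composition with the identity code truncates a code before the comparison. -/
lemma all_centralize : elementCodes.all (fun n => excludes cubeCode n ||
    !(comp n cubeCode).beq (comp cubeCode n) || n.beq (wordCode []) || n.beq cubeCode ||
      n.beq (comp cubeCode cubeCode) || [n, comp n (comp (comp n n) (comp n n)),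
        comp n (comp cubeCode cubeCode)].any fun u =>
          (comp u u).beq cubeCode && !(comp u (wordCode [])).beq (comp cubeCode cubeCode)) = true := by
  decide +kernel

/-- A square root `u` of `σ₀ ^ 2` that is not conjugate to `σ₀` may survive, but then it admits no
companions outside its own powers, which are too few for a subgroup of order 12. -/
lemma all_square_root : elementCodes.all (fun n => !(comp n n).beq cubeCode ||
    n.beq (comp cubeCode cubeCode) || reachesCentral n ||
      elementCodes.any (fun s => (comp s (sigmaCode 0)).beq (comp n s)) ||
        elementCodes.all fun b => excludes n b || [wordCode [], n, cubeCode, comp cubeCode n,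
          comp cubeCode cubeCode, comp (comp cubeCode cubeCode) n].any b.beq) = true := by
  decide +kernel

/-- Once `σ₀` is present, every element outside the two subgroups produces the central involution.
-/
lemma all_rotation : elementCodes.all (fun n => excludes (sigmaCode 0) n ||
    codes₁.any n.beq || codes₂.any n.beq) = true := by
  decide +kernel


/-- The rotation `σ₀` as an element of the group. -/
noncomputable def rotation : G32T9403 := ⟨σ₀, sigma_mem 0⟩

/-- The central involution `σ₃ ^ 2`. -/
noncomputable def centralInvolution : G32T9403 := ⟨σ₃, sigma_mem 3⟩ * ⟨σ₃, sigma_mem 3⟩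

lemma encodes_centralInvolution :
    Encodes centralCode (centralInvolution : Equiv.Perm (Fin 32)) :=
  (encodes_sigma 3).mul (encodes_sigma 3)

lemma encodes_cube : Encodes cubeCode ((rotation * rotation : G32T9403) : Equiv.Perm (Fin 32)) :=
  (encodes_sigma 0).mul (encodes_sigma 0)

lemma encodes_rotation : Encodes (sigmaCode 0) (rotation : Equiv.Perm (Fin 32)) := encodes_sigma 0

lemma Encodes.mul_coe {m n : ℕ} {g h : G32T9403} (hm : Encodes m (g : Equiv.Perm (Fin 32)))
    (hn : Encodes n (h : Equiv.Perm (Fin 32))) :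
    Encodes (comp m n) ((g * h : G32T9403) : Equiv.Perm (Fin 32)) := hm.mul hn

lemma Encodes.eq_of_beq {m n : ℕ} {g h : G32T9403} (hm : Encodes m (g : Equiv.Perm (Fin 32)))
    (hn : Encodes n (h : Equiv.Perm (Fin 32))) (e : m.beq n = true) : g = h := by
  rw [Nat.eq_of_beq_eq_true e] at hm
  exact Subtype.ext (hm.ext hn)

section

variable {K : Subgroup G32T9403}

lemma not_reachesCentral (hz : centralInvolution ∉ K) {v : G32T9403} (hv : v ∈ K) {n : ℕ}
    (he : Encodes n (v : Equiv.Perm (Fin 32))) : reachesCentral n = false := by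
  rw [← Bool.not_eq_true]
  intro h
  have key {m : ℕ} {w : G32T9403} (hw : w ∈ K) (hm : Encodes m (w : Equiv.Perm (Fin 32)))
      (e : m.beq centralCode = true) : False :=
    hz (hm.eq_of_beq encodes_centralInvolution e ▸ hw)
  have h3 := (he.mul_coe he).mul_coe he
  have hv3 := K.mul_mem (K.mul_mem hv hv) hv
  simp only [reachesCentral, withValue_eq, Bool.or_eq_true] at h
  rcases h with h | h | h
  · exact key hv3 h3 h
  · exact key (K.mul_mem hv3 hv3) (h3.mul_coe h3) h
  · exact key (K.mul_mem (K.mul_mem hv3 hv3) (K.mul_mem hv3 hv3))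
      ((h3.mul_coe h3).mul_coe (h3.mul_coe h3)) h

lemma not_excludes (hz : centralInvolution ∉ K) {u b : G32T9403} (hu : u ∈ K) (hb : b ∈ K)
    {m n : ℕ} (hm : Encodes m (u : Equiv.Perm (Fin 32)))
    (hn : Encodes n (b : Equiv.Perm (Fin 32))) : excludes m n = false := by
  have hmm := hm.mul_coe hm
  have huu := K.mul_mem hu hu
  have hubb := K.mul_mem hu (K.mul_mem hb hb)
  have ebb := hm.mul_coe (hn.mul_coe hn)
  simp only [excludes, withValue_eq, Bool.or_eq_false_iff]
  exact ⟨⟨not_reachesCentral hz hb hn,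
    not_reachesCentral hz (K.mul_mem hu hb) (hm.mul_coe hn)⟩,
    not_reachesCentral hz (K.mul_mem huu hb) (hmm.mul_coe hn),
    ⟨not_reachesCentral hz hubb ebb, not_reachesCentral hz (K.mul_mem hu hubb) (hm.mul_coe ebb)⟩,
    not_reachesCentral hz (K.mul_mem (K.mul_mem hu huu) hb) ((hm.mul_coe hmm).mul_coe hn)⟩

lemma Encodes.not_beq {m n : ℕ} {g h : G32T9403} (hm : Encodes m (g : Equiv.Perm (Fin 32)))
    (hn : Encodes n (h : Equiv.Perm (Fin 32))) (e : g ≠ h) : m.beq n = false := by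
  rw [← Bool.not_eq_true]
  exact fun h => e (hm.eq_of_beq hn h)

/-- Equality of group elements is visible on codes of compositions. -/
lemma Encodes.comp_beq {m n m' n' : ℕ} {g h g' h' : G32T9403}
    (hm : Encodes m (g : Equiv.Perm (Fin 32))) (hn : Encodes n (h : Equiv.Perm (Fin 32)))
    (hm' : Encodes m' (g' : Equiv.Perm (Fin 32))) (hn' : Encodes n' (h' : Equiv.Perm (Fin 32)))
    (e : g * h = g' * h') : (comp m n).beq (comp m' n') = true := by
  have : comp m n = comp m' n' := by
    have key : ∀ k ≤ 32, compDigits m n k = compDigits m' n' k := by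
      intro k hk
      induction k with
      | zero => rfl
      | succ k ih =>
        have h1 := hm.mul_coe hn ⟨k, hk⟩
        have h2 := hm'.mul_coe hn' ⟨k, hk⟩
        rw [e] at h1
        rw [h1] at h2
        rw [compDigits_succ, compDigits_succ, ih (by omega)]
        rw [comp, comp, digit_compDigits _ _ _ _ hk, digit_compDigits _ _ _ _ hk] at h2
        rw [h2]
    exact key 32 le_rfl
  rw [this]; exact Nat.beq_refl _

lemma exists_conj_of_pow_three {v : G32T9403} (hv : v ^ 3 = 1) (hv1 : v ≠ 1) :
    ∃ g : G32T9403, g * (rotation * rotation) = v * g := by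
  obtain ⟨n, hn, he, h⟩ := forall_mem_of_all all_order_three v.2
  have h3 : (comp n (comp n n)).beq (wordCode []) = true := by
    have h1 : (comp n (comp n n)).beq (comp (wordCode []) (wordCode [])) = true :=
      he.comp_beq (he.mul_coe he) (g' := 1) (h' := 1) encodes_one encodes_one
        (by rw [← pow_two, ← pow_succ', hv, one_mul])
    have h2 : comp (wordCode []) (wordCode []) = wordCode [] := by decide +kernel
    rwa [h2] at h1
  have h1 := he.not_beq (h := 1) encodes_one hv1
  simp only [h3, h1, Bool.not_true, Bool.false_or, List.any_eq_true] at h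
  obtain ⟨s, hs, h⟩ := h
  obtain ⟨g, hg, hsg⟩ := exists_of_mem_elementCodes hs
  exact ⟨⟨g, hg⟩, Encodes.eq_of_beq (Encodes.mul_coe (g := ⟨g, hg⟩) hsg encodes_cube)
    (he.mul_coe (h := ⟨g, hg⟩) hsg) h⟩

lemma normalizes (hz : centralInvolution ∉ K) (ht : rotation * rotation ∈ K) {v : G32T9403}
    (hv : v ∈ K) : v * (rotation * rotation) = rotation * rotation * v ∨
      v * (rotation * rotation) = rotation * rotation * (rotation * rotation) * v := by
  obtain ⟨n, hn, he, h⟩ := forall_mem_of_all all_normalize v.2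
  simp only [not_excludes hz ht hv encodes_cube he, Bool.false_or, Bool.or_eq_true] at h
  exact h.imp ((he.mul_coe encodes_cube).eq_of_beq (encodes_cube.mul_coe he))
    ((he.mul_coe encodes_cube).eq_of_beq ((encodes_cube.mul_coe encodes_cube).mul_coe he))

lemma exists_square_root (hz : centralInvolution ∉ K) (ht : rotation * rotation ∈ K)
    {v : G32T9403} (hv : v ∈ K) (hc : v * (rotation * rotation) = rotation * rotation * v)
    (h1 : v ≠ 1) (h2 : v ≠ rotation * rotation)
    (h3 : v ≠ rotation * rotation * (rotation * rotation)) :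
    ∃ u ∈ K, u * u = rotation * rotation ∧ u ≠ rotation * rotation * (rotation * rotation) := by
  obtain ⟨n, hn, he, h⟩ := forall_mem_of_all all_centralize v.2
  have ett := encodes_cube.mul_coe encodes_cube
  simp only [not_excludes hz ht hv encodes_cube he, he.comp_beq encodes_cube encodes_cube he hc,
    he.not_beq (h := 1) encodes_one h1, he.not_beq encodes_cube h2, he.not_beq ett h3,
    Bool.not_true, Bool.false_or, List.any_eq_true, Bool.and_eq_true] at h
  obtain ⟨m, hm, h, h'⟩ := h
  have key {u : G32T9403} (hu : u ∈ K) (hmu : Encodes m (u : Equiv.Perm (Fin 32))) :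
      ∃ u ∈ K, u * u = rotation * rotation ∧ u ≠ rotation * rotation * (rotation * rotation) := by
    refine ⟨u, hu, (hmu.mul_coe hmu).eq_of_beq encodes_cube h, fun e => ?_⟩
    have := hmu.comp_beq (h := 1) encodes_one encodes_cube encodes_cube (by rw [mul_one, e])
    rw [this] at h'
    exact absurd h' (by simp)
  simp only [List.mem_cons, List.not_mem_nil, or_false] at hm
  rcases hm with rfl | rfl | rfl
  · exact key hv he
  · exact key (K.mul_mem hv (K.mul_mem (K.mul_mem hv hv) (K.mul_mem hv hv)))
      (he.mul_coe ((he.mul_coe he).mul_coe (he.mul_coe he)))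
  · exact key (K.mul_mem hv (K.mul_mem ht ht)) (he.mul_coe ett)

/-- A subgroup of order 12 that contains a square root `u` of `σ₀ ^ 2` and avoids the centre
contains a conjugate of `σ₀`. -/
lemma exists_conj_of_square (hz : centralInvolution ∉ K) (hcard : Nat.card K = 12)
    {u : G32T9403} (hu : u ∈ K) (hsq : u * u = rotation * rotation)
    (hne : u ≠ rotation * rotation * (rotation * rotation)) :
    ∃ g : G32T9403, g * rotation = u * g := by
  obtain ⟨n, hn, he, h⟩ := forall_mem_of_all all_square_root u.2
  have ett := encodes_cube.mul_coe encodes_cube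
  have e2 : (comp n n).beq cubeCode = true := he.comp_beq he encodes_rotation encodes_rotation hsq
  simp only [e2, he.not_beq ett hne, not_reachesCentral hz hu he, Bool.not_true, Bool.false_or,
    Bool.or_eq_true, List.any_eq_true, List.all_eq_true] at h
  rcases h with ⟨s, hs, h⟩ | h
  · obtain ⟨g, hg, hsg⟩ := exists_of_mem_elementCodes hs
    exact ⟨⟨g, hg⟩, Encodes.eq_of_beq (Encodes.mul_coe (g := ⟨g, hg⟩) hsg encodes_rotation)
      (he.mul_coe (h := ⟨g, hg⟩) hsg) h⟩
  -- In the remaining case all of `K` lies among the at most six products of powers of `u`, against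
  -- its order 12.
  · exfalso
    have hle : (K : Set G32T9403) ⊆ (({1, u, rotation * rotation, rotation * rotation * u,
        rotation * rotation * (rotation * rotation),
        rotation * rotation * (rotation * rotation) * u} : Finset G32T9403) : Set G32T9403) := by
      intro b hb
      obtain ⟨m, hm, hbm⟩ := exists_encodes b.2
      have := h m hm
      rw [not_excludes hz hu hb he hbm] at this
      obtain ⟨x, hx, hbx⟩ := this.resolve_left (by simp)
      simp only [Finset.coe_insert, Finset.coe_singleton, Set.mem_insert_iff,
        Set.mem_singleton_iff]
      simp only [List.mem_cons, List.not_mem_nil, or_false] at hx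
      rcases hx with rfl | rfl | rfl | rfl | rfl | rfl
      · exact .inl (hbm.eq_of_beq (h := 1) encodes_one hbx)
      · exact .inr (.inl (hbm.eq_of_beq he hbx))
      · exact .inr (.inr (.inl (hbm.eq_of_beq encodes_cube hbx)))
      · exact .inr (.inr (.inr (.inl (hbm.eq_of_beq (encodes_cube.mul_coe he) hbx))))
      · exact .inr (.inr (.inr (.inr (.inl (hbm.eq_of_beq ett hbx)))))
      · exact .inr (.inr (.inr (.inr (.inr (hbm.eq_of_beq (ett.mul_coe he) hbx)))))
    have h1 := Set.ncard_le_ncard hle (Finset.finite_toSet _)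
    rw [Set.ncard_coe_finset, ← Nat.card_coe_set_eq, SetLike.coe_sort_coe, hcard] at h1
    exact absurd (h1.trans Finset.card_le_six) (by norm_num)

/-- More than half of a group that normalizes a group of order three centralizes it. -/
lemma exists_centralizing {Γ : Type*} [Group Γ] {K : Subgroup Γ} {t : Γ} (hcard : Nat.card K = 12)
    (h : ∀ v ∈ K, v * t = t * v ∨ v * t = t * t * v) (ht : t * t * t = 1) :
    ∃ v ∈ K, v * t = t * v ∧ v ≠ 1 ∧ v ≠ t ∧ v ≠ t * t := by
  classical
  by_contra! hcon
  have hsub : ∀ v ∈ K, v * t = t * v → v ∈ ({1, t, t * t} : Finset Γ) := by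
    intro v hv hc
    have := hcon v hv hc
    simp only [Finset.mem_insert, Finset.mem_singleton]
    tauto
  -- Two elements that invert `t` differ by one that centralizes it. If only `1`, `t`, `t * t`
  -- centralized `t`, two translates of a set of at most three elements would cover `K`.
  have hle : ∃ k : Γ, (K : Set Γ) ⊆ (({1, t, t * t} ∪
      ({1, t, t * t} : Finset Γ).image (k * ·) : Finset Γ) : Set Γ) := by
    by_cases hk : ∃ k ∈ K, k * t ≠ t * k
    · obtain ⟨k, hk, hkt⟩ := hk
      refine ⟨k, fun v hv => ?_⟩
      rw [Finset.coe_union, Set.mem_union, Finset.mem_coe, Finset.mem_coe, Finset.mem_image]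
      by_cases hc : v * t = t * v
      · exact .inl (hsub v hv hc)
      · refine .inr ⟨k⁻¹ * v, hsub _ (K.mul_mem (K.inv_mem hk) hv) ?_, by simp⟩
        have h1 := (h v hv).resolve_left hc
        have h2 := (h k hk).resolve_left hkt
        have h3 : k * (t * t) = t * k := by
          rw [← mul_assoc, h2, mul_assoc, h2]
          calc t * t * (t * t * k) = t * t * t * (t * k) := by simp only [mul_assoc]
            _ = t * k := by rw [ht, one_mul]
        rw [mul_assoc, h1, inv_mul_eq_iff_eq_mul]
        have h4 : k * t * (k⁻¹ * v) = t * t * k * (k⁻¹ * v) := by rw [h2]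
        rw [← mul_assoc k, h4]
        simp [mul_assoc]
    · push Not at hk
      exact ⟨1, fun v hv => by
        rw [Finset.coe_union]; exact .inl (hsub v hv (hk v hv))⟩
  obtain ⟨k, hle⟩ := hle
  have h1 := Set.ncard_le_ncard hle (Finset.finite_toSet _)
  rw [Set.ncard_coe_finset, ← Nat.card_coe_set_eq, SetLike.coe_sort_coe, hcard] at h1
  have h3 : ({1, t, t * t} : Finset Γ).card ≤ 3 := Finset.card_le_three
  have h2 := (Finset.card_union_le ({1, t, t * t} : Finset Γ)
    (({1, t, t * t} : Finset Γ).image (k * ·)))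
  have h4 := Finset.card_image_le (s := ({1, t, t * t} : Finset Γ)) (f := (k * ·))
  omega

/-- By `all_rotation`, `K` is contained in the union of the two subgroups, hence in one of them, and
the orders agree. -/
lemma eq_of_rotation_mem (hz : centralInvolution ∉ K) (hcard : Nat.card K = 12)
    (hr : rotation ∈ K) : K = subH₁ ∨ K = subH₂ := by
  have hsub : (K : Set G32T9403) ⊆ (subH₁ : Set G32T9403) ∪ (subH₂ : Set G32T9403) := by
    intro b hb
    obtain ⟨n, hn, he, h⟩ := forall_mem_of_all all_rotation b.2
    simp only [not_excludes hz hr hb encodes_rotation he, Bool.false_or, Bool.or_eq_true,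
      List.any_eq_true] at h
    rcases h with ⟨m, hm, h⟩ | ⟨m, hm, h⟩
    · left
      have key : ∀ m ∈ codes₁, digit m 0 = 0 := by decide +kernel
      refine (mem_subH₁_iff b).2 (Fin.ext ?_)
      have := he 0
      rw [Nat.eq_of_beq_eq_true h] at this
      exact this.trans (key m hm)
    · right
      have key : ∀ m ∈ codes₂, s(digit m 30, digit m 31) = s(30, 31) := by decide +kernel
      refine (mem_subH₂_iff b).2 ?_
      apply Sym2.map.injective Fin.val_injective
      rw [Sym2.map_map, show pair 0 = s(30, 31) from rfl, Sym2.map_mk, Sym2.map_mk]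
      have h30 := he 30
      have h31 := he 31
      rw [Nat.eq_of_beq_eq_true h] at h30 h31
      simp only [Function.comp, h30, h31]
      exact key m hm
  rcases SubgroupClass.subset_union.1 hsub with h | h
  · left
    exact Subgroup.eq_of_le_of_card_ge h (by rw [hcard, card_of_index index_subH₁])
  · right
    exact Subgroup.eq_of_le_of_card_ge h (by rw [hcard, card_of_index index_subH₂])

end

lemma centralInvolution_comm (g : G32T9403) : g * centralInvolution = centralInvolution * g := by
  have key : ∀ i, sigma i * (σ₃ * σ₃) = σ₃ * σ₃ * sigma i := by
    intro i; ext a; revert i a; decide +kernel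
  apply Subtype.ext
  change (g : Equiv.Perm (Fin 32)) * (σ₃ * σ₃) = σ₃ * σ₃ * g
  refine induction_G32T9403 (P := fun g => g * (σ₃ * σ₃) = σ₃ * σ₃ * g) (by simp)
    (fun i g ih => ?_) g.2
  rw [mul_assoc, ih, ← mul_assoc, key, mul_assoc]

/-- A central element of `K` lies in every conjugate of `K`, hence in the core. -/
lemma centralInvolution_not_mem {K : Subgroup G32T9403} (h : K.normalCore = ⊥) :
    centralInvolution ∉ K := by
  intro hK
  have : centralInvolution ∈ K.normalCore := fun g => by
    rw [centralInvolution_comm, mul_inv_cancel_right]; exact hK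
  rw [h] at this
  replace this := Subgroup.mem_bot.1 this
  have h2 : σ₃ * σ₃ = 1 := by
    rw [Subtype.ext_iff, centralInvolution, Subgroup.coe_mul, Subgroup.coe_one] at this
    exact this
  have h1 := DFunLike.congr_fun h2 0
  rw [Equiv.Perm.mul_apply, Equiv.Perm.one_apply] at h1
  revert h1
  decide +kernel

lemma conj_subgroup {K : Subgroup G32T9403} (hz : centralInvolution ∉ K) (hcard : Nat.card K = 12)
    (g : G32T9403) : centralInvolution ∉ K.map (MulAut.conj g).toMonoidHom ∧
      Nat.card (K.map (MulAut.conj g).toMonoidHom) = 12 := by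
  constructor
  · rintro ⟨x, hx, h⟩
    have : g * x * g⁻¹ = centralInvolution := h
    rw [mul_inv_eq_iff_eq_mul, ← centralInvolution_comm, mul_right_inj] at this
    exact hz (this ▸ hx)
  · rw [Subgroup.card_map_of_injective (MulAut.conj g).injective, hcard]

lemma map_conj_eq {K L : Subgroup G32T9403} {g : G32T9403}
    (h : K.map (MulAut.conj g).toMonoidHom = L) : L.map (MulAut.conj g⁻¹).toMonoidHom = K := by
  rw [← h, Subgroup.map_map]
  convert K.map_id
  ext x
  simp [mul_assoc]

/-- Two conjugations are needed: one brings an element of order three to `σ₀ ^ 2`, the other brings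
a square root of `σ₀ ^ 2` in the subgroup to `σ₀`. -/
lemma exists_conj_eq (K : Subgroup G32T9403) (hi : K.index = 32) (hc : K.normalCore = ⊥) :
    ∃ g : G32T9403, subH₁.map (MulAut.conj g).toMonoidHom = K ∨
      subH₂.map (MulAut.conj g).toMonoidHom = K := by
  have hz := centralInvolution_not_mem hc
  have hcard := card_of_index hi
  obtain ⟨⟨v, hv⟩, hv3⟩ := exists_prime_orderOf_dvd_card' (G := K) 3 (by rw [hcard]; norm_num)
  obtain ⟨hpow, hne⟩ := orderOf_eq_prime_iff.1 hv3
  obtain ⟨g, hg⟩ := exists_conj_of_pow_three (v := v) (congrArg Subtype.val hpow)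
    fun e => hne (Subtype.ext e)
  obtain ⟨hz', hcard'⟩ := conj_subgroup hz hcard g⁻¹
  have ht : rotation * rotation ∈ K.map (MulAut.conj g⁻¹).toMonoidHom :=
    ⟨v, hv, by
      change g⁻¹ * v * g⁻¹⁻¹ = _
      rw [inv_inv, mul_assoc, ← hg, inv_mul_cancel_left]⟩
  obtain ⟨w, hw, hwc, h1, h2, h3⟩ := exists_centralizing hcard'
    (fun v hv => normalizes hz' ht hv) (by
      have : rotation * rotation * (rotation * rotation) * (rotation * rotation) = rotation ^ 6 := by
        simp only [pow_succ, pow_zero, one_mul, mul_assoc]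
      rw [this, Subtype.ext_iff]; exact sigma_zero_pow)
  obtain ⟨u, hu, hsq, hne⟩ := exists_square_root hz' ht hw hwc h1 h2 h3
  obtain ⟨g', hg'⟩ := exists_conj_of_square hz' hcard' hu hsq hne
  obtain ⟨hz'', hcard''⟩ := conj_subgroup hz' hcard' g'⁻¹
  have hr : rotation ∈ (K.map (MulAut.conj g⁻¹).toMonoidHom).map (MulAut.conj g'⁻¹).toMonoidHom :=
    ⟨u, hu, by
      change g'⁻¹ * u * g'⁻¹⁻¹ = _
      rw [inv_inv, mul_assoc, ← hg', inv_mul_cancel_left]⟩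
  have key (L : Subgroup G32T9403) (h : (K.map (MulAut.conj g⁻¹).toMonoidHom).map
      (MulAut.conj g'⁻¹).toMonoidHom = L) : L.map (MulAut.conj (g * g')).toMonoidHom = K := by
    have h1 := map_conj_eq (map_conj_eq h)
    have h2 := map_conj_eq h
    rw [inv_inv] at h2
    have h3 := map_conj_eq (K := K) (g := g⁻¹) rfl
    rw [inv_inv, ← h2, Subgroup.map_map] at h3
    rw [← h3]
    congr 1
  rcases eq_of_rotation_mem hz'' hcard'' hr with h | h
  · exact ⟨g * g', .inl (key _ h)⟩
  · exact ⟨g * g', .inr (key _ h)⟩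


/-! ### Permutation modules and invariant matrices -/

section PermModule

variable {R : Type*} [CommRing R] {G : Type*} [Group G] [Finite G]

/-- The coordinates of an element of a permutation module. -/
noncomputable def coords (R : Type*) [CommRing R] {G : Type*} [Group G] [Finite G]
    (H : Subgroup G) : PermModule R H ≃ₗ[R] (G ⧸ H → R) :=
  (Representation.ofMulAction R G (G ⧸ H)).asModuleEquiv.trans
    ((MonoidAlgebra.coeffLinearEquiv R).trans (Finsupp.linearEquivFunOnFinite R R (G ⧸ H)))

lemma coords_apply (H : Subgroup G) (v : PermModule R H) (a : G ⧸ H) :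
    coords R H v a = ((Representation.ofMulAction R G (G ⧸ H)).asModuleEquiv v).coeff a := rfl

lemma coords_single_smul (H : Subgroup G) (g : G) (v : PermModule R H) (a : G ⧸ H) :
    coords R H (MonoidAlgebra.single g (1 : R) • v) a = coords R H v (g⁻¹ • a) := by
  rw [coords_apply, Representation.asModuleEquiv_map_smul, Representation.asAlgebraHom_single_one,
    Representation.coeff_ofMulAction]
  rfl

/-- The homomorphism of permutation modules given by an invariant matrix. -/
noncomputable def homOfInvariant {H₁ H₂ : Subgroup G} (N : G ⧸ H₁ → G ⧸ H₂ → R)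
    (hN : ∀ (g : G) a b, N (g • a) (g • b) = N a b) :
    PermModule R H₁ →ₗ[MonoidAlgebra R G] PermModule R H₂ :=
  letI := Fintype.ofFinite (G ⧸ H₁)
  MonoidAlgebra.equivariantOfLinearOfComm
    ((coords R H₂).symm.toLinearMap ∘ₗ (Matrix.of N).vecMulLinear ∘ₗ (coords R H₁).toLinearMap)
    fun g v => by
      apply (coords R H₂).injective
      ext b
      rw [coords_single_smul]
      simp only [LinearMap.comp_apply, LinearEquiv.coe_coe, LinearEquiv.apply_symm_apply,
        Matrix.vecMulLinear_apply, Matrix.vecMul, dotProduct, Matrix.of_apply, coords_single_smul]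
      rw [← Equiv.sum_comp (MulAction.toPerm g)]
      refine Finset.sum_congr rfl fun a _ => ?_
      rw [MulAction.toPerm_apply, inv_smul_smul, ← hN g a, smul_inv_smul]

lemma coords_homOfInvariant {H₁ H₂ : Subgroup G} [Fintype (G ⧸ H₁)] (N : G ⧸ H₁ → G ⧸ H₂ → R)
    (hN : ∀ (g : G) a b, N (g • a) (g • b) = N a b) (v : PermModule R H₁) :
    coords R H₂ (homOfInvariant N hN v) = Matrix.vecMul (coords R H₁ v) (Matrix.of N) := by
  have : coords R H₂ (homOfInvariant N hN v) =
      @Matrix.vecMul _ _ _ _ (Fintype.ofFinite _) (coords R H₁ v) (Matrix.of N) :=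
    LinearEquiv.apply_symm_apply _ _
  rw [this]
  congr!

/-- An invariant matrix of unit determinant is an isomorphism of permutation modules. -/
lemma nonempty_equiv_of_isUnit_det {H₁ H₂ : Subgroup G} {n : ℕ} (e₁ : G ⧸ H₁ ≃ Fin n)
    (e₂ : G ⧸ H₂ ≃ Fin n) (N : Matrix (Fin n) (Fin n) R)
    (hN : ∀ (g : G) a b, N (e₁ (g • a)) (e₂ (g • b)) = N (e₁ a) (e₂ b)) (hdet : IsUnit N.det) :
    Nonempty (PermModule R H₁ ≃ₗ[MonoidAlgebra R G] PermModule R H₂) := by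
  let _ := Fintype.ofFinite (G ⧸ H₁)
  let φ := homOfInvariant (R := R) (fun a b => N (e₁ a) (e₂ b)) hN
  have hφ (v : PermModule R H₁) : coords R H₂ (φ v) =
      fun b => Matrix.vecMul (coords R H₁ v ∘ e₁.symm) N (e₂ b) := by
    rw [coords_homOfInvariant]
    ext b
    simp only [Matrix.vecMul, dotProduct, Matrix.of_apply]
    rw [← Equiv.sum_comp e₁]
    simp
  refine ⟨LinearEquiv.ofBijective φ ⟨fun v w h => ?_, fun w => ?_⟩⟩
  · have h1 : (fun b => Matrix.vecMul (coords R H₁ v ∘ e₁.symm) N (e₂ b)) =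
        fun b => Matrix.vecMul (coords R H₁ w ∘ e₁.symm) N (e₂ b) := by
      rw [← hφ, ← hφ, h]
    have h2 : Matrix.vecMul (coords R H₁ v ∘ e₁.symm) N =
        Matrix.vecMul (coords R H₁ w ∘ e₁.symm) N := by
      ext j
      simpa using congrFun h1 (e₂.symm j)
    have h3 := Matrix.vecMul_injective_of_isUnit ((Matrix.isUnit_iff_isUnit_det _).2 hdet) h2
    apply (coords R H₁).injective
    ext a
    simpa using congrFun h3 (e₁ a)
  · refine ⟨(coords R H₁).symm (Matrix.vecMul (coords R H₂ w ∘ e₂.symm) N⁻¹ ∘ e₁), ?_⟩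
    apply (coords R H₂).injective
    rw [hφ]
    ext b
    rw [LinearEquiv.apply_symm_apply, Function.comp_assoc, Equiv.self_comp_symm,
      Function.comp_id, Matrix.vecMul_vecMul, Matrix.nonsing_inv_mul _ hdet, Matrix.vecMul_one]
    simp

end PermModule

section HomMatrix

variable {G : Type*} [Group G] [Finite G] {H₁ H₂ H₃ : Subgroup G} {n : ℕ}

lemma cosetCoeff_eq (H : Subgroup G) (v : PermModule ℤ H) (a : G ⧸ H) :
    cosetCoeff H v a = coords ℤ H v a := rfl

lemma coords_cosetVec (H : Subgroup G) (a : G ⧸ H) [DecidableEq (G ⧸ H)] :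
    coords ℤ H (cosetVec H a) = Pi.single a 1 := by
  ext b
  rw [coords_apply, cosetVec, LinearEquiv.apply_symm_apply, MonoidAlgebra.coeff_single,
    Finsupp.single_apply, Pi.single_apply]
  simp [eq_comm]

lemma smul_cosetVec (H : Subgroup G) (g : G) (a : G ⧸ H) :
    cosetVec H (g • a) = MonoidAlgebra.single g (1 : ℤ) • cosetVec H a := by
  classical
  apply (coords ℤ H).injective
  ext b
  rw [coords_single_smul, coords_cosetVec, coords_cosetVec, Pi.single_apply, Pi.single_apply]
  simp [inv_smul_eq_iff]

lemma homMatrix_smul (e₁ : G ⧸ H₁ ≃ Fin n) (e₂ : G ⧸ H₂ ≃ Fin n) (φ : PermHom H₁ H₂) (g : G)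
    (a : G ⧸ H₁) (b : G ⧸ H₂) :
    homMatrix e₁ e₂ φ (e₁ (g • a)) (e₂ (g • b)) = homMatrix e₁ e₂ φ (e₁ a) (e₂ b) := by
  simp only [homMatrix, Matrix.of_apply, Equiv.symm_apply_apply, cosetCoeff_eq]
  rw [smul_cosetVec, map_smul, coords_single_smul, inv_smul_smul]

lemma eq_sum_cosetVec (H : Subgroup G) [Fintype (G ⧸ H)] (v : PermModule ℤ H) :
    v = ∑ a, coords ℤ H v a • cosetVec H a := by
  classical
  apply (coords ℤ H).injective
  ext b
  simp [coords_cosetVec, Finset.sum_apply, Pi.single_apply]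

/-- Matrices act on row vectors here, so the map applied first is the left factor. -/
lemma homMatrix_comp (e₁ : G ⧸ H₁ ≃ Fin n) (e₂ : G ⧸ H₂ ≃ Fin n) (e₃ : G ⧸ H₃ ≃ Fin n)
    (φ : PermHom H₁ H₂) (ψ : PermHom H₂ H₃) :
    homMatrix e₁ e₃ (ψ.comp φ) = homMatrix e₁ e₂ φ * homMatrix e₂ e₃ ψ := by
  classical
  let _ := Fintype.ofFinite (G ⧸ H₂)
  ext i j
  simp only [homMatrix, Matrix.of_apply, Matrix.mul_apply, cosetCoeff_eq, LinearMap.comp_apply]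
  conv_lhs => rw [eq_sum_cosetVec H₂ (φ (cosetVec H₁ (e₁.symm i)))]
  rw [map_sum, map_sum, Finset.sum_apply, ← Equiv.sum_comp e₂]
  refine Finset.sum_congr rfl fun a _ => ?_
  rw [Equiv.symm_apply_apply, map_zsmul, map_zsmul, Pi.smul_apply, smul_eq_mul]

lemma homMatrix_id (e₁ : G ⧸ H₁ ≃ Fin n) :
    homMatrix e₁ e₁ (LinearMap.id : PermHom H₁ H₁) = 1 := by
  classical
  ext i j
  simp [homMatrix, cosetCoeff_eq, coords_cosetVec, Pi.single_apply, Matrix.one_apply, eq_comm]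

lemma isUnit_det_homMatrix (e₁ : G ⧸ H₁ ≃ Fin n) (e₂ : G ⧸ H₂ ≃ Fin n)
    (φ : PermModule ℤ H₁ ≃ₗ[MonoidAlgebra ℤ G] PermModule ℤ H₂) :
    IsUnit (homMatrix e₁ e₂ φ.toLinearMap).det := by
  refine IsUnit.of_mul_eq_one (homMatrix e₂ e₁ φ.symm.toLinearMap).det ?_
  rw [← Matrix.det_mul, ← homMatrix_comp, ← LinearEquiv.coe_trans, LinearEquiv.self_trans_symm]
  exact (congrArg Matrix.det (homMatrix_id e₁)).trans Matrix.det_one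

lemma exists_homMatrix_eq_iff (e₁ : G ⧸ H₁ ≃ Fin n) (e₂ : G ⧸ H₂ ≃ Fin n)
    (M : Matrix (Fin n) (Fin n) ℤ) : (∃ φ : PermHom H₁ H₂, homMatrix e₁ e₂ φ = M) ↔
      ∀ (g : G) a b, M (e₁ (g • a)) (e₂ (g • b)) = M (e₁ a) (e₂ b) := by
  classical
  constructor
  · rintro ⟨φ, rfl⟩ g a b
    exact homMatrix_smul e₁ e₂ φ g a b
  · intro h
    let _ := Fintype.ofFinite (G ⧸ H₁)
    refine ⟨homOfInvariant (fun a b => M (e₁ a) (e₂ b)) h, ?_⟩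
    ext i j
    simp only [homMatrix, Matrix.of_apply, cosetCoeff_eq]
    rw [coords_homOfInvariant, coords_cosetVec, Matrix.single_one_vecMul]
    simp

/-- The homomorphism matrices are those that are constant on double cosets. -/
lemma exists_homMatrix_eq_iff_exists {κ : Type*} (e₁ : G ⧸ H₁ ≃ Fin n) (e₂ : G ⧸ H₂ ≃ Fin n)
    (c : κ ≃ DoubleCoset.Quotient (H₁ : Set G) (H₂ : Set G)) (M : Matrix (Fin n) (Fin n) ℤ) :
    (∃ φ : PermHom H₁ H₂, homMatrix e₁ e₂ φ = M) ↔
      ∃ x : κ → ℤ, ∀ a b : G, M (e₁ a) (e₂ b) = x (c.symm (DoubleCoset.mk H₁ H₂ (a⁻¹ * b))) := by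
  rw [exists_homMatrix_eq_iff]
  constructor
  · intro h
    -- Invariance moves the pair `(a, b)` by `a⁻¹` to `(1, a⁻¹ * b)` and then, by an element of
    -- `H₁`, to the chosen representative of the double coset.
    refine ⟨fun k => M (e₁ (1 : G)) (e₂ ((c k).out : G)), fun a b => ?_⟩
    simp only [Equiv.apply_symm_apply]
    obtain ⟨u, v, hu, hv, huv⟩ := DoubleCoset.mk_out_eq_mul H₁ H₂ (a⁻¹ * b)
    have h1 := h a⁻¹ a b
    rw [MulAction.Quotient.smul_coe, MulAction.Quotient.smul_coe, smul_eq_mul, smul_eq_mul,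
      inv_mul_cancel] at h1
    have h2 := h u (1 : G) ((a⁻¹ * b : G) : G ⧸ H₂)
    rw [MulAction.Quotient.smul_coe, MulAction.Quotient.smul_coe, smul_eq_mul, smul_eq_mul,
      mul_one] at h2
    have h3 : ((u : G) : G ⧸ H₁) = ((1 : G) : G ⧸ H₁) :=
      QuotientGroup.eq.2 (by simpa using H₁.inv_mem hu)
    have h4 : (((DoubleCoset.mk H₁ H₂ (a⁻¹ * b)).out : G) : G ⧸ H₂) =
        ((u * (a⁻¹ * b) : G) : G ⧸ H₂) := by
      rw [huv]
      exact QuotientGroup.mk_mul_of_mem _ hv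
    rw [h4, ← h1, ← h2, h3]
  · rintro ⟨x, hx⟩ g a b
    induction a using QuotientGroup.induction_on with | H a => ?_
    induction b using QuotientGroup.induction_on with | H b => ?_
    rw [MulAction.Quotient.smul_coe, MulAction.Quotient.smul_coe, hx, hx]
    simp [mul_assoc]

end HomMatrix


/-! ### Double cosets and their sizes -/

/-- The index of the double coset of an element. -/
noncomputable def doubleCosetIndex (g : G32T9403) : Fin 8 := pairIndex 0 (pairOf g 0)

lemma doubleCosetIndex_mul (a b : G32T9403) :
    doubleCosetIndex (a⁻¹ * b) = pairIndex ((a : Equiv.Perm (Fin 32)) 0) (pairOf b 0) := by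
  rw [doubleCosetIndex, ← pairIndex_smul a, ← pairOf_mul, mul_inv_cancel_left]

/-- Pairs with the same index at the point `0` lie in one orbit of the stabilizer of `0`; such
orbits on the cosets of the second subgroup are the double cosets. -/
lemma doubleCosetIndex_eq_iff (g g' : G32T9403) : doubleCosetIndex g = doubleCosetIndex g' ↔
    DoubleCoset.mk subH₁ subH₂ g = DoubleCoset.mk subH₁ subH₂ g' := by
  rw [DoubleCoset.eq]
  constructor
  · intro h
    have key : ∀ b b', pairIndex 0 b = pairIndex 0 b' → ∃ n ∈ codes₁,
        (pair b).map (fun i : Fin 32 => Fin.ofNat 32 (digit n i)) = pair b' := by decide +kernel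
    obtain ⟨n, hn, hp⟩ := key _ _ h
    have hmem : ∀ n ∈ codes₁, n ∈ elementCodes ∧ digit n 0 = 0 := by decide +kernel
    obtain ⟨p, hp', he⟩ := exists_of_mem_elementCodes (hmem n hn).1
    have hfun : (fun i : Fin 32 => Fin.ofNat 32 (digit n i)) = p := by
      funext i; rw [← he i]; simp
    rw [hfun] at hp
    have hq := (map_pair ⟨p, hp'⟩ (pairOf g 0)).symm.trans hp
    rw [pair_injective.eq_iff, ← pairOf_mul] at hq
    refine ⟨⟨p, hp'⟩, (mem_subH₁_iff _).2 (Fin.ext ((he 0).trans (hmem n hn).2)),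
      (⟨p, hp'⟩ * g)⁻¹ * g', ?_, (mul_inv_cancel_left _ _).symm⟩
    rw [mem_subH₂_iff_pairOf, pairOf_mul, ← hq, ← pairOf_mul, inv_mul_cancel, pairOf_one]
  · rintro ⟨h, hh, k, hk, rfl⟩
    rw [mul_assoc]
    have := doubleCosetIndex_mul h⁻¹ (g * k)
    rw [inv_inv] at this
    rw [this, (mem_subH₁_iff _).1 (subH₁.inv_mem hh), pairOf_mul, (mem_subH₂_iff_pairOf k).1 hk]
    rfl

lemma exists_doubleCoset_equiv :
    ∃ c : Fin 8 ≃ DoubleCoset.Quotient (subH₁ : Set G32T9403) (subH₂ : Set G32T9403),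
      ∀ g, c.symm (DoubleCoset.mk subH₁ subH₂ g) = doubleCosetIndex g := by
  let F : DoubleCoset.Quotient (subH₁ : Set G32T9403) (subH₂ : Set G32T9403) → Fin 8 :=
    Quotient.lift doubleCosetIndex fun a b h =>
      (doubleCosetIndex_eq_iff a b).2 ((DoubleCoset.eq'' subH₁ subH₂).2 h)
  refine ⟨(Equiv.ofBijective F ⟨?_, fun k => ?_⟩).symm, fun g => rfl⟩
  · rintro ⟨g⟩ ⟨g'⟩ h
    exact (doubleCosetIndex_eq_iff g g').1 h
  · have key : ∀ k, ∃ b, pairIndex 0 b = k := by decide +kernel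
    obtain ⟨b, hb⟩ := key k
    obtain ⟨g, rfl⟩ := exists_pairOf b
    exact ⟨DoubleCoset.mk subH₁ subH₂ g, hb⟩

lemma numRightCosets_eq
    (c : Fin 8 ≃ DoubleCoset.Quotient (subH₁ : Set G32T9403) (subH₂ : Set G32T9403))
    (hc : ∀ g, c.symm (DoubleCoset.mk subH₁ subH₂ g) = doubleCosetIndex g) (k : Fin 8) :
    numRightCosets (c k) = ![2, 2, 2, 2, 3, 3, 6, 12] k := by
  -- The right coset of `g` is recorded by the point `g⁻¹ 0`. The number sought becomes the number
  -- of points with a given index at the first pair.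
  let ρ : Quotient (QuotientGroup.rightRel subH₁) → Fin 32 :=
    Quotient.lift (fun g : G32T9403 => ((g⁻¹ : G32T9403) : Equiv.Perm (Fin 32)) 0) fun a b h => by
      have h1 := (mem_subH₁_iff _).1 (QuotientGroup.rightRel_apply.1 h)
      change ((a⁻¹ : G32T9403) : Equiv.Perm (Fin 32)) 0 = (b : Equiv.Perm (Fin 32))⁻¹ 0
      rw [Subgroup.coe_mul, Equiv.Perm.mul_apply] at h1
      rw [Equiv.Perm.eq_inv_iff_eq, h1]
  have hρ : Function.Injective ρ := by
    rintro ⟨a⟩ ⟨b⟩ h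
    refine Quotient.sound (QuotientGroup.rightRel_apply.2 ((mem_subH₁_iff _).2 ?_))
    have h1 : ((a⁻¹ : G32T9403) : Equiv.Perm (Fin 32)) 0 =
      ((b⁻¹ : G32T9403) : Equiv.Perm (Fin 32)) 0 := h
    rw [Subgroup.coe_mul, Equiv.Perm.mul_apply, h1]
    change (b : Equiv.Perm (Fin 32)) ((b : Equiv.Perm (Fin 32))⁻¹ 0) = 0
    simp
  have himage : ρ '' (Quotient.mk (QuotientGroup.rightRel subH₁) ''
      DoubleCoset.quotToDoubleCoset subH₁ subH₂ (c k)) =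
        ((Finset.univ.filter fun a => pairIndex a 0 = k : Finset (Fin 32)) : Set (Fin 32)) := by
    have hmem (g : G32T9403) : g ∈ DoubleCoset.quotToDoubleCoset subH₁ subH₂ (c k) ↔
        pairIndex (((g⁻¹ : G32T9403) : Equiv.Perm (Fin 32)) 0) 0 = k := by
      rw [DoubleCoset.mem_quotToDoubleCoset_iff]
      have := doubleCosetIndex_mul g⁻¹ 1
      rw [pairOf_one, inv_inv, mul_one] at this
      rw [← this, ← hc, Equiv.symm_apply_eq]
    ext a
    simp only [Set.mem_image, exists_exists_and_eq_and, Finset.coe_filter, Finset.mem_univ,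
      true_and, Set.mem_ofPred_eq]
    constructor
    · rintro ⟨g, hg, rfl⟩
      exact (hmem g).1 hg
    · intro ha
      obtain ⟨g, hg, rfl⟩ := exists_apply_zero a
      refine ⟨(⟨g, hg⟩ : G32T9403)⁻¹, (hmem _).2 ?_, ?_⟩
      · rw [inv_inv]; exact ha
      · change ((((⟨g, hg⟩ : G32T9403)⁻¹)⁻¹ : G32T9403) : Equiv.Perm (Fin 32)) 0 = g 0
        rw [inv_inv]
  rw [numRightCosets, ← Set.ncard_image_of_injective _ hρ, himage, Set.ncard_coe_finset]
  revert k
  have key : ∀ k : Fin 8, (Finset.univ.filter fun a => pairIndex a 0 = k).card =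
      ![2, 2, 2, 2, 3, 3, 6, 12] k := by decide +kernel
  exact fun k _ => key k


/-! ### The determinant by an orthogonal change of basis -/

/-- The sum of the first `n` values of a sequence, by plain recursion. -/
def sumUpTo (f : ℕ → ℤ) : ℕ → ℤ
  | 0 => 0
  | n + 1 => sumUpTo f n + f n

lemma sumUpTo_eq (f : ℕ → ℤ) (n : ℕ) : sumUpTo f n = ∑ i : Fin n, f i := by
  induction n with
  | zero => rfl
  | succ n ih => rw [sumUpTo, ih, Fin.sum_univ_castSucc]; rfl

/-- The entries of a vector stored as base-8 digits shifted by 4. -/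
def shiftedDigit (n j : ℕ) : ℤ := Int.subNatNat (Nat.mod (Nat.div n (Nat.pow 8 j)) 8) 4

/-- Vectors on the points adapted to the decomposition into irreducible representations. -/
def pointVectors : List ℕ := [
    45273235722436764339167971613, 45273235722436759941121460580, 45273235722436729154795883300,
    45273235722436482864191265060, 45273235722434512539354319140, 45273235722418749940658751780,
    45273235722292649151094212900, 45273235722436764330594814244, 45273235722436764270582712612,
    45273235722436763790485899556, 45273235133293875485069166884, 45273231009293653506377533732,
    45273198017291877676844468516, 44035597914606287721562523940, 35372133259792951398324390180,
    45137836030639925871600879908, 45273235722456990955072833252, 45273235722740163577740896100,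
    45273239862577887924578306340, 45273306104835856495084194084, 45795534852267709536163481865,
    71276323407854625014485997412, 45273239862704233920305452836, 45273306104677921801410394020,
    79227989810575821217947563775, 45273239862451539759959784228, 45273306104993789501842479780,
    78183564253943634911206160073, 45447277864703845546803218715, 53940931617746853765248367332,
    56591544653045955423959964525, 56243287665482088921439853403]

/-- Vectors on the pairs, the first images of the vectors on the points. -/
def pairVectors : List ℕ := [
    36605275374731736113686399268, 45137836030639956657926457636, 45273533231525185059170699556,
    45273235133293874935330130212, 45137836030639895085275302180, 45272938213348343483873773860,
    45273235133293876034808203556, 45273235722452526937863997732, 45273235722436764347623688932,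
    45273235731659854901048129828, 45273235731659854901043943716, 45273235722421001740472404260,
    45273235722436764347623688036, 45273235796079625445930322219, 45273235648793903232405621035,
    36610035520146468716061804836, 45273235713213110818614434660, 45273235713172578439416993508,
    45272928177166646568482392356, 44924758724015175158084028708, 45099456544991678015292459327,
    78690249882225367810128598756, 45272929350860722842010827044, 45621098803971818003794607524,
    78530591024109997944445187839, 45272929369267497469031078180, 45621098822459657389212095652,
    78879376307112779433747789513, 45447014604157484731387234605, 56412240454637481902531328868,
    56591544653045955423959964525, 56242758778594442071344864091]

/-- The second images of the vectors on the points. -/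
def pairVectors' : List ℕ := [
    45137835441497036949856340260, 53938815988211335701584005412, 45275615795159893247507188004,
    53938816006657516825339906788, 45275615795128368041661970724, 53938815997434426263461611364,
    45275615795144130631897864484, 45272938286991173871956281636, 45272938139705482994496194852,
    45273235796079656781994936612, 45137836619782814725699684651, 45408635414233602739089328427,
    45273235133293875552714901803, 45273235713213673777289677540, 45273235722452526929410144548,
    45272938213348373788106049828, 45273235722436764339167971620, 45273235722436764339167971620,
    45273235722436764339167971620, 45273235722436764339167971620, 45273235722436764339167971620,
    45273235722436764339167971620, 45273235722436764339167971620, 45273235722436764339167971620,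
    45273235722436764339167971620, 45273235722436764339167971620, 45273235722436764339167971620,
    45273235722436764339167971620, 45273235722436764339167971620, 45273235722436764339167971620,
    45273235722436764339167971620, 45273235722436764339167971620]

/-- The squared lengths of `pointVectors`. -/
def squaredLength : List ℤ := [
    2, 2, 2, 2, 2, 2, 2, 2, 2, 2, 2, 2, 2, 2, 2, 2, 8, 24, 8, 24, 48, 48, 16, 48, 96, 16, 48, 96,
    16, 16, 32, 32]

/-- The factor of the determinant that belongs to each of `pointVectors`. -/
def factorIndex : List ℕ := [
    0, 0, 0, 0, 0, 0, 0, 0, 0, 0, 0, 0, 0, 0, 0, 0, 1, 1, 1, 1, 1, 1, 2, 2, 2, 3, 3, 3, 4, 4, 5, 6]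

/-- The linear forms in the determinant. -/
def linearForms : List (List ℤ) := [
  [0, 1, -1, 0, 0, 0, 0, 0], [2, 0, 0, -2, 1, 1, -2, 0], [2, 2, 2, 2, -1, -1, -2, -4], [2, -2,
    -2, 2, -1, -1, -2, 4], [2, 0, 0, -2, -3, -3, 6, 0], [2, 2, 2, 2, 3, 3, 6, 12], [2, -2, -2, 2,
    3, 3, 6, -12]]

/-- The matrix entries of the basis change on the points. -/
def pointEntry (i a : ℕ) : ℤ := shiftedDigit (pointVectors.getD i 0) a

/-- The entries of the first images. -/
def pairEntry (i b : ℕ) : ℤ := shiftedDigit (pairVectors.getD i 0) b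

/-- The entries of the second images. -/
def pairEntry' (i b : ℕ) : ℤ := shiftedDigit (pairVectors'.getD i 0) b

/-- The table of double coset indices with natural number arguments. -/
def indexEntry (a b : ℕ) : ℕ := (List.ofFn indexRow).getD a 0 / 8 ^ b % 8

/-- The coefficient of the `k`-th variable in the first form of the `i`-th row. -/
def formCoeff (i k : ℕ) : ℤ := (linearForms.getD (factorIndex.getD i 0) []).getD k 0

/-- The coefficient of the `k`-th variable in the second form of the `i`-th row. -/
def formCoeff' (i k : ℕ) : ℤ :=
  if i < 16 then if k = 4 then 1 else if k = 5 then -1 else 0 else 0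

lemma indexEntry_eq : ∀ a b : Fin 32, indexEntry a b = pairIndex a b := by decide +kernel

lemma orthogonal_pointEntry : ∀ i j : Fin 32, sumUpTo (fun a => pointEntry i a * pointEntry j a) 32 =
    if i = j then squaredLength.getD i 0 else 0 := by
  decide +kernel

/-- The stretching factors 2 here and 3 for the second images are the coefficients of the form `2u²
+ 3v²`. -/
lemma orthogonal_pairEntry : ∀ i j : Fin 32, sumUpTo (fun b => pairEntry i b * pairEntry j b) 32 =
    if i = j then (if i < 16 then 2 else 1) * squaredLength.getD i 0 else 0 := by
  decide +kernel

lemma orthogonal_pairEntry' : ∀ i j : Fin 32,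
    sumUpTo (fun b => pairEntry' i b * pairEntry' j b) 32 =
      if i = j then (if i < 16 then 3 else 0) * squaredLength.getD i 0 else 0 := by
  decide +kernel

/-- This antisymmetry removes the mixed terms, so that no `uv` term appears in the form. -/
lemma orthogonal_pairEntry_pairEntry' : ∀ i j : Fin 32,
    sumUpTo (fun b => pairEntry i b * pairEntry' j b) 32 +
      sumUpTo (fun b => pairEntry' i b * pairEntry j b) 32 = 0 := by
  decide +kernel

/-- The image of a basis vector is linear in the eight variables, so it is verified one variable at
a time. -/
lemma sum_pointEntry : ∀ i b : Fin 32, ∀ k : Fin 8,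
    sumUpTo (fun a => if indexEntry a b = k then pointEntry i a else 0) 32 =
      formCoeff i k * pairEntry i b + formCoeff' i k * pairEntry' i b := by
  decide +kernel


section
variable {R : Type*} [CommRing R]

/-- The first linear form of the `i`-th row. -/
def rowForm (x : Fin 8 → R) (i : Fin 32) : R := ∑ k : Fin 8, (formCoeff i k : R) * x k

/-- The second linear form of the `i`-th row. -/
def rowForm' (x : Fin 8 → R) (i : Fin 32) : R := ∑ k : Fin 8, (formCoeff' i k : R) * x k

/-- The matrix with entries indexed by the double cosets. -/
def indexMatrix (x : Fin 8 → R) : Matrix (Fin 32) (Fin 32) R :=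
  Matrix.of fun a b => x (pairIndex a b)

/-- The matrix of the basis change on the points. -/
def pointMatrix (R : Type*) [CommRing R] : Matrix (Fin 32) (Fin 32) R :=
  Matrix.of fun i a => (pointEntry i a : R)

lemma pointMatrix_mul_transpose :
    pointMatrix R * (pointMatrix R).transpose =
      Matrix.diagonal fun i : Fin 32 => ((squaredLength.getD i 0 : ℤ) : R) := by
  ext i j
  have h := congrArg (Int.cast : ℤ → R) (orthogonal_pointEntry i j)
  rw [sumUpTo_eq] at h
  push_cast at h
  rw [Matrix.mul_apply, Matrix.diagonal_apply]
  simpa [pointMatrix] using h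

lemma pointMatrix_mul_indexMatrix (x : Fin 8 → R) (i b : Fin 32) :
    (pointMatrix R * indexMatrix x) i b =
      rowForm x i * pairEntry i b + rowForm' x i * pairEntry' i b := by
  have key : ∀ a : Fin 32, (pointMatrix R) i a * indexMatrix x a b =
      ∑ k : Fin 8, x k * ((if indexEntry a b = k then pointEntry i a else 0 : ℤ) : R) := by
    intro a
    rw [Finset.sum_eq_single (pairIndex a b)]
    · simp [indexEntry_eq, pointMatrix, indexMatrix, mul_comm]
    · intro k _ hk
      have : ¬ ((pairIndex a b : Fin 8) : ℕ) = k := fun h => hk (Fin.ext h.symm)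
      simp [indexEntry_eq, this]
    · simp
  rw [Matrix.mul_apply, Finset.sum_congr rfl fun a _ => key a, Finset.sum_comm]
  have h : ∀ k : Fin 8, ∑ a : Fin 32,
      x k * ((if indexEntry a b = k then pointEntry i a else 0 : ℤ) : R) =
        (formCoeff i k : R) * x k * pairEntry i b + (formCoeff' i k : R) * x k * pairEntry' i b := by
    intro k
    have h := congrArg (Int.cast : ℤ → R) (sum_pointEntry i b k)
    rw [sumUpTo_eq] at h
    rw [← Finset.mul_sum, ← Int.cast_sum, h]
    push_cast
    ring
  rw [Finset.sum_congr rfl fun k _ => h k, Finset.sum_add_distrib, ← Finset.sum_mul,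
    ← Finset.sum_mul]
  rfl

/-- The eigenvalue of `A Aᵀ` in the `i`-th row. -/
def rowValue (x : Fin 8 → R) (i : Fin 32) : R :=
  if i < 16 then 2 * rowForm x i ^ 2 + 3 * rowForm' x i ^ 2 else rowForm x i ^ 2

lemma rowForm_eq_of_lt (x : Fin 8 → R) {i j : Fin 32} (hi : i < 16) (hj : j < 16) :
    rowForm x i = rowForm x j ∧ rowForm' x i = rowForm' x j := by
  have h1 : ∀ i j : Fin 32, i < 16 → j < 16 → ∀ k : Fin 8,
      formCoeff i k = formCoeff j k ∧ formCoeff' i k = formCoeff' j k := by decide +kernel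
  simp only [rowForm, rowForm']
  exact ⟨Finset.sum_congr rfl fun k _ => by rw [(h1 i j hi hj k).1],
    Finset.sum_congr rfl fun k _ => by rw [(h1 i j hi hj k).2]⟩

lemma pairEntry'_eq_zero : ∀ i b : Fin 32, ¬ i < 16 → pairEntry' i b = 0 := by
  decide +kernel

/-- The first 16 rows share their two linear forms, so antisymmetry applies after factoring them
out. Any other row has zero second image, and then antisymmetry makes both sums vanish. -/
lemma cross_term_eq_zero (x : Fin 8 → R) (i j : Fin 32) :
    rowForm x i * rowForm' x j * ∑ b : Fin 32, (pairEntry i b * pairEntry' j b : R) +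
      rowForm' x i * rowForm x j * ∑ b : Fin 32, (pairEntry' i b * pairEntry j b : R) = 0 := by
  have h := congrArg (Int.cast : ℤ → R) (orthogonal_pairEntry_pairEntry' i j)
  rw [sumUpTo_eq, sumUpTo_eq] at h
  push_cast at h
  by_cases hi : i < 16
  · by_cases hj : j < 16
    · obtain ⟨h1, h2⟩ := rowForm_eq_of_lt x hi hj
      rw [h1, h2]
      linear_combination rowForm x j * rowForm' x j * h
    · have h0 : ∑ b : Fin 32, (pairEntry i b * pairEntry' j b : R) = 0 :=
        Finset.sum_eq_zero fun b _ => by simp [pairEntry'_eq_zero j b hj]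
      rw [h0, zero_add] at h
      rw [h0, h]
      ring
  · have h0 : ∑ b : Fin 32, (pairEntry' i b * pairEntry j b : R) = 0 :=
      Finset.sum_eq_zero fun b _ => by simp [pairEntry'_eq_zero i b hi]
    rw [h0, add_zero] at h
    rw [h0, h]
    ring

lemma pointMatrix_mul_indexMatrix_mul_transpose (x : Fin 8 → R) :
    (pointMatrix R * indexMatrix x) * (pointMatrix R * indexMatrix x).transpose =
      Matrix.diagonal fun i : Fin 32 => ((squaredLength.getD i 0 : ℤ) : R) * rowValue x i := by
  ext i j
  have h1 := congrArg (Int.cast : ℤ → R) (orthogonal_pairEntry i j)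
  have h2 := congrArg (Int.cast : ℤ → R) (orthogonal_pairEntry' i j)
  rw [sumUpTo_eq] at h1 h2
  push_cast at h1 h2
  have key : ((pointMatrix R * indexMatrix x) * (pointMatrix R * indexMatrix x).transpose) i j =
      rowForm x i * rowForm x j * ∑ b : Fin 32, (pairEntry i b * pairEntry j b : R) +
      rowForm' x i * rowForm' x j * ∑ b : Fin 32, (pairEntry' i b * pairEntry' j b : R) +
      (rowForm x i * rowForm' x j * ∑ b : Fin 32, (pairEntry i b * pairEntry' j b : R) +
      rowForm' x i * rowForm x j * ∑ b : Fin 32, (pairEntry' i b * pairEntry j b : R)) := by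
    rw [Matrix.mul_apply]
    simp only [Matrix.transpose_apply, pointMatrix_mul_indexMatrix, Finset.mul_sum,
      ← Finset.sum_add_distrib]
    exact Finset.sum_congr rfl fun b _ => by ring
  rw [key, cross_term_eq_zero, h1, h2, Matrix.diagonal_apply]
  by_cases hij : i = j
  · subst hij
    by_cases hi : i < 16
    · simp only [rowValue, if_pos hi, if_true]
      ring
    · simp only [rowValue, if_neg hi, if_true]
      ring
  · simp [hij]

/-- The factored determinant over a commutative ring. -/
def detFormIn (x : Fin 8 → R) : R :=
  (2 * (x 1 - x 2) ^ 2 + 3 * (x 4 - x 5) ^ 2) ^ 8 *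
  (2 * (x 0 - x 3) + (x 4 + x 5 - 2 * x 6)) ^ 6 *
  (2 * (x 0 + x 1 + x 2 + x 3) - (x 4 + x 5 + 2 * x 6 + 4 * x 7)) ^ 3 *
  (2 * (x 0 - x 1 - x 2 + x 3) - (x 4 + x 5 + 2 * x 6 - 4 * x 7)) ^ 3 *
  (2 * (x 0 - x 3) - 3 * (x 4 + x 5 - 2 * x 6)) ^ 2 *
  (2 * (x 0 + x 1 + x 2 + x 3) + 3 * (x 4 + x 5 + 2 * x 6 + 4 * x 7)) *
  (2 * (x 0 - x 1 - x 2 + x 3) + 3 * (x 4 + x 5 + 2 * x 6 - 4 * x 7))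

/-- The factors of the determinant. -/
def factorValue (x : Fin 8 → R) : Fin 7 → R :=
  ![2 * (x 1 - x 2) ^ 2 + 3 * (x 4 - x 5) ^ 2,
    (2 * (x 0 - x 3) + (x 4 + x 5 - 2 * x 6)) ^ 2,
    (2 * (x 0 + x 1 + x 2 + x 3) - (x 4 + x 5 + 2 * x 6 + 4 * x 7)) ^ 2,
    (2 * (x 0 - x 1 - x 2 + x 3) - (x 4 + x 5 + 2 * x 6 - 4 * x 7)) ^ 2,
    (2 * (x 0 - x 3) - 3 * (x 4 + x 5 - 2 * x 6)) ^ 2,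
    (2 * (x 0 + x 1 + x 2 + x 3) + 3 * (x 4 + x 5 + 2 * x 6 + 4 * x 7)) ^ 2,
    (2 * (x 0 - x 1 - x 2 + x 3) + 3 * (x 4 + x 5 + 2 * x 6 - 4 * x 7)) ^ 2]

lemma factorIndex_lt : ∀ i : Fin 32, factorIndex.getD i 0 < 7 ∧
    (i < 16 ↔ factorIndex.getD i 0 = 0) := by
  decide +kernel

lemma rowValue_eq_factorValue (x : Fin 8 → R) (i : Fin 32) :
    rowValue x i = factorValue x ⟨factorIndex.getD i 0, (factorIndex_lt i).1⟩ := by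
  obtain ⟨h1, h2⟩ := factorIndex_lt i
  have h3 : (i : ℕ) < 16 ↔ factorIndex.getD i 0 = 0 := h2
  simp only [rowValue, rowForm, rowForm', formCoeff, formCoeff', h3, h2]
  obtain ⟨f, hf⟩ : ∃ f, factorIndex.getD i 0 = f := ⟨_, rfl⟩
  simp only [hf] at h1 ⊢
  interval_cases f <;> simp [factorValue, linearForms, Fin.sum_univ_eight] <;> ring

/-- The row of the table of factors as an element of `Fin 7`. -/
def rowFactor (i : Fin 32) : Fin 7 := ⟨factorIndex.getD i 0, (factorIndex_lt i).1⟩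

lemma card_rowFactor : ∀ f : Fin 7, (Finset.univ.filter fun i => rowFactor i = f).card =
    (![16, 6, 3, 3, 2, 1, 1] : Fin 7 → ℕ) f := by
  decide +kernel

/-- The quadratic form occurs in 16 rows and stands with exponent 8 in the determinant; each linear
form enters its row values squared. -/
lemma prod_rowValue (x : Fin 8 → R) : ∏ i, rowValue x i = detFormIn x ^ 2 := by
  have h : ∏ i, rowValue x i = ∏ f, factorValue x f ^ (![16, 6, 3, 3, 2, 1, 1] : Fin 7 → ℕ) f := by
    rw [Finset.prod_congr rfl fun i _ => rowValue_eq_factorValue x i,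
      ← Finset.prod_fiberwise Finset.univ rowFactor]
    refine Finset.prod_congr rfl fun f _ => ?_
    rw [← card_rowFactor f]
    refine Finset.prod_eq_pow_card fun i hi => ?_
    rw [← (Finset.mem_filter.mp hi).2]
    rfl
  rw [h, Fin.prod_univ_seven]
  simp only [factorValue, detFormIn, Matrix.cons_val]
  generalize 2 * (x 1 - x 2) ^ 2 + 3 * (x 4 - x 5) ^ 2 = a0
  generalize (2 * (x 0 - x 3) + (x 4 + x 5 - 2 * x 6)) = a1
  generalize (2 * (x 0 + x 1 + x 2 + x 3) - (x 4 + x 5 + 2 * x 6 + 4 * x 7)) = a2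
  generalize (2 * (x 0 - x 1 - x 2 + x 3) - (x 4 + x 5 + 2 * x 6 - 4 * x 7)) = a3
  generalize (2 * (x 0 - x 3) - 3 * (x 4 + x 5 - 2 * x 6)) = a4
  generalize (2 * (x 0 + x 1 + x 2 + x 3) + 3 * (x 4 + x 5 + 2 * x 6 + 4 * x 7)) = a5
  generalize (2 * (x 0 - x 1 - x 2 + x 3) + 3 * (x 4 + x 5 + 2 * x 6 - 4 * x 7)) = a6
  ring

lemma squaredLength_ne_zero : ∀ i : Fin 32, squaredLength.getD i 0 ≠ 0 := by
  decide +kernel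

/-- The two Gram matrices are diagonal with proportional entries; the squared determinant of the
basis change is a nonzero integer and cancels. -/
lemma det_indexMatrix_sq [IsDomain R] [CharZero R] (x : Fin 8 → R) :
    (indexMatrix x).det ^ 2 = detFormIn x ^ 2 := by
  have h1 := congrArg Matrix.det (pointMatrix_mul_transpose (R := R))
  have h2 := congrArg Matrix.det (pointMatrix_mul_indexMatrix_mul_transpose x)
  rw [Matrix.det_mul, Matrix.det_transpose, Matrix.det_diagonal] at h1
  rw [Matrix.det_mul, Matrix.det_transpose, Matrix.det_diagonal, Matrix.det_mul,
    Finset.prod_mul_distrib, prod_rowValue, ← h1] at h2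
  have h3 : (pointMatrix R).det * (pointMatrix R).det ≠ 0 := by
    rw [h1]
    exact Finset.prod_ne_zero_iff.mpr fun i _ => Int.cast_ne_zero.mpr (squaredLength_ne_zero i)
  refine mul_left_cancel₀ h3 ?_
  linear_combination h2

end

lemma map_detFormIn {R S : Type*} [CommRing R] [CommRing S] (f : R →+* S) (x : Fin 8 → R) :
    f (detFormIn x) = detFormIn fun k => f (x k) := by
  have h2 : f 2 = 2 := map_ofNat f 2
  have h3 : f 3 = 3 := map_ofNat f 3
  have h4 : f 4 = 4 := map_ofNat f 4
  simp [detFormIn, h2, h3, h4]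

lemma detFormIn_int (x : Fin 8 → ℤ) : detFormIn x = detForm x := rfl

/-- For separate integer values the sign could vary. It is fixed once by taking the square root of
the identity in the polynomial ring and then specializing. -/
lemma exists_det_indexMatrix : ∃ s : ℤˣ, ∀ x : Fin 8 → ℤ,
    (indexMatrix x).det = s * detForm x := by
  have key := sq_eq_sq_iff_eq_or_eq_neg.mp (det_indexMatrix_sq (R := MvPolynomial (Fin 8) ℤ)
    MvPolynomial.X)
  have heval : ∀ x : Fin 8 → ℤ, MvPolynomial.eval x (indexMatrix
      (MvPolynomial.X : Fin 8 → MvPolynomial (Fin 8) ℤ)).det = (indexMatrix x).det := by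
    intro x
    rw [RingHom.map_det]
    congr 1
    ext i j
    simp [indexMatrix]
  have heval' : ∀ x : Fin 8 → ℤ, MvPolynomial.eval x (detFormIn
      (MvPolynomial.X : Fin 8 → MvPolynomial (Fin 8) ℤ)) = detForm x := by
    intro x
    rw [map_detFormIn, ← detFormIn_int]
    simp
  rcases key with h | h
  · exact ⟨1, fun x => by rw [← heval, h, heval']; simp⟩
  · exact ⟨-1, fun x => by rw [← heval, h, map_neg, heval']; simp⟩


/-! ### Orderings of the cosets and the arithmetic consequences -/

/-- The data of the determinant formula with sign `s`. -/
lemma exists_orderings (s : ℤˣ) : ∃ (e₁ : G32T9403 ⧸ subH₁ ≃ Fin 32)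
    (e₂ : G32T9403 ⧸ subH₂ ≃ Fin 32)
    (c : Fin 8 ≃ DoubleCoset.Quotient (subH₁ : Set G32T9403) (subH₂ : Set G32T9403)),
    (∀ k, numRightCosets (c k) = ![2, 2, 2, 2, 3, 3, 6, 12] k) ∧
    (∀ M : Matrix (Fin 32) (Fin 32) ℤ,
      (∃ φ : PermHom subH₁ subH₂, homMatrix e₁ e₂ φ = M) ↔
        ∃ x : Fin 8 → ℤ, ∀ a b : G32T9403,
          M (e₁ a) (e₂ b) = x (c.symm (DoubleCoset.mk subH₁ subH₂ (a⁻¹ * b)))) ∧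
    (∀ (M : Matrix (Fin 32) (Fin 32) ℤ) (x : Fin 8 → ℤ),
      (∀ a b : G32T9403,
        M (e₁ a) (e₂ b) = x (c.symm (DoubleCoset.mk subH₁ subH₂ (a⁻¹ * b)))) →
      M.det = s * detForm x) := by
  obtain ⟨e₁, he₁⟩ := exists_equiv₁
  obtain ⟨e₂, he₂⟩ := exists_equiv₂
  obtain ⟨c, hc⟩ := exists_doubleCoset_equiv
  obtain ⟨s₀, hs₀⟩ := exists_det_indexMatrix
  -- An odd reordering of the cosets of the first subgroup reverses the sign, so both signs occur.
  obtain ⟨ρ, hρ⟩ : ∃ ρ : Equiv.Perm (Fin 32), Equiv.Perm.sign ρ = s * s₀ := by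
    rcases Int.units_eq_one_or (s * s₀) with h | h
    · exact ⟨1, by rw [h, Equiv.Perm.sign_one]⟩
    · exact ⟨Equiv.swap 0 1, by rw [h, Equiv.Perm.sign_swap (by decide)]⟩
  refine ⟨e₁.trans ρ, e₂, c, numRightCosets_eq c hc, exists_homMatrix_eq_iff_exists _ _ c, ?_⟩
  intro M x hM
  have h1 : (M.submatrix ρ id) = indexMatrix x := by
    ext i j
    obtain ⟨a, ha⟩ := QuotientGroup.mk_surjective (e₁.symm i)
    obtain ⟨b, hb⟩ := QuotientGroup.mk_surjective (e₂.symm j)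
    obtain rfl : e₁ a = i := by rw [ha, Equiv.apply_symm_apply]
    obtain rfl : e₂ b = j := by rw [hb, Equiv.apply_symm_apply]
    have h := hM a b
    rw [hc, doubleCosetIndex_mul, ← he₁, ← he₂] at h
    exact h
  have h2 := Matrix.det_permute ρ M
  have h3 : ((s * s₀ : ℤˣ) : ℤ) * ((s * s₀ : ℤˣ) : ℤ) = 1 := by
    rw [← Units.val_mul, Int.units_mul_self, Units.val_one]
  have h4 : (s₀ : ℤ) * s₀ = 1 := by rw [← Units.val_mul, Int.units_mul_self, Units.val_one]
  rw [h1, hs₀, hρ] at h2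
  push_cast at h2 h3
  calc M.det = (s * s₀ * (s * s₀)) * M.det := by rw [h3, one_mul]
    _ = s * (s₀ * s₀) * detForm x := by linear_combination (-(s : ℤ) * s₀) * h2
    _ = _ := by rw [h4, mul_one]

lemma detForm_two : detForm ![1, 1, 0, -1, 0, 0, 0, 0] = 2 ^ 32 := by
  simp [detForm, Matrix.cons_val]

lemma detForm_three : detForm ![0, 0, 0, 0, 1, 0, 0, 0] = 3 ^ 12 := by
  simp [detForm, Matrix.cons_val]

/-- The factor `2u² + 3v²` would have to be a unit, but its values are nonnegative and never 1. -/
lemma detForm_ne (x : Fin 8 → ℤ) : detForm x ≠ 1 ∧ detForm x ≠ -1 := by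
  have key : ¬ IsUnit (detForm x) := by
    intro h
    have h1 : IsUnit (2 * (x 1 - x 2) ^ 2 + 3 * (x 4 - x 5) ^ 2) := by
      refine isUnit_of_dvd_unit ?_ h
      unfold detForm
      simp only [mul_assoc]
      exact (dvd_pow_self _ (by norm_num)).mul_right _
    generalize x 1 - x 2 = u at h1
    generalize x 4 - x 5 = v at h1
    rcases Int.isUnit_iff.mp h1 with h | h
    · by_cases hv : v = 0
      · subst hv; omega
      · have := (sq_pos_of_ne_zero hv)
        nlinarith [sq_nonneg u]
    · nlinarith [sq_nonneg u, sq_nonneg v]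
  exact ⟨fun h => key (h ▸ isUnit_one), fun h => key (h ▸ isUnit_one.neg)⟩

lemma exists_homMatrix_det (x : Fin 8 → ℤ) (e₁ : G32T9403 ⧸ subH₁ ≃ Fin 32)
    (e₂ : G32T9403 ⧸ subH₂ ≃ Fin 32)
    (c : Fin 8 ≃ DoubleCoset.Quotient (subH₁ : Set G32T9403) (subH₂ : Set G32T9403))
    (hM : ∀ M : Matrix (Fin 32) (Fin 32) ℤ,
      (∃ φ : PermHom subH₁ subH₂, homMatrix e₁ e₂ φ = M) ↔
        ∃ x : Fin 8 → ℤ, ∀ a b : G32T9403,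
          M (e₁ a) (e₂ b) = x (c.symm (DoubleCoset.mk subH₁ subH₂ (a⁻¹ * b))))
    (hdet : ∀ (M : Matrix (Fin 32) (Fin 32) ℤ) (x : Fin 8 → ℤ),
      (∀ a b : G32T9403,
        M (e₁ a) (e₂ b) = x (c.symm (DoubleCoset.mk subH₁ subH₂ (a⁻¹ * b)))) →
      M.det = detForm x) :
    ∃ φ : PermHom subH₁ subH₂, (homMatrix e₁ e₂ φ).det = detForm x := by
  have key : ∃ M : Matrix (Fin 32) (Fin 32) ℤ, ∀ a b : G32T9403,
      M (e₁ a) (e₂ b) = x (c.symm (DoubleCoset.mk subH₁ subH₂ (a⁻¹ * b))) := by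
    let F : G32T9403 ⧸ subH₁ → G32T9403 ⧸ subH₂ → ℤ := fun a b =>
      x (c.symm (DoubleCoset.mk subH₁ subH₂ ((a.out)⁻¹ * b.out)))
    refine ⟨Matrix.of fun i j => F (e₁.symm i) (e₂.symm j), fun a b => ?_⟩
    simp only [Matrix.of_apply, Equiv.symm_apply_apply, F]
    congr 2
    rw [DoubleCoset.eq]
    obtain ⟨h, hh⟩ := QuotientGroup.mk_out_eq_mul subH₁ a
    obtain ⟨k, hk⟩ := QuotientGroup.mk_out_eq_mul subH₂ b
    refine ⟨h, h.2, k⁻¹, (k⁻¹).2, ?_⟩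
    rw [hh, hk]
    simp [mul_assoc]
  obtain ⟨M, h⟩ := key
  obtain ⟨φ, rfl⟩ := (hM M).2 ⟨x, h⟩
  exact ⟨φ, hdet _ x h⟩

lemma exists_homMatrix_two_three : ∃ (e₁ : G32T9403 ⧸ subH₁ ≃ Fin 32)
    (e₂ : G32T9403 ⧸ subH₂ ≃ Fin 32) (φ ψ : PermHom subH₁ subH₂),
    (homMatrix e₁ e₂ φ).det = 2 ^ 32 ∧ (homMatrix e₁ e₂ ψ).det = 3 ^ 12 := by
  obtain ⟨e₁, e₂, c, -, hM, hdet⟩ := exists_orderings 1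
  simp only [Units.val_one, one_mul] at hdet
  obtain ⟨φ, hφ⟩ := exists_homMatrix_det ![1, 1, 0, -1, 0, 0, 0, 0] e₁ e₂ c hM hdet
  obtain ⟨ψ, hψ⟩ := exists_homMatrix_det ![0, 0, 0, 0, 1, 0, 0, 0] e₁ e₂ c hM hdet
  exact ⟨e₁, e₂, φ, ψ, hφ.trans detForm_two, hψ.trans detForm_three⟩

lemma isCoprime_two_pow_three_pow : IsCoprime ((2 : ℤ) ^ 32) (3 ^ 12) :=
  IsCoprime.pow (Int.isCoprime_iff_gcd_eq_one.mpr (by decide))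

lemma detGcd_eq_one : detGcd subH₁ subH₂ = 1 := by
  obtain ⟨e₁, e₂, φ, ψ, hφ, hψ⟩ := exists_homMatrix_two_three
  unfold detGcd
  set I := Ideal.span {t : ℤ | ∃ (n : ℕ) (e₁ : G32T9403 ⧸ subH₁ ≃ Fin n)
    (e₂ : G32T9403 ⧸ subH₂ ≃ Fin n) (φ : PermHom subH₁ subH₂), t = (homMatrix e₁ e₂ φ).det}
  have htop : I = ⊤ := by
    rw [Ideal.eq_top_iff_one]
    obtain ⟨u, v, h⟩ := isCoprime_two_pow_three_pow
    rw [← h]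
    exact I.add_mem (I.mul_mem_left _ (Ideal.subset_span ⟨32, e₁, e₂, φ, hφ.symm⟩))
      (I.mul_mem_left _ (Ideal.subset_span ⟨32, e₁, e₂, ψ, hψ.symm⟩))
  have h : IsUnit (Submodule.IsPrincipal.generator I) := by
    rw [← Ideal.span_singleton_eq_top, Ideal.span_singleton_generator, htop]
  exact Int.isUnit_iff_natAbs_eq.mp h

/-- A relation expressing 1 by two coprime determinants persists in the local ring `ℤ_[p]`, where
one of its two terms must be a unit. -/
lemma locallyIntegrallyEquivalent : LocallyIntegrallyEquivalent subH₁ subH₂ := by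
  intro p _
  obtain ⟨e₁, e₂, φ, ψ, hφ, hψ⟩ := exists_homMatrix_two_three
  have key (χ : PermHom subH₁ subH₂) (h : IsUnit (((homMatrix e₁ e₂ χ).det : ℤ) : ℤ_[p])) :
      Nonempty (PermModule ℤ_[p] subH₁ ≃ₗ[MonoidAlgebra ℤ_[p] G32T9403] PermModule ℤ_[p] subH₂) := by
    refine nonempty_equiv_of_isUnit_det e₁ e₂ ((homMatrix e₁ e₂ χ).map (Int.castRingHom ℤ_[p]))
      (fun g a b => ?_) ?_
    · simp only [Matrix.map_apply, homMatrix_smul]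
    · rw [← RingHom.mapMatrix_apply, ← RingHom.map_det]
      exact h
  obtain ⟨u, v, h⟩ := isCoprime_two_pow_three_pow
  have h' := congrArg (Int.cast : ℤ → ℤ_[p]) h
  push_cast at h'
  rcases IsLocalRing.isUnit_or_isUnit_of_add_one h' with h1 | h1
  · refine key φ ?_
    rw [hφ]
    push_cast
    exact isUnit_of_mul_isUnit_right h1
  · refine key ψ ?_
    rw [hψ]
    push_cast
    exact isUnit_of_mul_isUnit_right h1

lemma not_integrallyEquivalent : ¬ IntegrallyEquivalent subH₁ subH₂ := by
  rintro ⟨φ⟩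
  obtain ⟨e₁, e₂, c, -, hM, hdet⟩ := exists_orderings 1
  have h := isUnit_det_homMatrix e₁ e₂ φ
  obtain ⟨x, hx⟩ := (hM _).1 ⟨φ.toLinearMap, rfl⟩
  rw [hdet _ x hx, Units.val_one, one_mul] at h
  rcases Int.isUnit_iff.mp h with h | h
  · exact (detForm_ne x).1 h
  · exact (detForm_ne x).2 h

lemma not_forall_integrallyEquivalent : ¬ ∀ (Γ : Type) [Group Γ] [Finite Γ] (A B : Subgroup Γ),
    LocallyIntegrallyEquivalent A B → IntegrallyEquivalent A B :=
  fun h => not_integrallyEquivalent (h G32T9403 subH₁ subH₂ locallyIntegrallyEquivalent)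


/-! ### Systems of generators for the splitting field -/

/-- Generators of the splitting field of `f₁` with their relations. -/
@[ext]
structure RootData (L : Type*) [Field L] where
  /-- a square root of `-1` -/
  I : L
  /-- a primitive cube root of unity -/
  w : L
  /-- a cube root of `6` -/
  c : L
  /-- a square root of `2` -/
  r : L
  /-- a square root of `4 - 2 c` -/
  a : L
  /-- a square root of `4 - 2 w c` -/
  b : L
  /-- a square root of `4 - 2 w ^ 2 c` -/
  d : L
  /-- a root of `f₁` -/
  x : L
  sq_I : I ^ 2 = -1
  sq_w : w ^ 2 + w + 1 = 0
  cube_c : c ^ 3 = 6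
  sq_r : r ^ 2 = 2
  sq_a : a ^ 2 = 4 - 2 * c
  sq_b : b ^ 2 = 4 - 2 * (w * c)
  sq_d : d ^ 2 = 4 - 2 * (w ^ 2 * c)
  mul_abd : a * b * d = -4
  pow_x : x ^ 4 * (1 + (a + b + d) / 2) ^ 2 = 6 * (r - 1)

namespace RootData

variable {L : Type*} [Field L] (D : RootData L)

/-- The roots of `k ^ 4 - 4 k ^ 3 + 12 k - 12`. -/
def k : Fin 4 → L :=
  ![1 + (D.a + D.b + D.d) / 2, 1 + (D.a - D.b - D.d) / 2, 1 + (-D.a + D.b - D.d) / 2,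
    1 + (-D.a - D.b + D.d) / 2]

/-- The pairwise products of square roots of the entries of `k`. -/
def B : Fin 4 → Fin 4 → L :=
  let F := (2 * D.w + 1) / 3 * D.c ^ 2 + D.c - (D.w + 2)
  let F' := -(2 * D.w + 1) / 3 * D.c ^ 2 + D.c + (D.w - 1)
  let G := (1 - D.w) / 3 * D.c ^ 2 + D.w * D.c - (D.w + 2)
  let G' := (D.w - 1) / 3 * D.c ^ 2 + D.w * D.c + (D.w - 1)
  let H := -(D.w + 2) / 3 * D.c ^ 2 - (D.w + 1) * D.c - (D.w + 2)
  let H' := (D.w + 2) / 3 * D.c ^ 2 - (D.w + 1) * D.c + (D.w - 1)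
  ![![D.k 0, (D.b * F - D.d * F') / 2, (D.a * G' - D.d * G) / 2, (D.a * H - D.b * H') / 2],
    ![(D.b * F - D.d * F') / 2, D.k 1, (D.a * H + D.b * H') / 2, -(D.a * G' + D.d * G) / 2],
    ![(D.a * G' - D.d * G) / 2, (D.a * H + D.b * H') / 2, D.k 2, (D.b * F + D.d * F') / 2],
    ![(D.a * H - D.b * H') / 2, -(D.a * G' + D.d * G) / 2, (D.b * F + D.d * F') / 2, D.k 3]]

lemma B_symm (i j : Fin 4) : D.B i j = D.B j i := by
  fin_cases i <;> fin_cases j <;> rfl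

lemma B_self (i : Fin 4) : D.B i i = D.k i := by
  fin_cases i <;> rfl

section
variable [CharZero L]

/-- From `a b d = -4` one has `b d = -4 a / (4 - 2 c)`, and `(4 - 2 c)(4 + 2 c + c²) = 2 (8 - c³) =
4`. The two analogues replace `c` by its conjugates. -/
lemma mul_bd : D.b * D.d = -D.a * (4 + 2 * D.c + D.c ^ 2) := by
  obtain ⟨I, w, c, r, a, b, d, x, hI, hw, hc, hr, ha, hb, hd, habd, hx⟩ := D
  linear_combination (1/4 * c ^ 2 + 1/2 * c + 1) * (a) * habd - (1/4 * c ^ 2 + 1/2 * c + 1) * (b * d) * ha + (1/2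
    * b * d) * hc

lemma mul_ad : D.a * D.d = -D.b * (4 + 2 * D.w * D.c + D.w ^ 2 * D.c ^ 2) := by
  obtain ⟨I, w, c, r, a, b, d, x, hI, hw, hc, hr, ha, hb, hd, habd, hx⟩ := D
  linear_combination (1/4 * w ^ 2 * c ^ 2 + 1/2 * w * c + 1) * (b) * habd - (1/4 * w ^ 2 * c ^ 2 + 1/2 * w * c +
    1) * (a * d) * hb + (1/2 * w * c ^ 3 * a * d - 1/2 * c ^ 3 * a * d) * hw + (1/2 * a * d) * hc

lemma mul_ab : D.a * D.b = -D.d * (4 + 2 * D.w ^ 2 * D.c + D.w * D.c ^ 2) := by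
  obtain ⟨I, w, c, r, a, b, d, x, hI, hw, hc, hr, ha, hb, hd, habd, hx⟩ := D
  linear_combination (1/4 * w ^ 4 * c ^ 2 + 1/2 * w ^ 2 * c + 1) * (d) * habd - (1/4 * w ^ 4 * c ^ 2 + 1/2 * w ^ 2
    * c + 1) * (a * b) * hd + (1/2 * w ^ 4 * c ^ 3 * a * b - 1/2 * w ^ 3 * c ^ 3 * a * b - w ^ 2
    * c ^ 2 * d + 1/2 * w * c ^ 3 * a * b + w * c ^ 2 * d - 1/2 * c ^ 3 * a * b) * hw + (1/2 * a
    * b) * hc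

/-- Euler's solution of the quartic: after the shift by 1, the roots are half sums of square roots
of the roots of the resolvent cubic. The condition on `a b d` leaves four choices of sign. -/
lemma quartic_k (j : Fin 4) : D.k j ^ 4 - 4 * D.k j ^ 3 + 12 * D.k j - 12 = 0 := by
  have hbd := D.mul_bd
  have had := D.mul_ad
  have hab := D.mul_ab
  obtain ⟨I, w, c, r, a, b, d, x, hI, hw, hc, hr, ha, hb, hd, habd, hx⟩ := D
  fin_cases j
  · change (1 + (a + b + d) / 2) ^ 4 - 4 * (1 + (a + b + d) / 2) ^ 3 + 12 * (1 + (a + b + d) / 2) - 12 = 0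
    linear_combination (-1/8 * c + 1/16 * a ^ 2 + 1/4 * a * b + 1/4 * a * d + 3/8 * b ^ 2 + 3/4 * b * d + 3/8 * d ^
    2 - 5/4) * ha + (-1/8 * w * c - 3/4 * c + 1/4 * a * b + 3/4 * a * d + 1/16 * b ^ 2 + 1/4 * b
    * d + 3/8 * d ^ 2 + 1/4) * hb + (-1/8 * w ^ 2 * c - 3/4 * w * c - 3/4 * c + 3/4 * a * b + 1/4
    * a * d + 1/4 * b * d + 1/16 * d ^ 2 + 7/4) * hd + (-3/2 * w ^ 2 * c - 1/2 * w * c - 1/2 * c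
    + 2) * hab + (-1/2 * w ^ 2 * c - 3/2 * w * c - 1/2 * c + 2) * had + (-1/2 * w ^ 2 * c - 1/2 *
    w * c - 3/2 * c + 2) * hbd + (1/2 * w ^ 2 * c ^ 3 * b + 3 * w ^ 2 * c ^ 2 * d + 1/4 * w ^ 2 *
    c ^ 2 + w * c ^ 3 * b + 3/2 * w * c ^ 3 * d + w * c ^ 2 * b - 2 * w * c ^ 2 * d + 5/4 * w * c
    ^ 2 + 1/2 * c ^ 3 * a - c ^ 3 * b - c ^ 3 * d + c ^ 2 * a + 1/4 * c ^ 2 + 2 * c * a + 2 * c *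
    b + 2 * c * d - 4 * c) * hw + (a + b + d) * hc
  · change (1 + (a - b - d) / 2) ^ 4 - 4 * (1 + (a - b - d) / 2) ^ 3 + 12 * (1 + (a - b - d) / 2) - 12 = 0
    linear_combination (-1/8 * c + 1/16 * a ^ 2 - 1/4 * a * b - 1/4 * a * d + 3/8 * b ^ 2 + 3/4 * b * d + 3/8 * d ^
    2 - 5/4) * ha + (-1/8 * w * c - 3/4 * c - 1/4 * a * b - 3/4 * a * d + 1/16 * b ^ 2 + 1/4 * b
    * d + 3/8 * d ^ 2 + 1/4) * hb + (-1/8 * w ^ 2 * c - 3/4 * w * c - 3/4 * c - 3/4 * a * b - 1/4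
    * a * d + 1/4 * b * d + 1/16 * d ^ 2 + 7/4) * hd + (3/2 * w ^ 2 * c + 1/2 * w * c + 1/2 * c -
    2) * hab + (1/2 * w ^ 2 * c + 3/2 * w * c + 1/2 * c - 2) * had + (-1/2 * w ^ 2 * c - 1/2 * w
    * c - 3/2 * c + 2) * hbd + (-1/2 * w ^ 2 * c ^ 3 * b - 3 * w ^ 2 * c ^ 2 * d + 1/4 * w ^ 2 *
    c ^ 2 - w * c ^ 3 * b - 3/2 * w * c ^ 3 * d - w * c ^ 2 * b + 2 * w * c ^ 2 * d + 5/4 * w * c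
    ^ 2 + 1/2 * c ^ 3 * a + c ^ 3 * b + c ^ 3 * d + c ^ 2 * a + 1/4 * c ^ 2 + 2 * c * a - 2 * c *
    b - 2 * c * d - 4 * c) * hw + (a - b - d) * hc
  · change (1 + (-a + b - d) / 2) ^ 4 - 4 * (1 + (-a + b - d) / 2) ^ 3 + 12 * (1 + (-a + b - d) / 2) - 12 = 0
    linear_combination (-1/8 * c + 1/16 * a ^ 2 - 1/4 * a * b + 1/4 * a * d + 3/8 * b ^ 2 - 3/4 * b * d + 3/8 * d ^
    2 - 5/4) * ha + (-1/8 * w * c - 3/4 * c - 1/4 * a * b + 3/4 * a * d + 1/16 * b ^ 2 - 1/4 * b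
    * d + 3/8 * d ^ 2 + 1/4) * hb + (-1/8 * w ^ 2 * c - 3/4 * w * c - 3/4 * c - 3/4 * a * b + 1/4
    * a * d - 1/4 * b * d + 1/16 * d ^ 2 + 7/4) * hd + (3/2 * w ^ 2 * c + 1/2 * w * c + 1/2 * c -
    2) * hab + (-1/2 * w ^ 2 * c - 3/2 * w * c - 1/2 * c + 2) * had + (1/2 * w ^ 2 * c + 1/2 * w
    * c + 3/2 * c - 2) * hbd + (1/2 * w ^ 2 * c ^ 3 * b - 3 * w ^ 2 * c ^ 2 * d + 1/4 * w ^ 2 * c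
    ^ 2 + w * c ^ 3 * b - 3/2 * w * c ^ 3 * d + w * c ^ 2 * b + 2 * w * c ^ 2 * d + 5/4 * w * c ^
    2 - 1/2 * c ^ 3 * a - c ^ 3 * b + c ^ 3 * d - c ^ 2 * a + 1/4 * c ^ 2 - 2 * c * a + 2 * c * b
    - 2 * c * d - 4 * c) * hw + (-a + b - d) * hc
  · change (1 + (-a - b + d) / 2) ^ 4 - 4 * (1 + (-a - b + d) / 2) ^ 3 + 12 * (1 + (-a - b + d) / 2) - 12 = 0
    linear_combination (-1/8 * c + 1/16 * a ^ 2 + 1/4 * a * b - 1/4 * a * d + 3/8 * b ^ 2 - 3/4 * b * d + 3/8 * d ^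
    2 - 5/4) * ha + (-1/8 * w * c - 3/4 * c + 1/4 * a * b - 3/4 * a * d + 1/16 * b ^ 2 - 1/4 * b
    * d + 3/8 * d ^ 2 + 1/4) * hb + (-1/8 * w ^ 2 * c - 3/4 * w * c - 3/4 * c + 3/4 * a * b - 1/4
    * a * d - 1/4 * b * d + 1/16 * d ^ 2 + 7/4) * hd + (-3/2 * w ^ 2 * c - 1/2 * w * c - 1/2 * c
    + 2) * hab + (1/2 * w ^ 2 * c + 3/2 * w * c + 1/2 * c - 2) * had + (1/2 * w ^ 2 * c + 1/2 * w
    * c + 3/2 * c - 2) * hbd + (-1/2 * w ^ 2 * c ^ 3 * b + 3 * w ^ 2 * c ^ 2 * d + 1/4 * w ^ 2 *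
    c ^ 2 - w * c ^ 3 * b + 3/2 * w * c ^ 3 * d - w * c ^ 2 * b - 2 * w * c ^ 2 * d + 5/4 * w * c
    ^ 2 - 1/2 * c ^ 3 * a + c ^ 3 * b - c ^ 3 * d - c ^ 2 * a + 1/4 * c ^ 2 - 2 * c * a - 2 * c *
    b + 2 * c * d - 4 * c) * hw + (-a - b + d) * hc

lemma k_ne_zero (j : Fin 4) : D.k j ≠ 0 := by
  intro h
  have := D.quartic_k j
  rw [h] at this
  norm_num at this

/-- Each product of two of the `k` is a square in the field, and this identity says that the square
roots `B` have compatible signs. The cases are polynomial identities modulo the relations for the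
generators. -/
lemma B_zero_mul (i j : Fin 4) : D.B 0 i * D.B 0 j = D.k 0 * D.B i j := by
  have h11 : D.B 0 1 * D.B 0 1 = D.k 0 * D.B 1 1 := by
    have hbd := D.mul_bd
    have had := D.mul_ad
    have hab := D.mul_ab
    obtain ⟨I, w, c, r, a, b, d, x, hI, hw, hc, hr, ha, hb, hd, habd, hx⟩ := D
    simp only [B, k, Matrix.cons_val]
    linear_combination (-1/4) * ha + (1/9 * w ^ 2 * c ^ 4 - 1/3 * w ^ 2 * c ^ 2 + 1/4 * w ^ 2 + 1/9 * w * c ^ 4 +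
      1/3 * w * c ^ 3 - 5/6 * w * c ^ 2 - 1/2 * w * c + w + 1/36 * c ^ 4 + 1/6 * c ^ 3 - 1/12 * c
      ^ 2 - c + 5/4) * hb + (1/9 * w ^ 2 * c ^ 4 - 1/3 * w ^ 2 * c ^ 2 + 1/4 * w ^ 2 + 1/9 * w *
      c ^ 4 - 1/3 * w * c ^ 3 + 1/6 * w * c ^ 2 + 1/2 * w * c - 1/2 * w + 1/36 * c ^ 4 - 1/6 * c
      ^ 3 + 5/12 * c ^ 2 - 1/2 * c + 1/2) * hd + (2/9 * w ^ 2 * c ^ 4 - 2/3 * w ^ 2 * c ^ 2 + 1/2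
      * w ^ 2 + 2/9 * w * c ^ 4 - 2/3 * w * c ^ 2 + 1/2 * w + 1/18 * c ^ 4 - 2/3 * c ^ 2 + 3/2 *
      c - 1/2) * hbd + (-2/9 * w ^ 2 * c ^ 5 + 2/3 * w ^ 2 * c ^ 3 - 1/2 * w ^ 2 * c - 2/9 * w *
      c ^ 5 + 2/3 * w * c ^ 4 - 1/3 * w * c ^ 3 - w * c ^ 2 + w * c - 2/9 * c ^ 6 * a - 4/9 * c ^
      5 * a + 1/6 * c ^ 5 - 2/9 * c ^ 4 * a - 1/9 * c ^ 4 + 4/3 * c ^ 3 * a + 1/2 * c ^ 3 + 13/6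
      * c ^ 2 * a + 1/3 * c ^ 2 - c * a - 7/2 * c - 2 * a + 2) * hw + (1/6 * c ^ 3 * a + 1/3 * c
      ^ 2 * a - 1/6 * c ^ 2 + 2/3 * c * a + 1/3 * c - 1/2 * a - 1/2) * hc
  have h22 : D.B 0 2 * D.B 0 2 = D.k 0 * D.B 2 2 := by
    have hbd := D.mul_bd
    have had := D.mul_ad
    have hab := D.mul_ab
    obtain ⟨I, w, c, r, a, b, d, x, hI, hw, hc, hr, ha, hb, hd, habd, hx⟩ := D
    simp only [B, k, Matrix.cons_val]
    linear_combination (1/36 * w ^ 2 * c ^ 4 + 1/6 * w ^ 2 * c ^ 3 + 5/12 * w ^ 2 * c ^ 2 + 1/2 * w ^ 2 * c + 1/4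
      * w ^ 2 - 1/18 * w * c ^ 4 - 1/6 * w * c ^ 3 - 1/3 * w * c ^ 2 - 1/2 * w * c - 1/2 * w +
      1/36 * c ^ 4 + 1/6 * c ^ 2 + 1/2) * ha + (-1/4) * hb + (1/36 * w ^ 2 * c ^ 4 - 1/6 * w ^ 2
      * c ^ 3 + 5/12 * w ^ 2 * c ^ 2 - 1/2 * w ^ 2 * c + 1/4 * w ^ 2 - 1/18 * w * c ^ 4 + 1/6 * w
      * c ^ 3 + 1/6 * w * c ^ 2 - w * c + w + 1/36 * c ^ 4 - 1/3 * c ^ 2 + 5/4) * hd + (1/18 * w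
      ^ 2 * c ^ 4 - 1/6 * w ^ 2 * c ^ 2 + 1/2 * w ^ 2 - 1/9 * w * c ^ 4 - 1/6 * w * c ^ 2 + 3/2 *
      w * c + 1/2 * w + 1/18 * c ^ 4 - 1/6 * c ^ 2 - 1/2) * had + (-1/18 * w ^ 2 * c ^ 6 * b -
      1/18 * w ^ 2 * c ^ 5 + 1/6 * w ^ 2 * c ^ 4 * b + 1/3 * w ^ 2 * c ^ 4 - 5/6 * w ^ 2 * c ^ 3
      - 1/2 * w ^ 2 * c ^ 2 * b + w ^ 2 * c ^ 2 - 1/2 * w ^ 2 * c + 1/6 * w * c ^ 6 * b - 1/9 * w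
      * c ^ 5 * b + 1/6 * w * c ^ 5 - 2/3 * w * c ^ 4 - 7/6 * w * c ^ 3 * b + 1/2 * w * c ^ 3 + w
      * c ^ 2 - w * c * b - 3/2 * w * c - 1/6 * c ^ 6 * b + 1/3 * c ^ 5 * b - 2/9 * c ^ 5 - 2/9 *
      c ^ 4 * b + 2/9 * c ^ 4 + 3/2 * c ^ 3 * b + 1/6 * c ^ 3 - 4/3 * c ^ 2 * b + 1/3 * c ^ 2 - c
      - 2 * b + 2) * hw + (-1/3 * w * c ^ 2 * b + 1/6 * w * c ^ 2 + 2/3 * w * c * b + 1/3 * w * c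
      + 1/6 * c ^ 3 * b - 1/3 * c ^ 2 * b + 1/6 * c ^ 2 - 1/2 * b - 1/2) * hc
  have h33 : D.B 0 3 * D.B 0 3 = D.k 0 * D.B 3 3 := by
    have hbd := D.mul_bd
    have had := D.mul_ad
    have hab := D.mul_ab
    obtain ⟨I, w, c, r, a, b, d, x, hI, hw, hc, hr, ha, hb, hd, habd, hx⟩ := D
    simp only [B, k, Matrix.cons_val]
    linear_combination (1/36 * w ^ 2 * c ^ 4 + 1/6 * w ^ 2 * c ^ 3 + 5/12 * w ^ 2 * c ^ 2 + 1/2 * w ^ 2 * c + 1/4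
      * w ^ 2 + 1/9 * w * c ^ 4 + 1/2 * w * c ^ 3 + 7/6 * w * c ^ 2 + 3/2 * w * c + w + 1/9 * c ^
      4 + 1/3 * c ^ 3 + 11/12 * c ^ 2 + c + 5/4) * ha + (1/36 * w ^ 2 * c ^ 4 - 1/6 * w ^ 2 * c ^
      3 + 5/12 * w ^ 2 * c ^ 2 - 1/2 * w ^ 2 * c + 1/4 * w ^ 2 + 1/9 * w * c ^ 4 - 1/2 * w * c ^
      3 + 2/3 * w * c ^ 2 - 1/2 * w + 1/9 * c ^ 4 - 1/3 * c ^ 3 - 1/12 * c ^ 2 + 1/2 * c + 1/2) *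
      hb + (-1/4) * hd + (1/18 * w ^ 2 * c ^ 4 - 1/6 * w ^ 2 * c ^ 2 + 1/2 * w ^ 2 + 2/9 * w * c
      ^ 4 - 1/6 * w * c ^ 2 - 3/2 * w * c + 1/2 * w + 2/9 * c ^ 4 - 1/6 * c ^ 2 - 3/2 * c - 1/2)
      * hab + (-1/9 * w ^ 2 * c ^ 5 * d + 1/3 * w ^ 2 * c ^ 3 * d - w ^ 2 * c * d - 1/18 * w * c
      ^ 6 * d - 1/3 * w * c ^ 5 * d - 1/18 * w * c ^ 5 + 1/6 * w * c ^ 4 * d + 1/3 * w * c ^ 4 -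
      5/6 * w * c ^ 3 + 5/2 * w * c ^ 2 * d + w * c ^ 2 - 1/2 * w * c - 1/6 * c ^ 6 * d - 2/9 * c
      ^ 5 - 2/9 * c ^ 4 * d + 5/9 * c ^ 4 + 3/2 * c ^ 3 * d - 4/3 * c ^ 3 + 2/3 * c ^ 2 * d + 4/3
      * c ^ 2 + 2 * c * d + 3/2 * c - 2 * d + 2) * hw + (1/3 * w * c ^ 2 * d - 1/6 * w * c ^ 2 -
      2/3 * w * c * d - 1/3 * w * c + 1/6 * c ^ 3 * d - 2/3 * c * d - 1/3 * c - 1/2 * d - 1/2) *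
      hc
  have h12 : D.B 0 1 * D.B 0 2 = D.k 0 * D.B 1 2 := by
    have hbd := D.mul_bd
    have had := D.mul_ad
    have hab := D.mul_ab
    obtain ⟨I, w, c, r, a, b, d, x, hI, hw, hc, hr, ha, hb, hd, habd, hx⟩ := D
    simp only [B, k, Matrix.cons_val]
    linear_combination (1/12 * w * c ^ 2 + 1/4 * w * c + 1/4 * w + 1/6 * c ^ 2 + 1/4 * c + 1/2) * ha + (-1/12 * w
      * c ^ 2 + 1/4 * w * c - 1/4 * w - 1/6 * c ^ 2 + 1/4 * c + 1/4) * hb + (1/18 * w ^ 2 * c ^ 4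
      - 1/6 * w ^ 2 * c ^ 3 + 1/12 * w ^ 2 * c ^ 2 + 1/4 * w ^ 2 * c - 1/4 * w ^ 2 - 1/36 * w * c
      ^ 4 - 1/6 * w * c ^ 3 + 5/6 * w * c ^ 2 - 1/2 * w * c - 1/4 * w - 1/36 * c ^ 4 + 1/12 * c ^
      3 + 1/12 * c ^ 2 - 1/2 * c + 1/2) * hd + (1/18 * w ^ 2 * c ^ 4 + 1/6 * w ^ 2 * c ^ 3 + 1/12
      * w ^ 2 * c ^ 2 - 1/4 * w ^ 2 * c - 1/4 * w ^ 2 - 1/36 * w * c ^ 4 + 1/6 * w * c ^ 3 + 1/12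
      * w * c ^ 2 + 1/4 * w * c - 1/4 * w - 1/36 * c ^ 4 - 1/12 * c ^ 3 + 1/12 * c ^ 2 + 1/4 * c
      + 5/4) * hab + (1/18 * w ^ 2 * c ^ 4 + 1/6 * w ^ 2 * c ^ 3 + 1/12 * w ^ 2 * c ^ 2 - 1/4 * w
      ^ 2 * c - 1/4 * w ^ 2 - 1/36 * w * c ^ 4 - 1/12 * w * c ^ 2 + 1/4 * w * c + 3/4 * w - 1/36
      * c ^ 4 + 1/12 * c ^ 3 + 1/2 * c + 1/4) * had + (1/18 * w ^ 2 * c ^ 4 - 1/6 * w ^ 2 * c ^ 3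
      + 1/12 * w ^ 2 * c ^ 2 + 1/4 * w ^ 2 * c - 1/4 * w ^ 2 - 1/36 * w * c ^ 4 + w * c - 5/4 * w
      - 1/36 * c ^ 4 - 1/12 * c ^ 3 + 1/6 * c ^ 2 + 3/4 * c - 3/4) * hbd + (-1/18 * w ^ 2 * c ^ 6
      * b - 1/6 * w ^ 2 * c ^ 5 * b - 1/9 * w ^ 2 * c ^ 5 * d - 1/9 * w ^ 2 * c ^ 5 - 1/12 * w ^
      2 * c ^ 4 * b - 1/3 * w ^ 2 * c ^ 4 * d + 1/3 * w ^ 2 * c ^ 4 + 1/4 * w ^ 2 * c ^ 3 * b -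
      1/6 * w ^ 2 * c ^ 3 * d - 1/6 * w ^ 2 * c ^ 3 + 1/4 * w ^ 2 * c ^ 2 * b + 1/2 * w ^ 2 * c ^
      2 * d - 1/2 * w ^ 2 * c ^ 2 + 1/2 * w ^ 2 * c * d + 1/2 * w ^ 2 * c + 1/12 * w * c ^ 6 * b
      - 1/18 * w * c ^ 6 * d + 1/18 * w * c ^ 5 * b + 1/6 * w * c ^ 5 - 1/6 * w * c ^ 4 * b -
      1/12 * w * c ^ 4 * d - 2/3 * w * c ^ 3 * b + 1/4 * w * c ^ 3 * d - 3/2 * w * c ^ 3 - 1/2 *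
      w * c ^ 2 * b - 3/4 * w * c ^ 2 * d + 3/2 * w * c ^ 2 + 1/2 * w * c * b - 1/18 * c ^ 6 * a
      + 1/12 * c ^ 6 * d + 1/18 * c ^ 5 * a + 1/12 * c ^ 5 * b + 1/36 * c ^ 4 * a + 1/36 * c ^ 4
      * b + 5/18 * c ^ 4 * d - 5/18 * c ^ 4 + 1/4 * c ^ 3 * a - 7/12 * c ^ 3 * b - 7/6 * c ^ 3 *
      d + c ^ 3 - 7/12 * c ^ 2 * a - 5/6 * c ^ 2 * b - 1/3 * c ^ 2 * d - 1/6 * c ^ 2 - 1/2 * c *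
      a - c * b - 2 * c * d + a + b + d - 1) * hw + (1/12 * w * c ^ 3 * a - 1/12 * w * c ^ 3 * b
      - 1/12 * w * c ^ 2 * b + 1/12 * w * c ^ 2 * d - 1/6 * w * c ^ 2 + 1/12 * w * c * a + 1/12 *
      w * c * b - 1/6 * w * c * d + 1/6 * w * c - 3/4 * w * a + 3/4 * w * b + 1/12 * c ^ 3 * a -
      1/12 * c ^ 3 * d + 1/12 * c ^ 2 * a - 1/12 * c ^ 2 * b + 1/12 * c * a + 1/12 * c * b - 1/6
      * c * d + 1/6 * c - 1/2 * a + 1/4 * b + d - 1) * hc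
  have h13 : D.B 0 1 * D.B 0 3 = D.k 0 * D.B 1 3 := by
    have hbd := D.mul_bd
    have had := D.mul_ad
    have hab := D.mul_ab
    obtain ⟨I, w, c, r, a, b, d, x, hI, hw, hc, hr, ha, hb, hd, habd, hx⟩ := D
    simp only [B, k, Matrix.cons_val]
    linear_combination (1/12 * w * c ^ 2 + 1/4 * w * c + 1/4 * w - 1/12 * c ^ 2 - 1/4) * ha + (-1/18 * w ^ 2 * c ^
      4 + 1/6 * w ^ 2 * c ^ 3 - 1/12 * w ^ 2 * c ^ 2 - 1/4 * w ^ 2 * c + 1/4 * w ^ 2 - 5/36 * w *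
      c ^ 4 + 1/6 * w * c ^ 3 + 2/3 * w * c ^ 2 - w * c + 1/4 * w - 1/18 * c ^ 4 - 1/12 * c ^ 3 +
      2/3 * c ^ 2 - 1/4 * c - 1/2) * hb + (-1/12 * w * c ^ 2 + 1/4 * w * c - 1/4 * w + 1/12 * c ^
      2 - 1/2) * hd + (-1/18 * w ^ 2 * c ^ 4 - 1/6 * w ^ 2 * c ^ 3 - 1/12 * w ^ 2 * c ^ 2 + 1/4 *
      w ^ 2 * c + 1/4 * w ^ 2 - 5/36 * w * c ^ 4 - 1/3 * w * c ^ 3 - 1/4 * w * c ^ 2 + 3/4 * w *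
      c + 5/4 * w - 1/18 * c ^ 4 - 1/4 * c ^ 3 - 1/6 * c ^ 2 + 3/4) * hab + (-1/18 * w ^ 2 * c ^
      4 - 1/6 * w ^ 2 * c ^ 3 - 1/12 * w ^ 2 * c ^ 2 + 1/4 * w ^ 2 * c + 1/4 * w ^ 2 - 5/36 * w *
      c ^ 4 - 1/6 * w * c ^ 3 - 1/12 * w * c ^ 2 + 3/4 * w * c + 1/4 * w - 1/18 * c ^ 4 + 1/12 *
      c ^ 3 - 1/12 * c ^ 2 + 1/4 * c - 5/4) * had + (-1/18 * w ^ 2 * c ^ 4 + 1/6 * w ^ 2 * c ^ 3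
      - 1/12 * w ^ 2 * c ^ 2 - 1/4 * w ^ 2 * c + 1/4 * w ^ 2 - 5/36 * w * c ^ 4 + 1/3 * w * c ^ 3
      - 1/6 * w * c ^ 2 + 1/2 * w * c - 3/4 * w - 1/18 * c ^ 4 + 1/4 * c ^ 3 - 1/4 * c ^ 2 - 1/4)
      * hbd + (1/18 * w ^ 2 * c ^ 6 * b + 1/6 * w ^ 2 * c ^ 5 * b + 1/9 * w ^ 2 * c ^ 5 * d +
      1/12 * w ^ 2 * c ^ 4 * b + 1/3 * w ^ 2 * c ^ 4 * d - 1/4 * w ^ 2 * c ^ 3 * b + 1/6 * w ^ 2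
      * c ^ 3 * d - 1/4 * w ^ 2 * c ^ 2 * b - 1/2 * w ^ 2 * c ^ 2 * d - 1/2 * w ^ 2 * c * d +
      1/12 * w * c ^ 6 * b + 1/18 * w * c ^ 6 * d + 1/9 * w * c ^ 5 * b + 1/3 * w * c ^ 5 * d +
      1/9 * w * c ^ 5 + 1/3 * w * c ^ 4 * b + 5/12 * w * c ^ 4 * d - 1/3 * w * c ^ 4 - 1/3 * w *
      c ^ 3 * b + 1/12 * w * c ^ 3 * d + 1/3 * w * c ^ 3 - 1/2 * w * c ^ 2 * b - 5/4 * w * c ^ 2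
      * d - 1/2 * w * c * b - 2 * w * c * d + 1/18 * c ^ 6 * a - 1/12 * c ^ 6 * b + 1/12 * c ^ 6
      * d - 1/18 * c ^ 5 * a - 1/12 * c ^ 5 * b + 1/6 * c ^ 5 - 1/36 * c ^ 4 * a + 2/9 * c ^ 4 *
      b + 2/9 * c ^ 4 * d - 2/9 * c ^ 4 - 1/4 * c ^ 3 * a + 7/6 * c ^ 3 * b - 7/6 * c ^ 3 + 7/12
      * c ^ 2 * a + 5/6 * c ^ 2 * b + 5/6 * c ^ 2 * d + 5/3 * c ^ 2 + 1/2 * c * a - c * b - 1/2 *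
      c - a - b - d + 1) * hw + (1/12 * w * c ^ 3 * a - 1/12 * w * c ^ 3 * d + 1/12 * w * c ^ 2 *
      b - 1/12 * w * c ^ 2 * d - 1/6 * w * c ^ 2 + 1/12 * w * c * a - 1/6 * w * c * b + 1/12 * w
      * c * d + 1/6 * w * c - 3/4 * w * a + 3/4 * w * d + 1/12 * c ^ 3 * b - 1/12 * c ^ 3 * d -
      1/12 * c ^ 2 * a + 1/12 * c ^ 2 * b - 1/6 * c ^ 2 - 1/4 * a - b + 1/2 * d + 1) * hc
  have h23 : D.B 0 2 * D.B 0 3 = D.k 0 * D.B 2 3 := by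
    have hbd := D.mul_bd
    have had := D.mul_ad
    have hab := D.mul_ab
    obtain ⟨I, w, c, r, a, b, d, x, hI, hw, hc, hr, ha, hb, hd, habd, hx⟩ := D
    simp only [B, k, Matrix.cons_val]
    linear_combination (-1/36 * w ^ 2 * c ^ 4 - 1/6 * w ^ 2 * c ^ 3 - 5/12 * w ^ 2 * c ^ 2 - 1/2 * w ^ 2 * c - 1/4
      * w ^ 2 - 1/36 * w * c ^ 4 - 1/6 * w * c ^ 3 - 5/12 * w * c ^ 2 - 1/2 * w * c - 1/4 * w +
      1/18 * c ^ 4 + 1/12 * c ^ 3 + 1/3 * c ^ 2 + 1/4 * c + 1/2) * ha + (-1/6 * w * c ^ 2 + 1/4 *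
      w - 1/12 * c ^ 2 - 1/4 * c + 1/2) * hb + (1/6 * w * c ^ 2 - 1/4 * w + 1/12 * c ^ 2 - 1/4 *
      c + 1/4) * hd + (-1/36 * w ^ 2 * c ^ 4 + 1/12 * w ^ 2 * c ^ 2 - 1/4 * w ^ 2 - 1/36 * w * c
      ^ 4 - 1/6 * w * c ^ 3 + 1/6 * w * c ^ 2 + 1/4 * w * c + 3/4 * w + 1/18 * c ^ 4 - 1/12 * c ^
      3 - 1/2 * c + 1/4) * hab + (-1/36 * w ^ 2 * c ^ 4 + 1/12 * w ^ 2 * c ^ 2 - 1/4 * w ^ 2 -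
      1/36 * w * c ^ 4 + 1/6 * w * c ^ 3 - 1/4 * w * c - 5/4 * w + 1/18 * c ^ 4 + 1/12 * c ^ 3 -
      1/12 * c ^ 2 - 3/4 * c - 3/4) * had + (-1/36 * w ^ 2 * c ^ 4 + 1/6 * w ^ 2 * c ^ 3 - 5/12 *
      w ^ 2 * c ^ 2 + 1/2 * w ^ 2 * c - 1/4 * w ^ 2 - 1/36 * w * c ^ 4 + 1/6 * w * c ^ 3 - 5/12 *
      w * c ^ 2 + 1/2 * w * c - 1/4 * w + 1/18 * c ^ 4 - 1/12 * c ^ 3 - 5/12 * c ^ 2 + 5/4) * hbd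
      + (1/36 * w ^ 2 * c ^ 6 * b + 1/18 * w ^ 2 * c ^ 5 * d - 1/12 * w ^ 2 * c ^ 4 * b - 1/6 * w
      ^ 2 * c ^ 3 * d + 1/4 * w ^ 2 * c ^ 2 * b + 1/2 * w ^ 2 * c * d + 1/36 * w * c ^ 6 * d -
      1/9 * w * c ^ 5 * b + 1/12 * w * c ^ 4 * b + 1/4 * w * c ^ 4 * d + 1/12 * w * c ^ 3 * b -
      1/6 * w * c ^ 3 * d - 1/3 * w * c ^ 3 + w * c ^ 2 * b - 1/4 * w * c ^ 2 * d + 1/2 * w * c *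
      b - 2 * w * c * d + 1/2 * w * c + 1/36 * c ^ 6 * a - 1/12 * c ^ 6 * b - 1/9 * c ^ 5 * a +
      1/12 * c ^ 5 * b + 1/18 * c ^ 5 + 7/36 * c ^ 4 * a - 5/36 * c ^ 4 * b - 5/36 * c ^ 4 * d +
      2/9 * c ^ 4 - 1/3 * c ^ 3 * a + 2/3 * c ^ 3 * b + 1/12 * c ^ 3 * d + 2/3 * c ^ 3 + 11/12 *
      c ^ 2 * a - 1/3 * c ^ 2 * b + 1/6 * c ^ 2 * d - 1/6 * c ^ 2 - 3/2 * c * a + 2 * c * b + c *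
      d - 3 * c + a + b + d - 1) * hw + (1/12 * w * c ^ 3 * b - 1/12 * w * c ^ 3 * d - 1/12 * w *
      c ^ 2 * b + 1/12 * w * c ^ 2 * d - 3/4 * w * b + 3/4 * w * d - 1/12 * c ^ 3 * a + 1/12 * c
      ^ 3 * b + 1/12 * c ^ 2 * a - 1/12 * c ^ 2 * b - 1/6 * c ^ 2 + 1/6 * c * a - 1/12 * c * b -
      1/12 * c * d - 1/6 * c + a - 1/2 * b + 1/4 * d - 1) * hc
  have h0 : ∀ l, D.B 0 0 * D.B 0 l = D.k 0 * D.B 0 l := fun l => rfl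
  fin_cases i <;> fin_cases j
  · exact h0 0
  · exact h0 1
  · exact h0 2
  · exact h0 3
  · exact (mul_comm _ _).trans (h0 1)
  · exact h11
  · exact h12
  · exact h13
  · exact (mul_comm _ _).trans (h0 2)
  · exact (mul_comm _ _).trans h12
  · exact h22
  · exact h23
  · exact (mul_comm _ _).trans (h0 3)
  · exact (mul_comm _ _).trans h13
  · exact (mul_comm _ _).trans h23
  · exact h33

/-- Every entry is compared with the row of index 0; the factor `k 0 ^ 2` that arises is not zero.
-/
lemma B_mul (i j l : Fin 4) : D.B i j * D.B j l = D.k j * D.B i l := by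
  have h1 := D.B_zero_mul i j
  have h2 := D.B_zero_mul j l
  have h3 := D.B_zero_mul i l
  have h4 := D.B_zero_mul j j
  rw [B_self] at h4
  have h0 := D.k_ne_zero 0
  refine mul_left_cancel₀ (mul_ne_zero h0 h0) ?_
  linear_combination (-D.k 0 * D.B j l) * h1 - (D.B 0 i * D.B 0 j) * h2 + D.k 0 * D.k j * h3 +
    (D.B 0 i * D.B 0 l) * h4

lemma B_ne_zero (i j : Fin 4) : D.B i j ≠ 0 := by
  intro h
  have h1 := D.B_mul i j i
  rw [h, zero_mul, B_self, eq_comm, mul_eq_zero] at h1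
  exact h1.elim (D.k_ne_zero _) (D.k_ne_zero _)

end

end RootData


/-! ### The roots of the first polynomial and their transformation -/

namespace RootData

variable {L : Type*} [Field L] (D : RootData L)

lemma pow_four_I : D.I ^ 4 = 1 := by linear_combination (D.I ^ 2 - 1) * D.sq_I

lemma cube_w : D.w ^ 3 = 1 := by linear_combination (D.w - 1) * D.sq_w

lemma pow_I_mod (m : ℕ) : D.I ^ (m % 4) = D.I ^ m := (pow_eq_pow_mod m D.pow_four_I).symm

lemma pow_I_add (m n : Fin 4) : D.I ^ ((m + n : Fin 4) : ℕ) = D.I ^ (m : ℕ) * D.I ^ (n : ℕ) := by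
  rw [Fin.val_add, pow_I_mod, pow_add]

lemma pow_I_mul (m n : Fin 4) : D.I ^ ((m * n : Fin 4) : ℕ) = (D.I ^ (m : ℕ)) ^ (n : ℕ) := by
  rw [Fin.val_mul, pow_I_mod, pow_mul]

/-- The numerators of the roots of `f₁`. -/
def T : Fin 2 → L := ![D.x * D.k 0, (1 - D.I) * (2 * D.w + 1) / D.x]

/-- The roots of `f₁`. -/
def root (p : Fin 2 × Fin 4 × Fin 4) : L := D.I ^ (p.2.2 : ℕ) * (D.T p.1 / D.B 0 p.2.1)

section
variable [CharZero L]

lemma w_ne : 2 * D.w + 1 ≠ 0 := by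
  intro h
  have : (2 * D.w + 1) ^ 2 = -3 := by linear_combination 4 * D.sq_w
  rw [h] at this
  norm_num at this

lemma I_ne : 1 - D.I ≠ 0 := by
  intro h
  have : D.I ^ 2 = 1 := by rw [← sub_eq_zero.mp h, one_pow]
  rw [D.sq_I] at this
  norm_num at this

lemma x_ne_zero : D.x ≠ 0 := by
  intro h
  have h1 := D.pow_x
  have h2 := D.sq_r
  rw [h] at h1
  have h3 : D.r = 1 := by linear_combination (1 / 6) * (-h1)
  rw [h3] at h2
  norm_num at h2

lemma T_ne_zero (e : Fin 2) : D.T e ≠ 0 := by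
  fin_cases e
  · exact mul_ne_zero D.x_ne_zero (D.k_ne_zero 0)
  · exact div_ne_zero (mul_ne_zero D.I_ne D.w_ne) D.x_ne_zero

lemma root_zero : D.root (0, 0, 0) = D.x := by
  change D.I ^ 0 * (D.x * D.k 0 / D.k 0) = D.x
  rw [pow_zero, one_mul, mul_div_cancel_right₀ _ (D.k_ne_zero 0)]

lemma T_zero_mul (e : Fin 2) : D.T e * D.T (e + 1) = (1 - D.I) * (2 * D.w + 1) * D.k 0 := by
  have h : D.T 0 * D.T 1 = (1 - D.I) * (2 * D.w + 1) * D.k 0 := by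
    change D.x * D.k 0 * ((1 - D.I) * (2 * D.w + 1) / D.x) = _
    have := D.x_ne_zero
    field_simp
  fin_cases e
  · exact h
  · exact (mul_comm _ _).trans h

/-- The roots attached to a second system of generators. -/
lemma T_div_B {D D' : RootData L} {π : Fin 4 → Fin 4} {s : Fin 4 → L} {e : Fin 2} {y z u : L}
    (hs : ∀ j, s j ^ 2 = 1) (hB : ∀ j, D'.B 0 j = s 0 * s j * D.B (π 0) (π j))
    (hx : D'.x * D.B 0 (π 0) = s 0 * y * D.T e) (hw : 2 * D'.w + 1 = u * (2 * D.w + 1))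
    (hz : z * y * (1 - D.I) = u * (1 - D'.I)) (j : Fin 4) :
    D'.T 0 / D'.B 0 j = s j * y * (D.T e / D.B 0 (π j)) ∧
      D'.T 1 / D'.B 0 j = s j * z * (D.T (e + 1) / D.B 0 (π j)) := by
  have h1 := D.B_mul 0 (π 0) (π j)
  have h2 := D.B_mul (π 0) 0 (π j)
  have hT := D.T_zero_mul e
  have h0 := hs 0
  have hj := hs j
  have hk : D'.k 0 = D.k (π 0) := by
    rw [← B_self, hB, B_self]
    linear_combination D.k (π 0) * h0
  have hB0 := D.B_ne_zero 0 (π 0)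
  rw [D.B_symm (π 0) 0] at h2
  constructor
  · rw [← mul_div_assoc, div_eq_div_iff (D'.B_ne_zero _ _) (D.B_ne_zero _ _), hB]
    change D'.x * D'.k 0 * _ = _
    rw [hk]
    linear_combination D.B (π 0) (π j) * hx - D'.x * h1 -
      y * D.T e * s 0 * D.B (π 0) (π j) * hj
  · rw [← mul_div_assoc, div_eq_div_iff (D'.B_ne_zero _ _) (D.B_ne_zero _ _), hB]
    change (1 - D'.I) * (2 * D'.w + 1) / D'.x * _ = _
    rw [div_mul_eq_mul_div, div_eq_iff D'.x_ne_zero]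
    refine mul_right_cancel₀ hB0 ?_
    linear_combination (1 - D'.I) * D.B 0 (π 0) * D.B 0 (π j) * hw -
      (2 * D.w + 1) * D.B 0 (π 0) * D.B 0 (π j) * hz + z * y * (1 - D.I) * (2 * D.w + 1) * h2 -
      z * y * D.B (π 0) (π j) * hT - z * D.T (e + 1) * s 0 * s j ^ 2 * D.B (π 0) (π j) * hx -
      z * y * D.T e * D.T (e + 1) * D.B (π 0) (π j) * (s 0 ^ 2 * hj + h0)

/-- The roots attached to two systems of generators are permuted by an affine rule. -/
lemma root_eq_root {D D' : RootData L} {π σ : Fin 4 → Fin 4} {n : Fin 2 → Fin 4} {q : Fin 4}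
    {e : Fin 2} {u : L} (hs : ∀ j, (D.I ^ (σ j : ℕ)) ^ 2 = 1)
    (hB : ∀ j, D'.B 0 j = D.I ^ (σ 0 : ℕ) * D.I ^ (σ j : ℕ) * D.B (π 0) (π j))
    (hx : D'.x * D.B 0 (π 0) = D.I ^ (σ 0 : ℕ) * D.I ^ (n 0 : ℕ) * D.T e)
    (hw : 2 * D'.w + 1 = u * (2 * D.w + 1)) (hI : D'.I = D.I ^ (q : ℕ))
    (hz : D.I ^ (n 1 : ℕ) * D.I ^ (n 0 : ℕ) * (1 - D.I) = u * (1 - D'.I))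
    (p : Fin 2 × Fin 4 × Fin 4) :
    D'.root p = D.root (p.1 + e, π p.2.1, q * p.2.2 + σ p.2.1 + n p.1) := by
  obtain ⟨e', j, m⟩ := p
  obtain ⟨h1, h2⟩ := T_div_B hs hB hx hw hz j
  simp only [root, pow_I_add, pow_I_mul, hI]
  fin_cases e'
  · simp only [Fin.zero_eta, zero_add]
    rw [h1]
    ring
  · simp only [Fin.mk_one]
    rw [h2, add_comm 1 e]
    ring

end

/-- Here `(1 - I) ^ 4 = -4` and `(2 w + 1) ^ 4 = 9`. Since -36 is the product of `6 (r - 1)` and `6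
(-r - 1)`, the second numerator belongs to the other square root of 2. -/
lemma T_one_pow : D.T 1 ^ 4 = -36 / D.x ^ 4 := by
  change ((1 - D.I) * (2 * D.w + 1) / D.x) ^ 4 = _
  have h2 : ((1 - D.I) * (2 * D.w + 1)) ^ 4 = -36 := by
    have h3 : (2 * D.w + 1) ^ 2 = -3 := by linear_combination 4 * D.sq_w
    have h4 : (1 - D.I) ^ 2 = -2 * D.I := by linear_combination D.sq_I
    calc _ = ((1 - D.I) ^ 2) ^ 2 * ((2 * D.w + 1) ^ 2) ^ 2 := by ring
      _ = _ := by rw [h3, h4]; linear_combination 36 * D.sq_I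
  rw [div_pow, h2]

/-- The generators after the rotation of three of the `k`. -/
def rotate : RootData L where
  I := -D.I
  w := D.w
  c := D.w * D.c
  r := D.r
  a := D.b
  b := D.d
  d := D.a
  x := D.x
  sq_I := by rw [neg_sq, D.sq_I]
  sq_w := D.sq_w
  cube_c := by rw [mul_pow, D.cube_w, one_mul, D.cube_c]
  sq_r := D.sq_r
  sq_a := D.sq_b
  sq_b := by rw [D.sq_d]; ring
  sq_d := by rw [D.sq_a]; linear_combination 2 * D.c * D.cube_w
  mul_abd := by rw [← D.mul_abd]; ring
  pow_x := by rw [← D.pow_x]; ring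

/-- The generators after the complex conjugation of the cube root of unity. -/
def conjugate (s : L) (hs : s ^ 2 = 1) : RootData L where
  I := D.I
  w := D.w ^ 2
  c := D.c
  r := D.r
  a := D.a
  b := D.d
  d := D.b
  x := s * D.x
  sq_I := D.sq_I
  sq_w := by linear_combination (D.w ^ 2 - D.w + 1) * D.sq_w
  cube_c := D.cube_c
  sq_r := D.sq_r
  sq_a := D.sq_a
  sq_b := D.sq_d
  sq_d := by rw [D.sq_b]; linear_combination 2 * D.w * D.c * D.cube_w
  mul_abd := by rw [← D.mul_abd]; ring
  pow_x := by
    rw [← D.pow_x]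
    linear_combination (s ^ 2 + 1) * D.x ^ 4 * (1 + (D.a + D.b + D.d) / 2) ^ 2 * hs

/-- The generators after the exchange of the two square roots of `2`. -/
def exchange [CharZero L] : RootData L where
  I := D.I
  w := D.w
  c := D.c
  r := -D.r
  a := -D.a
  b := -D.b
  d := D.d
  -- With `a` and `b` negated, `k 0` becomes `k 3`; the new `x` must be a root that belongs to `-r`
  -- and `k 3`.
  x := D.T 1 / D.B 0 3
  sq_I := D.sq_I
  sq_w := D.sq_w
  cube_c := D.cube_c
  sq_r := by rw [neg_sq, D.sq_r]
  sq_a := by rw [neg_sq, D.sq_a]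
  sq_b := by rw [neg_sq, D.sq_b]
  sq_d := D.sq_d
  mul_abd := by rw [← D.mul_abd]; ring
  pow_x := by
    have h1 := D.T_one_pow
    have h2 : D.B 0 3 ^ 2 = D.k 0 * D.k 3 := by
      have := D.B_mul 0 3 0
      rw [B_self, D.B_symm 3 0] at this
      rw [sq, this, mul_comm]
    have h3 : 1 + (-D.a + -D.b + D.d) / 2 = D.k 3 := by simp [k]; ring
    have hx : D.x ^ 4 * D.k 0 ^ 2 = 6 * (D.r - 1) := D.pow_x
    have h5 := D.k_ne_zero 0
    have h6 := D.k_ne_zero 3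
    have h7 := D.x_ne_zero
    rw [h3, div_pow, h1, show D.B 0 3 ^ 4 = (D.B 0 3 ^ 2) ^ 2 by ring, h2]
    field_simp
    have := D.sq_r
    linear_combination 6 * (-D.r - 1) * (-hx) + 36 * this

end RootData


/-! ### Numbering of the roots and the four generating permutations -/

/-- The position of the point `p` in the list of roots of `f₁`. -/
def labelTable : List ℕ :=
  [0, 2, 28, 21, 26, 29, 20, 27, 11, 15, 5, 9, 13, 7, 30, 23, 24, 31, 22, 25, 4, 10, 12, 6, 8, 14,
    18, 19, 1, 3, 16, 17]

/-- The index of the root that belongs to a point. -/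
def label (p : Fin 32) : Fin 2 × Fin 4 × Fin 4 :=
  let n := labelTable.getD p 0
  (Fin.ofNat 2 (n / 16), Fin.ofNat 4 (n / 4), Fin.ofNat 4 n)

lemma label_injective : Function.Injective label := by
  have h : ∀ p p', label p = label p' → p = p' := by decide +kernel
  exact fun p p' => h p p'

/-- The affine rule for the action on the indices of the roots. -/
def affine (π σ : Fin 4 → Fin 4) (n : Fin 2 → Fin 4) (q : Fin 4) (e : Fin 2)
    (p : Fin 2 × Fin 4 × Fin 4) : Fin 2 × Fin 4 × Fin 4 :=
  (p.1 + e, π p.2.1, q * p.2.2 + σ p.2.1 + n p.1)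

/-- The parameters are the permutation of the `k`, the signs of the `B` as exponents of `I`, the
factors of the two numerators, the exponent of the image of `I` (3 for `-I`), and whether the square
roots of 2 are exchanged. -/
lemma affine_label_zero : ∀ p, affine ![0, 2, 3, 1] ![2, 0, 0, 2] ![2, 3] 3 0 (label p) =
    label (σ₀ p) := by
  decide +kernel

lemma affine_label_one : ∀ p, affine ![0, 1, 3, 2] ![2, 0, 2, 2] ![2, 0] 1 0 (label p) =
    label (σ₁ p) := by
  decide +kernel

lemma affine_label_two : ∀ p, affine ![0, 1, 3, 2] ![2, 0, 2, 2] ![0, 2] 1 0 (label p) =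
    label (σ₂ p) := by
  decide +kernel

lemma affine_label_three : ∀ p, affine ![3, 2, 1, 0] ![2, 0, 2, 0] ![2, 2] 1 1 (label p) =
    label (σ₃ p) := by
  decide +kernel

namespace RootData

variable {L : Type*} [Field L] [CharZero L] (D : RootData L)

lemma root_rotate (p : Fin 32) : D.rotate.root (label p) = D.root (label (σ₀ p)) := by
  rw [← affine_label_zero]
  have hI := D.sq_I
  refine root_eq_root (u := 1) (fun j => ?_) (fun j => ?_) ?_ ?_ ?_ ?_ _
  · fin_cases j <;> simp [hI]
  · fin_cases j <;> simp [hI] <;> simp [B, k, rotate]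
    · ring
    · linear_combination (1/3 * D.w * D.c ^ 2 * D.a + 1/3 * D.w * D.c ^ 2 * D.d -
        1/6 * D.c ^ 2 * D.a - 1/6 * D.c ^ 2 * D.d) * D.sq_w
    · linear_combination (1/6 * D.w * D.c ^ 2 * D.a + 1/6 * D.w * D.c ^ 2 * D.b -
        1/3 * D.c ^ 2 * D.a - 1/3 * D.c ^ 2 * D.b - 1/2 * D.c * D.a + 1/2 * D.c * D.b) * D.sq_w
    · linear_combination 2 * (-1/6 * D.w * D.c ^ 2 * D.b - 1/6 * D.w * D.c ^ 2 * D.d -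
        1/6 * D.c ^ 2 * D.b - 1/6 * D.c ^ 2 * D.d - 1/2 * D.c * D.b + 1/2 * D.c * D.d) * D.sq_w
  · simp [hI]; rfl
  · simp [rotate]
  · simp [rotate]; linear_combination -D.I * hI
  · simp [rotate]; linear_combination (-D.I ^ 4 + D.I ^ 3 + D.I ^ 2 - D.I - 1) * hI

lemma root_conjugate_neg (p : Fin 32) (hs) : (D.conjugate 1 hs).root (label p) =
    D.root (label (σ₁ p)) := by
  rw [← affine_label_one]
  have hI := D.sq_I
  refine root_eq_root (u := -1) (fun j => ?_) (fun j => ?_) ?_ ?_ ?_ ?_ _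
  · fin_cases j <;> simp [hI]
  · fin_cases j <;> simp [hI] <;> simp [B, k, conjugate]
    · ring
    · linear_combination (1/3 * D.c ^ 2 * D.b + 1/3 * D.c ^ 2 * D.d - 1/2 * D.b -
        1/2 * D.d) * D.sq_w
    · linear_combination 2 * (1/6 * D.c ^ 2 * D.a + 1/6 * D.c ^ 2 * D.b + 1/2 * D.c * D.a -
        1/2 * D.c * D.b + 1/2 * D.a + 1/2 * D.b) * D.sq_w
    · linear_combination 2 * (-1/6 * D.c ^ 2 * D.a - 1/6 * D.c ^ 2 * D.d - 1/2 * D.c * D.a +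
        1/2 * D.c * D.d - 1/2 * D.a - 1/2 * D.d) * D.sq_w
  · simp [hI, conjugate]; rfl
  · simp [conjugate]; linear_combination 2 * D.sq_w
  · simp [conjugate]
  · simp [conjugate, hI]

lemma root_conjugate (p : Fin 32) (hs) : (D.conjugate (-1) hs).root (label p) =
    D.root (label (σ₂ p)) := by
  rw [← affine_label_two]
  have hI := D.sq_I
  refine root_eq_root (u := -1) (fun j => ?_) (fun j => ?_) ?_ ?_ ?_ ?_ _
  · fin_cases j <;> simp [hI]
  · fin_cases j <;> simp [hI] <;> simp [B, k, conjugate]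
    · ring
    · linear_combination (1/3 * D.c ^ 2 * D.b + 1/3 * D.c ^ 2 * D.d - 1/2 * D.b -
        1/2 * D.d) * D.sq_w
    · linear_combination 2 * (1/6 * D.c ^ 2 * D.a + 1/6 * D.c ^ 2 * D.b + 1/2 * D.c * D.a -
        1/2 * D.c * D.b + 1/2 * D.a + 1/2 * D.b) * D.sq_w
    · linear_combination 2 * (-1/6 * D.c ^ 2 * D.a - 1/6 * D.c ^ 2 * D.d - 1/2 * D.c * D.a +
        1/2 * D.c * D.d - 1/2 * D.a - 1/2 * D.d) * D.sq_w
  · simp [hI, conjugate]; rfl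
  · simp [conjugate]; linear_combination 2 * D.sq_w
  · simp [conjugate]
  · simp [conjugate, hI]

lemma root_exchange (p : Fin 32) : D.exchange.root (label p) = D.root (label (σ₃ p)) := by
  rw [← affine_label_three]
  have hI := D.sq_I
  refine root_eq_root (u := 1) (fun j => ?_) (fun j => ?_) ?_ ?_ ?_ ?_ _
  · fin_cases j <;> simp [hI]
  · fin_cases j <;> simp [hI] <;> simp [B, k, exchange] <;> ring
  · simp [hI, exchange]; rw [div_mul_cancel₀ _ (D.B_ne_zero _ _)]
  · simp [exchange]
  · simp [exchange]
  · simp [exchange, hI]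

end RootData


/-! ### Degrees in towers of quadratic extensions -/

section Tower

open IntermediateField

variable {F E : Type*} [Field F] [Field E] [Algebra F E]

@[simp, norm_cast]
lemma coe_ofNat_intermediateField (K : IntermediateField F E) (n : ℕ) [n.AtLeastTwo] :
    ((ofNat(n) : K) : E) = ofNat(n) := map_ofNat K.val n

/-- The intermediate field generated by one more element. -/
def adj (K : IntermediateField F E) (y : E) : IntermediateField F E := K ⊔ F⟮y⟯

lemma le_adj (K : IntermediateField F E) (y : E) : K ≤ adj K y := le_sup_left

lemma mem_adj_self (K : IntermediateField F E) (y : E) : y ∈ adj K y :=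
  (le_sup_right : F⟮y⟯ ≤ adj K y) (mem_adjoin_simple_self F y)

lemma adj_le {K M : IntermediateField F E} {y : E} (h : K ≤ M) (hy : y ∈ M) : adj K y ≤ M :=
  sup_le h (adjoin_simple_le_iff.mpr hy)

lemma adj_comm (K : IntermediateField F E) (y z : E) : adj (adj K y) z = adj (adj K z) y :=
  sup_right_comm _ _ _

lemma adj_eq_restrictScalars (K : IntermediateField F E) (y : E) :
    adj K y = (IntermediateField.adjoin K {y}).restrictScalars F :=
  (restrictScalars_adjoin_eq_sup F K {y}).symm

lemma finrank_adj (K : IntermediateField F E) {y : E} (hy : IsIntegral K y) :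
    Module.finrank F (adj K y) = Module.finrank F K * (minpoly K y).natDegree := by
  rw [adj_eq_restrictScalars, ← adjoin.finrank hy]
  exact (Module.finrank_mul_finrank F K K⟮y⟯).symm

section Quadratic

variable {K : IntermediateField F E} {y : E}

lemma aeval_sq_sub (hy : y ^ 2 ∈ K) :
    Polynomial.aeval y (Polynomial.X ^ 2 - Polynomial.C (⟨y ^ 2, hy⟩ : K)) = 0 := by
  simp [IntermediateField.algebraMap_apply]

lemma isIntegral_of_sq_mem (hy : y ^ 2 ∈ K) : IsIntegral K y :=
  ⟨_, Polynomial.monic_X_pow_sub_C _ two_ne_zero, aeval_sq_sub hy⟩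

lemma natDegree_minpoly_le_two (hy : y ^ 2 ∈ K) : (minpoly K y).natDegree ≤ 2 :=
  (Polynomial.natDegree_le_of_dvd (minpoly.dvd K y (aeval_sq_sub hy))
    (Polynomial.monic_X_pow_sub_C _ two_ne_zero).ne_zero).trans
    (Polynomial.natDegree_X_pow_sub_C).le

lemma finrank_adj_sq (hy : y ^ 2 ∈ K) (hn : y ∉ K) :
    Module.finrank F (adj K y) = Module.finrank F K * 2 := by
  rw [finrank_adj K (isIntegral_of_sq_mem hy)]
  congr 1
  refine le_antisymm (natDegree_minpoly_le_two hy) ?_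
  rw [minpoly.two_le_natDegree_iff (isIntegral_of_sq_mem hy)]
  rintro ⟨z, rfl⟩
  exact hn z.2

lemma finrank_adj_sq_le (hy : y ^ 2 ∈ K) :
    Module.finrank F (adj K y) ≤ Module.finrank F K * 2 := by
  rw [finrank_adj K (isIntegral_of_sq_mem hy)]
  exact Nat.mul_le_mul_left _ (natDegree_minpoly_le_two hy)

lemma exists_of_mem_adj (hy : y ^ 2 ∈ K) {z : E} (hz : z ∈ adj K y) :
    ∃ u v : K, z = u + v * y := by
  rw [adj_eq_restrictScalars, mem_restrictScalars, ← mem_toSubalgebra,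
    adjoin_simple_toSubalgebra_of_isAlgebraic (isIntegral_of_sq_mem hy).isAlgebraic] at hz
  induction hz using Algebra.adjoin_induction with
  | mem z hz =>
    rw [Set.mem_singleton_iff.mp hz]
    exact ⟨0, 1, by simp⟩
  | algebraMap z => exact ⟨z, 0, by simp [IntermediateField.algebraMap_apply]⟩
  | add z z' _ _ h h' =>
    obtain ⟨u, v, rfl⟩ := h
    obtain ⟨u', v', rfl⟩ := h'
    exact ⟨u + u', v + v', by push_cast; ring⟩
  | mul z z' _ _ h h' =>
    obtain ⟨u, v, rfl⟩ := h
    obtain ⟨u', v', rfl⟩ := h'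
    exact ⟨u * u' + v * v' * ⟨y ^ 2, hy⟩, u * v' + u' * v, by push_cast; ring⟩

lemma eq_zero_of_add_mul_eq_zero (hn : y ∉ K) {u v : K} (h : (u : E) + v * y = 0) :
    u = 0 ∧ v = 0 := by
  have hv0 : v = 0 := by
    by_contra hv0
    apply hn
    have hv1 : (v : E) ≠ 0 := fun h => hv0 (Subtype.ext h)
    have : y = ((-u / v : K) : E) := by
      push_cast
      rw [eq_div_iff hv1]
      linear_combination h
    rw [this]
    exact (-u / v : K).2
  rw [hv0, ZeroMemClass.coe_zero, zero_mul, add_zero] at h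
  exact ⟨Subtype.ext h, hv0⟩

end Quadratic

/-- Over this field the quartic polynomial for `k` is irreducible. -/
def Generic (K : IntermediateField F E) : Prop :=
  ∀ y : K, y ^ 3 ≠ 6 ∧ y ^ 4 - 4 * y ^ 3 + 12 * y - 12 ≠ 0

/-- A root in `K(y)` yields a root of one of the two polynomials in `K`: a quadratic factor of the
quartic produces a root of its resolvent cubic, which is a cube root of 6. This is why the cubic
belongs to the notion. -/
lemma Generic.adj [CharZero E] {K : IntermediateField F E} (hK : Generic K) {y : E}
    (hy : y ^ 2 ∈ K) : Generic (adj K y) := by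
  rintro ⟨z, hz⟩
  by_cases hn : y ∈ K
  · have h := hK ⟨z, adj_le le_rfl hn hz⟩
    simpa [Subtype.ext_iff] using h
  obtain ⟨u, v, rfl⟩ := exists_of_mem_adj hy hz
  obtain ⟨D, hD⟩ : ∃ D : K, (D : E) = y ^ 2 := ⟨⟨_, hy⟩, rfl⟩
  constructor
  · intro h
    replace h := congrArg (Subtype.val) h
    push_cast at h
    obtain ⟨e1, e2⟩ := eq_zero_of_add_mul_eq_zero hn
      (u := u ^ 3 + 3 * u * (v ^ 2 * D) - 6) (v := v * (3 * u ^ 2 + v ^ 2 * D))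
      (by push_cast; rw [hD]; linear_combination h)
    rcases mul_eq_zero.mp e2 with h0 | h0
    · exact (hK u).1 (by rw [h0] at e1; linear_combination e1)
    -- With `v² D = -3u²` the constant part becomes `-8u³ = 6`.
    · exact (hK (-2 * u)).1 (by linear_combination e1 - 3 * u * h0)
  · intro h
    replace h := congrArg (Subtype.val) h
    push_cast at h
    obtain ⟨e1, e2⟩ := eq_zero_of_add_mul_eq_zero hn
      (u := u ^ 4 + 6 * u ^ 2 * (v ^ 2 * D) + (v ^ 2 * D) ^ 2 -
        4 * (u ^ 3 + 3 * u * (v ^ 2 * D)) + 12 * u - 12)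
      (v := v * (4 * u ^ 3 + 4 * u * (v ^ 2 * D) - 4 * (3 * u ^ 2 + v ^ 2 * D) + 12))
      (by push_cast; rw [hD]; linear_combination h)
    rcases mul_eq_zero.mp e2 with h0 | h0
    · exact (hK u).2 (by rw [h0] at e1; linear_combination e1)
    -- Here `u` is half the sum of two conjugate roots, so `2 (u - 1)` plays the role of `a`, and `c
    -- = (4 - a²) / 2` becomes `2u (2 - u)`.
    · refine (hK (2 * u * (2 - u))).1 ?_
      generalize v ^ 2 * D = w at e1 h0
      obtain ⟨z, rfl⟩ : ∃ z, u = 1 + z := ⟨u - 1, by ring⟩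
      have e3 : z * w = -z ^ 3 + 3 * z - 1 := by linear_combination (1 / 4) * h0
      linear_combination 2 * z ^ 2 * e1 - (2 * (z * w + (-z ^ 3 + 3 * z - 1)) +
        12 * z ^ 3 - 12 * z) * e3

-- No root in `K` excludes factors of degree 1 and 3. If the degree were 2, completing the square
-- would place `k` in a quadratic extension of `K`, which is still generic.
open Polynomial in
lemma natDegree_minpoly_quartic [CharZero E] {K : IntermediateField F E} (hK : Generic K) {k : E}
    (hk : k ^ 4 - 4 * k ^ 3 + 12 * k - 12 = 0) :
    IsIntegral K k ∧ (minpoly K k).natDegree = 4 := by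
  obtain ⟨q, hq⟩ : ∃ q : K[X], q = X ^ 4 - 4 * X ^ 3 + 12 * X - 12 := ⟨_, rfl⟩
  have hdeg : q.natDegree = 4 := by rw [hq]; compute_degree!
  have hmon : q.Monic := by rw [hq]; monicity!
  have hev : aeval k q = 0 := by rw [hq]; simpa [map_ofNat] using hk
  have hint : IsIntegral K k := ⟨q, hmon, hev⟩
  refine ⟨hint, ?_⟩
  obtain ⟨l, hl⟩ := minpoly.dvd K k hev
  have hm := minpoly.monic hint
  have hlm : l.Monic := hm.of_mul_monic_left (hl ▸ hmon)
  have hsum : (minpoly K k).natDegree + l.natDegree = 4 := by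
    rw [← hm.natDegree_mul hlm, ← hl, hdeg]
  have hroot : ∀ z : K, ¬ q.IsRoot z := by
    intro z hz
    refine (hK z).2 ?_
    rw [hq] at hz
    simpa using hz
  have h1 : 1 < (minpoly K k).natDegree := by
    rw [← Nat.succ_le_iff, Nat.succ_eq_add_one, minpoly.two_le_natDegree_iff hint]
    rintro ⟨z, rfl⟩
    exact hroot z (by
      rw [aeval_algebraMap_apply] at hev
      exact (map_eq_zero_iff _ (algebraMap K E).injective).mp hev)
  have h3 : (minpoly K k).natDegree ≠ 3 := by
    intro h
    have hl1 : l.natDegree = 1 := by omega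
    rw [hlm.eq_X_add_C hl1] at hl
    refine hroot (-l.coeff 0) ?_
    rw [hl]
    simp
  have h2 : (minpoly K k).natDegree ≠ 2 := by
    intro h
    have hmin := minpoly.aeval K k
    rw [hm.as_sum, h] at hmin
    simp [Finset.sum_range_succ] at hmin
    set p := (minpoly K k).coeff 1
    set n := (minpoly K k).coeff 0
    have hy : (k + p / 2) ^ 2 ∈ K := by
      have : (k + p / 2) ^ 2 = ((p ^ 2 / 4 - n : K) : E) := by
        push_cast
        linear_combination hmin
      rw [this]
      exact (p ^ 2 / 4 - n : K).2
    have hk' : k ∈ IntegralEquivalence.adj K (k + p / 2) := by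
      have h4 : ((p / 2 : K) : E) ∈ IntegralEquivalence.adj K (k + p / 2) := le_adj _ _ (p / 2 : K).2
      have h5 := sub_mem (mem_adj_self K (k + p / 2)) h4
      push_cast at h5
      rwa [add_sub_cancel_right] at h5
    exact (hK.adj hy ⟨k, hk'⟩).2 (Subtype.ext (by push_cast; exact hk))
  omega

lemma int_cube_ne (n : ℤ) : n ^ 3 ≠ 6 := by
  intro h
  have h1 : n ≤ 1 := by by_contra! h1; nlinarith [sq_nonneg (n - 2), sq_nonneg n]
  have h2 : 0 < n := by by_contra! h1; nlinarith [sq_nonneg n]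
  interval_cases n; omega

/-- The value is 4 modulo 8 for even `n` and odd for odd `n`. -/
lemma int_quartic_ne (n : ℤ) : n ^ 4 - 4 * n ^ 3 + 12 * n - 12 ≠ 0 := by
  intro h
  rcases Int.even_or_odd' n with ⟨m, rfl | rfl⟩
  · have : 8 * (2 * m ^ 4 - 4 * m ^ 3 + 3 * m - 2) = -4 := by linear_combination h
    omega
  · have : 2 * (8 * m ^ 4 - 12 * m ^ 2 + 4 * m) = 3 := by linear_combination h
    omega

open Polynomial in
lemma generic_bot {E : Type*} [Field E] [CharZero E] [Algebra ℚ E] :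
    Generic (⊥ : IntermediateField ℚ E) := by
  have key : ∀ y : ℚ, y ^ 3 ≠ 6 ∧ y ^ 4 - 4 * y ^ 3 + 12 * y - 12 ≠ 0 := by
    intro y
    constructor
    · intro h
      have hy : IsIntegral ℤ y := ⟨X ^ 3 - 6, by monicity!, by simp [h]⟩
      obtain ⟨n, rfl⟩ := IsIntegrallyClosed.isIntegral_iff.mp hy
      exact int_cube_ne n (by rw [eq_intCast] at h; exact_mod_cast h)
    · intro h
      have hy : IsIntegral ℤ y := ⟨X ^ 4 - 4 * X ^ 3 + 12 * X - 12, by monicity!, by simpa using h⟩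
      obtain ⟨n, rfl⟩ := IsIntegrallyClosed.isIntegral_iff.mp hy
      exact int_quartic_ne n (by rw [eq_intCast] at h; exact_mod_cast h)
  intro y
  obtain ⟨z, hz⟩ := mem_bot.mp y.2
  obtain rfl : y = algebraMap ℚ _ z := Subtype.ext (hz.symm.trans
    (IsScalarTower.algebraMap_apply ℚ (⊥ : IntermediateField ℚ E) E z))
  have h := key z
  constructor
  · intro h1
    exact h.1 ((algebraMap ℚ (⊥ : IntermediateField ℚ E)).injective (by simpa using h1))
  · intro h1
    exact h.2 ((algebraMap ℚ (⊥ : IntermediateField ℚ E)).injective (by simpa using h1))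

end Tower


/-! ### Elimination of `k` and `r` -/

section
variable {L : Type*} [Field L] [CharZero L] {Y k r : L}

/-- Separating even and odd powers of `k` in the quartic and squaring leaves a relation in `k²`.
Substituting `Y k² = 6 (r - 1)` and reducing by the quadratic equation of `6 (r - 1)` leaves `r`
only linearly, so `r` is rational in `Y`. -/
lemma linear_in_r (hr : r ^ 2 = 2) (hk : k ^ 4 - 4 * k ^ 3 + 12 * k - 12 = 0)
    (hY : Y * k ^ 2 = 6 * (r - 1)) :
    6 * (r - 1) * (Y ^ 3 + 6 * Y ^ 2 + 20 * Y + 18) = Y ^ 4 + 18 * Y ^ 2 + 48 * Y + 45 := by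
  have h1 : (k ^ 4 - 12) ^ 2 = 16 * k ^ 2 * (k ^ 2 - 3) ^ 2 := by
    linear_combination (k ^ 4 - 12 + 4 * k * (k ^ 2 - 3)) * hk
  have hP : ((Y * k ^ 2) ^ 2 - 12 * Y ^ 2) ^ 2 =
      16 * (Y * k ^ 2) * Y * (Y * k ^ 2 - 3 * Y) ^ 2 := by
    linear_combination Y ^ 4 * h1
  rw [hY] at hP
  have he : (6 * (r - 1)) ^ 2 + 12 * (6 * (r - 1)) - 36 = 0 := by linear_combination 36 * hr
  generalize 6 * (r - 1) = a at hP he ⊢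
  linear_combination (1 / 144) * (a ^ 2 - 16 * a * Y - 12 * a + 72 * Y ^ 2 + 192 * Y + 180) * he - (1 / 144) * hP

/-- The octic is the norm of the linear relation: `a = 6 (r - 1)` has the conjugate `-12 - a`. -/
lemma octic_eq_zero (hr : r ^ 2 = 2) (hk : k ^ 4 - 4 * k ^ 3 + 12 * k - 12 = 0)
    (hY : Y * k ^ 2 = 6 * (r - 1)) :
    Y ^ 8 + 12 * Y ^ 7 + 72 * Y ^ 6 + 120 * Y ^ 5 - 234 * Y ^ 4 + 108 * Y ^ 3 + 396 * Y ^ 2 -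
      432 * Y + 81 = 0 := by
  have h1 := linear_in_r hr hk hY
  have he : (6 * (r - 1)) ^ 2 + 12 * (6 * (r - 1)) - 36 = 0 := by linear_combination 36 * hr
  generalize 6 * (r - 1) = a at h1 he
  linear_combination (-(Y ^ 4 + 18 * Y ^ 2 + 48 * Y + 45) - (12 + a) *
    (Y ^ 3 + 6 * Y ^ 2 + 20 * Y + 18)) * h1 + (Y ^ 3 + 6 * Y ^ 2 + 20 * Y + 18) ^ 2 * he

end

/-! ### The degree of a real root -/

section Real

open IntermediateField

lemma not_mem_bot_of_irrational {y : ℝ} (h : Irrational y) : y ∉ (⊥ : IntermediateField ℚ ℝ) := by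
  rw [mem_bot]
  rintro ⟨q, hq⟩
  exact h ⟨q, hq⟩

lemma sqrt_three_sq : √3 ^ 2 = (3 : ℝ) := Real.sq_sqrt (by norm_num)

lemma sq_ne_of_irrational {n : ℕ} (h : Irrational √(n : ℝ)) (q : (⊥ : IntermediateField ℚ ℝ)) :
    (q : ℝ) ^ 2 ≠ n := by
  intro hq
  apply not_mem_bot_of_irrational h
  rw [← hq, Real.sqrt_sq_eq_abs]
  rcases abs_choice (q : ℝ) with h | h <;> rw [h]
  · exact q.2
  · exact neg_mem q.2

lemma not_mem_adj_sqrt_three {r : ℝ} (hr : r ^ 2 = 2) :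
    r ∉ adj (⊥ : IntermediateField ℚ ℝ) √3 := by
  have h3 : √3 ∉ (⊥ : IntermediateField ℚ ℝ) :=
    not_mem_bot_of_irrational (irrational_sqrt_ofNat_iff.mpr (by decide +kernel))
  have h3' : √3 ^ 2 ∈ (⊥ : IntermediateField ℚ ℝ) := by
    rw [sqrt_three_sq]; exact ofNat_mem _ 3
  intro h
  obtain ⟨u, v, rfl⟩ := exists_of_mem_adj h3' h
  obtain ⟨e1, e2⟩ := eq_zero_of_add_mul_eq_zero h3 (u := u ^ 2 + 3 * v ^ 2 - 2) (v := 2 * u * v)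
    (by push_cast; linear_combination hr - v ^ 2 * sqrt_three_sq)
  have e3 := congrArg (Subtype.val) e1
  push_cast at e3
  rcases mul_eq_zero.mp e2 with h0 | h0
  · rw [mul_eq_zero] at h0
    rcases h0 with h0 | h0
    · norm_num [Subtype.ext_iff] at h0
    · rw [h0] at e3
      refine sq_ne_of_irrational (n := 6) (irrational_sqrt_ofNat_iff.mpr (by decide +kernel)) (3 * v) ?_
      push_cast at e3 ⊢
      linear_combination 3 * e3
  · rw [h0] at e3
    refine sq_ne_of_irrational (n := 2) (irrational_sqrt_ofNat_iff.mpr (by decide +kernel)) u ?_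
    push_cast at e3 ⊢
    linear_combination e3

/-- The tower of real fields has degree `64`. -/
lemma finrank_realTower {δ r k x : ℝ} (hδ : δ = 1 ∨ δ = -1) (hr : r ^ 2 = 2)
    (hk : k ^ 4 - 4 * k ^ 3 + 12 * k - 12 = 0) (hx : δ * x ^ 4 * k ^ 2 = 6 * (r - 1)) :
    Module.finrank ℚ (adj (adj (adj (adj (adj (⊥ : IntermediateField ℚ ℝ) √3) r) k) (x ^ 2 * k))
      x) = 64 := by
  have hk0 : k ≠ 0 := by rintro rfl; norm_num at hk
  have hδ2 : δ ^ 2 = 1 := by rcases hδ with rfl | rfl <;> norm_num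
  have h3 : √3 ∉ (⊥ : IntermediateField ℚ ℝ) :=
    not_mem_bot_of_irrational (irrational_sqrt_ofNat_iff.mpr (by decide +kernel))
  have h3' : √3 ^ 2 ∈ (⊥ : IntermediateField ℚ ℝ) := by
    rw [sqrt_three_sq]; exact ofNat_mem _ 3
  have hr' (K : IntermediateField ℚ ℝ) : r ^ 2 ∈ K := by
    rw [hr]; exact ofNat_mem _ 2
  have d1 : Module.finrank ℚ (adj (⊥ : IntermediateField ℚ ℝ) √3) = 2 := by
    rw [finrank_adj_sq h3' h3, IntermediateField.finrank_bot]
  have g1 : Generic (adj (⊥ : IntermediateField ℚ ℝ) √3) := generic_bot.adj h3'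
  have hrn := not_mem_adj_sqrt_three hr
  generalize adj (⊥ : IntermediateField ℚ ℝ) √3 = K₁ at *
  have d0 : Module.finrank ℚ (adj K₁ k) = 8 := by
    rw [finrank_adj _ (natDegree_minpoly_quartic g1 hk).1, (natDegree_minpoly_quartic g1 hk).2, d1]
  have d2 : Module.finrank ℚ (adj (adj K₁ r) k) = 16 := by
    have g2 := g1.adj (hr' K₁)
    rw [finrank_adj _ (natDegree_minpoly_quartic g2 hk).1, (natDegree_minpoly_quartic g2 hk).2,
      finrank_adj_sq (hr' _) hrn, d1]
  have hkmem : k ∈ adj (adj K₁ r) k := mem_adj_self _ k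
  have hA : (x ^ 2 * k) ^ 2 = 6 * δ * (r - 1) := by
    linear_combination δ * hx - x ^ 4 * k ^ 2 * hδ2
  have hAmem : (x ^ 2 * k) ^ 2 ∈ adj (adj K₁ r) k := by
    have hrmem : r ∈ adj (adj K₁ r) k := le_adj _ _ (mem_adj_self _ r)
    have hδmem : δ ∈ adj (adj K₁ r) k := by
      rcases hδ with rfl | rfl
      · exact one_mem _
      · exact neg_mem (one_mem _)
    rw [hA]
    exact mul_mem (mul_mem (ofNat_mem _ 6) hδmem) (sub_mem hrmem (one_mem _))
  -- Writing the element as `u + v r` over the real field `K₁(k)` gives `u² + 2v² = -6δ` and `u v =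
  -- 3δ`. For `δ = 1` the first is impossible over the reals; for `δ = -1` eliminating `v` gives
  -- `(u² - 3)² = -9`.
  have hAn : x ^ 2 * k ∉ adj (adj K₁ r) k := by
    have hrn' : r ∉ adj K₁ k := by
      intro h
      have h1 : adj (adj K₁ k) r = adj K₁ k := le_antisymm (adj_le le_rfl h) (le_adj _ _)
      rw [adj_comm, h1, d0] at d2
      norm_num at d2
    rw [adj_comm]
    intro h
    obtain ⟨u, v, huv⟩ := exists_of_mem_adj (hr' _) h
    rw [huv] at hA
    have hδ' : ∃ δ' : adj K₁ k, (δ' : ℝ) = δ := by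
      rcases hδ with rfl | rfl
      · exact ⟨1, by simp⟩
      · exact ⟨-1, by simp⟩
    obtain ⟨δ', hδ'⟩ := hδ'
    obtain ⟨e1, e2⟩ := eq_zero_of_add_mul_eq_zero hrn' (u := u ^ 2 + 2 * v ^ 2 + 6 * δ')
      (v := 2 * u * v - 6 * δ') (by
        push_cast
        rw [hδ']
        linear_combination hA - v ^ 2 * hr)
    have e3 := congrArg (Subtype.val) e1
    have e4 := congrArg (Subtype.val) e2
    push_cast at e3 e4
    rw [hδ'] at e3 e4
    generalize (u : ℝ) = u at e3 e4
    generalize (v : ℝ) = v at e3 e4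
    rcases hδ with rfl | rfl
    · nlinarith [sq_nonneg u, sq_nonneg v]
    · have : (u ^ 2 - 3) ^ 2 = -9 := by
        linear_combination u ^ 2 * e3 - ((1 / 2) * (2 * u * v - 6)) * e4
      nlinarith [sq_nonneg (u ^ 2 - 3)]
  have d3 : Module.finrank ℚ (adj (adj (adj K₁ r) k) (x ^ 2 * k)) = 32 := by
    rw [finrank_adj_sq hAmem hAn, d2]
  have hxmem : x ^ 2 ∈ adj (adj (adj K₁ r) k) (x ^ 2 * k) := by
    have h1 := div_mem (mem_adj_self (adj (adj K₁ r) k) (x ^ 2 * k))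
      (le_adj (adj (adj K₁ r) k) (x ^ 2 * k) hkmem)
    rwa [mul_div_cancel_right₀ _ hk0] at h1
  rw [finrank_adj_sq hxmem, d3]
  intro h
  -- Squaring `x = u + v x² k` gives `u² + v² (x² k)² = 0`, so `u = 0` over the reals, against `2 u
  -- v = 1 / k`.
  obtain ⟨u, v, huv⟩ := exists_of_mem_adj hAmem h
  obtain ⟨A, hA'⟩ : ∃ A : adj (adj K₁ r) k, (A : ℝ) = (x ^ 2 * k) ^ 2 := ⟨⟨_, hAmem⟩, rfl⟩
  obtain ⟨k', hk'⟩ : ∃ k' : adj (adj K₁ r) k, (k' : ℝ) = k := ⟨⟨_, hkmem⟩, rfl⟩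
  obtain ⟨e1, e2⟩ := eq_zero_of_add_mul_eq_zero hAn (u := u ^ 2 + v ^ 2 * A)
    (v := 2 * u * v - 1 / k') (by
      push_cast
      rw [hA', hk']
      have h1 : 1 / k * (x ^ 2 * k) = x ^ 2 := by field_simp
      linear_combination -(x + (u + v * (x ^ 2 * k))) * huv - h1)
  have e3 := congrArg (Subtype.val) e1
  have e4 := congrArg (Subtype.val) e2
  push_cast at e3 e4
  rw [hA'] at e3
  rw [hk'] at e4
  have hu : (u : ℝ) = 0 := by
    have h1 : 0 ≤ (v : ℝ) ^ 2 * (x ^ 2 * k) ^ 2 := by positivity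
    have h2 : (u : ℝ) ^ 2 = 0 := le_antisymm (by linarith) (sq_nonneg _)
    exact pow_eq_zero_iff two_ne_zero |>.mp h2
  rw [hu] at e4
  have : 1 / k ≠ 0 := one_div_ne_zero hk0
  apply this
  linear_combination -e4

/-- The tower of real fields is generated by `x` and the square root of `3`. -/
lemma realTower_le {δ r k x : ℝ} (hδ : δ = 1 ∨ δ = -1) (hr : r ^ 2 = 2)
    (hk : k ^ 4 - 4 * k ^ 3 + 12 * k - 12 = 0) (hx : δ * x ^ 4 * k ^ 2 = 6 * (r - 1))
    (hY : (δ * x ^ 4) ^ 3 + 6 * (δ * x ^ 4) ^ 2 + 20 * (δ * x ^ 4) + 18 ≠ 0) :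
    adj (adj (adj (adj (adj (⊥ : IntermediateField ℚ ℝ) √3) r) k) (x ^ 2 * k)) x ≤
      adj ℚ⟮x⟯ √3 := by
  have hxm : x ∈ ℚ⟮x⟯ := mem_adjoin_simple_self ℚ x
  have hYm : δ * x ^ 4 ∈ ℚ⟮x⟯ := by
    rcases hδ with rfl | rfl
    · rw [one_mul]; exact pow_mem hxm 4
    · exact mul_mem (neg_mem (one_mem _)) (pow_mem hxm 4)
  have h1 := linear_in_r hr hk hx
  have hx0 : δ * x ^ 4 ≠ 0 := by
    intro h0
    rw [h0, zero_mul] at hx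
    have : r = 1 := by linear_combination (-1 / 6) * hx
    rw [this] at hr
    norm_num at hr
  generalize δ * x ^ 4 = Y at hx hY hYm h1 hx0
  have hrm : r ∈ ℚ⟮x⟯ := by
    have : r = (Y ^ 4 + 18 * Y ^ 2 + 48 * Y + 45) / (6 * (Y ^ 3 + 6 * Y ^ 2 + 20 * Y + 18)) + 1 := by
      rw [← sub_eq_iff_eq_add, eq_div_iff (mul_ne_zero (by norm_num) hY)]
      linear_combination h1
    rw [this]
    refine add_mem (div_mem ?_ ?_) (one_mem _)
    · exact add_mem (add_mem (add_mem (pow_mem hYm 4) (mul_mem (ofNat_mem _ 18) (pow_mem hYm 2)))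
        (mul_mem (ofNat_mem _ 48) hYm)) (ofNat_mem _ 45)
    · exact mul_mem (ofNat_mem _ 6) (add_mem (add_mem (add_mem (pow_mem hYm 3) (mul_mem (ofNat_mem _ 6) (pow_mem hYm 2)))
        (mul_mem (ofNat_mem _ 20) hYm)) (ofNat_mem _ 18))
  have hkm : k ∈ ℚ⟮x⟯ := by
    have hk2 : k ^ 2 ∈ ℚ⟮x⟯ := by
      have : k ^ 2 = 6 * (r - 1) / Y := by rw [eq_div_iff hx0]; linear_combination hx
      rw [this]
      exact div_mem (mul_mem (ofNat_mem _ 6) (sub_mem hrm (one_mem _))) hYm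
    have h0 : 12 - 4 * k ^ 2 ≠ 0 := by
      intro h0
      have h2 : k ^ 2 = 3 := by linear_combination (-1 / 4) * h0
      have h3 : k ^ 4 = 12 := by linear_combination hk + 4 * k * h2
      have h4 : k ^ 4 = 9 := by linear_combination (k ^ 2 + 3) * h2
      rw [h4] at h3
      norm_num at h3
    -- The quartic is linear in `k` over the field of `k²`, and `k² ≠ 3`.
    have : k = (12 - (k ^ 2) ^ 2) / (12 - 4 * k ^ 2) := by
      rw [eq_div_iff h0]
      linear_combination hk
    rw [this]
    exact div_mem (sub_mem (ofNat_mem _ 12) (pow_mem hk2 2))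
      (sub_mem (ofNat_mem _ 12) (mul_mem (ofNat_mem _ 4) hk2))
  have h := le_adj ℚ⟮x⟯ √3
  refine adj_le (adj_le (adj_le (adj_le (adj_le bot_le (mem_adj_self _ _)) (h hrm)) (h hkm)) ?_)
    (h hxm)
  exact h (mul_mem (pow_mem hxm 2) hkm)

/-- A real root with these coordinates generates a field of degree at least `32`. -/
lemma le_natDegree_minpoly {δ r k x : ℝ} (hδ : δ = 1 ∨ δ = -1) (hr : r ^ 2 = 2)
    (hk : k ^ 4 - 4 * k ^ 3 + 12 * k - 12 = 0) (hx : δ * x ^ 4 * k ^ 2 = 6 * (r - 1))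
    (hY : (δ * x ^ 4) ^ 3 + 6 * (δ * x ^ 4) ^ 2 + 20 * (δ * x ^ 4) + 18 ≠ 0) (hi : IsIntegral ℚ x) :
    32 ≤ (minpoly ℚ x).natDegree := by
  have hs : √3 ^ 2 ∈ ℚ⟮x⟯ := by rw [sqrt_three_sq]; exact ofNat_mem _ 3
  have := adjoin.finiteDimensional hi
  have : FiniteDimensional ℚ (adj ℚ⟮x⟯ √3) := by
    have : FiniteDimensional ℚ ℚ⟮√3⟯ := adjoin.finiteDimensional
      ⟨Polynomial.X ^ 2 - Polynomial.C 3, Polynomial.monic_X_pow_sub_C _ two_ne_zero,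
        by simp⟩
    exact IntermediateField.finiteDimensional_sup _ _
  have h2 := finrank_le_of_le_right (realTower_le hδ hr hk hx hY)
  rw [finrank_realTower hδ hr hk hx] at h2
  -- Adjoining the square root of 3 at most doubles the degree, so degree 64 above forces degree at
  -- least 32 for `x`.
  have h3 := finrank_adj_sq_le (F := ℚ) hs
  rw [adjoin.finrank hi] at h3
  omega

end Real


/-! ### Irreducibility and a divisor of the degree of the splitting field -/

section
open Polynomial

lemma natDegree_f₁ : f₁.natDegree = 32 := by unfold f₁; compute_degree!

lemma natDegree_f₂ : f₂.natDegree = 32 := by unfold f₂; compute_degree!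

lemma monic_f₁ : f₁.Monic := by unfold f₁; monicity!

lemma monic_f₂ : f₂.Monic := by unfold f₂; monicity!

section
variable {L : Type*} [Field L] [Algebra ℚ L] {x k r : L}

lemma aeval_f₁ (x : L) : aeval x f₁ = x ^ 32 + 12 * x ^ 28 + 72 * x ^ 24 + 120 * x ^ 20 -
    234 * x ^ 16 + 108 * x ^ 12 + 396 * x ^ 8 - 432 * x ^ 4 + 81 := by
  simp [f₁, map_ofNat]

lemma aeval_f₂ (x : L) : aeval x f₂ = x ^ 32 - 12 * x ^ 28 + 72 * x ^ 24 - 120 * x ^ 20 -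
    234 * x ^ 16 - 108 * x ^ 12 + 396 * x ^ 8 + 432 * x ^ 4 + 81 := by
  simp [f₂, map_ofNat]

/-- `f₂` is obtained from `f₁` by a primitive eighth root of unity. -/
lemma aeval_f₂_mul {z : L} (hz : z ^ 4 = -1) (x : L) : aeval (z * x) f₂ = aeval x f₁ := by
  rw [aeval_f₁, aeval_f₂]
  have h8 : z ^ 8 = 1 := by linear_combination (z ^ 4 - 1) * hz
  have h12 : z ^ 12 = -1 := by linear_combination z ^ 8 * hz - h8
  have h16 : z ^ 16 = 1 := by linear_combination (z ^ 8 + 1) * h8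
  have h20 : z ^ 20 = -1 := by linear_combination z ^ 16 * hz - h16
  have h24 : z ^ 24 = 1 := by linear_combination z ^ 16 * h8 + h16
  have h28 : z ^ 28 = -1 := by linear_combination z ^ 24 * hz - h24
  have h32 : z ^ 32 = 1 := by linear_combination (z ^ 16 + 1) * h16
  simp only [mul_pow, hz, h8, h12, h16, h20, h24, h28, h32]
  ring

variable [CharZero L]

lemma aeval_f₁_eq_zero (hr : r ^ 2 = 2) (hk : k ^ 4 - 4 * k ^ 3 + 12 * k - 12 = 0)
    (hx : x ^ 4 * k ^ 2 = 6 * (r - 1)) : aeval x f₁ = 0 := by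
  rw [aeval_f₁]
  linear_combination octic_eq_zero hr hk hx

lemma aeval_f₂_eq_zero (hr : r ^ 2 = 2) (hk : k ^ 4 - 4 * k ^ 3 + 12 * k - 12 = 0)
    (hx : -x ^ 4 * k ^ 2 = 6 * (r - 1)) : aeval x f₂ = 0 := by
  rw [aeval_f₂]
  linear_combination octic_eq_zero hr hk hx

end

/-- The quartic takes the values 12 at -2 and -19 at -1. -/
lemma exists_quartic_root : ∃ k : ℝ, k ^ 2 ≤ 4 ∧ 0 < k ^ 2 ∧ k ^ 4 - 4 * k ^ 3 + 12 * k - 12 = 0 := by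
  have h := intermediate_value_Icc' (f := fun k : ℝ => k ^ 4 - 4 * k ^ 3 + 12 * k - 12)
    (a := -2) (b := -1) (by norm_num) (by fun_prop)
  obtain ⟨k, ⟨h1, h2⟩, hk⟩ := h (show (0 : ℝ) ∈ _ by constructor <;> norm_num)
  exact ⟨k, by nlinarith, by nlinarith, hk⟩

lemma exists_pow_four {y : ℝ} (hy : 0 ≤ y) : ∃ x : ℝ, x ^ 4 = y :=
  ⟨√√y, by rw [show (4 : ℕ) = 2 * 2 from rfl, pow_mul, Real.sq_sqrt (Real.sqrt_nonneg _),
    Real.sq_sqrt hy]⟩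

lemma irreducible_of_le_natDegree_minpoly {f : ℚ[X]} (hf : f.Monic) {x : ℝ} (hx : aeval x f = 0)
    (h : f.natDegree ≤ (minpoly ℚ x).natDegree) : Irreducible f := by
  have hi : IsIntegral ℚ x := ⟨f, hf, hx⟩
  rw [Polynomial.eq_of_monic_of_dvd_of_natDegree_le (minpoly.monic hi) hf (minpoly.dvd ℚ x hx) h]
  exact minpoly.irreducible hi

lemma exists_real_root_f₁ : ∃ x r k : ℝ, r ^ 2 = 2 ∧ k ^ 4 - 4 * k ^ 3 + 12 * k - 12 = 0 ∧
    1 * x ^ 4 * k ^ 2 = 6 * (r - 1) := by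
  obtain ⟨k, -, h0, hk⟩ := exists_quartic_root
  have h2 : (√2 : ℝ) ^ 2 = 2 := Real.sq_sqrt (by norm_num)
  have h1 : 0 ≤ √2 - 1 := by
    have := Real.sqrt_nonneg 2
    nlinarith
  obtain ⟨x, hx⟩ := exists_pow_four (y := 6 * (√2 - 1) / k ^ 2) (by positivity)
  refine ⟨x, √2, k, h2, hk, ?_⟩
  rw [one_mul, hx, div_mul_cancel₀ _ h0.ne']

lemma exists_real_root_f₂ : ∃ x r k : ℝ, r ^ 2 = 2 ∧ k ^ 4 - 4 * k ^ 3 + 12 * k - 12 = 0 ∧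
    -1 * x ^ 4 * k ^ 2 = 6 * (r - 1) ∧
    (-1 * x ^ 4) ^ 3 + 6 * (-1 * x ^ 4) ^ 2 + 20 * (-1 * x ^ 4) + 18 ≠ 0 := by
  obtain ⟨k, h4, h0, hk⟩ := exists_quartic_root
  have h2 : (√2 : ℝ) ^ 2 = 2 := Real.sq_sqrt (by norm_num)
  have h1 : 1 ≤ √2 := by
    have := Real.sqrt_nonneg 2
    nlinarith
  obtain ⟨x, hx⟩ := exists_pow_four (y := 6 * (√2 + 1) / k ^ 2) (by positivity)
  have hx' : x ^ 4 * k ^ 2 = 6 * (√2 + 1) := by rw [hx, div_mul_cancel₀ _ h0.ne']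
  refine ⟨x, -√2, k, by rw [neg_sq, h2], hk, by linear_combination -hx', ?_⟩
  -- From `k² ≤ 4` and `√2 ≥ 1`; for such values the cubic in `-x⁴` is negative.
  have hY : 3 ≤ x ^ 4 := by
    by_contra! h
    nlinarith
  generalize x ^ 4 = Y at hY
  nlinarith [mul_nonneg (sub_nonneg.mpr hY) (sq_nonneg (Y - 3)), sq_nonneg (Y - 3)]

lemma first_cubic_ne (x : ℝ) :
    (1 * x ^ 4) ^ 3 + 6 * (1 * x ^ 4) ^ 2 + 20 * (1 * x ^ 4) + 18 ≠ 0 := by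
  positivity

lemma irreducible_f₁ : Irreducible f₁ := by
  obtain ⟨x, r, k, hr, hk, hx⟩ := exists_real_root_f₁
  have h0 : aeval x f₁ = 0 := aeval_f₁_eq_zero hr hk (by linear_combination hx)
  refine irreducible_of_le_natDegree_minpoly monic_f₁ h0 ?_
  rw [natDegree_f₁]
  exact le_natDegree_minpoly (Or.inl rfl) hr hk hx (first_cubic_ne x) ⟨_, monic_f₁, h0⟩

lemma irreducible_f₂ : Irreducible f₂ := by
  obtain ⟨x, r, k, hr, hk, hx, hne⟩ := exists_real_root_f₂
  have h0 : aeval x f₂ = 0 := aeval_f₂_eq_zero hr hk (by linear_combination hx)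
  refine irreducible_of_le_natDegree_minpoly monic_f₂ h0 ?_
  rw [natDegree_f₂]
  exact le_natDegree_minpoly (Or.inr rfl) hr hk hx hne ⟨_, monic_f₂, h0⟩

open IntermediateField in
/-- A field with these elements has degree divisible by `384`. -/
lemma dvd_finrank_of_mem (M : IntermediateField ℚ ℂ) {c : ℂ} (hI : Complex.I ∈ M)
    (hs : ((√3 : ℝ) : ℂ) ∈ M) (hM : ∀ x : ℂ, aeval x f₁ = 0 → x ∈ M) (hc : c ^ 3 = 6)
    (hcM : c ∈ M) : 384 ∣ Module.finrank ℚ M := by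
  obtain ⟨x, r, k, hr, hk, hx⟩ := exists_real_root_f₁
  have h0 : aeval x f₁ = 0 := aeval_f₁_eq_zero hr hk (by linear_combination hx)
  have hT := finrank_realTower (Or.inl rfl) hr hk hx
  have hTle := realTower_le (Or.inl rfl) hr hk hx (first_cubic_ne x)
  generalize adj (adj (adj (adj (adj (⊥ : IntermediateField ℚ ℝ) √3) r) k) (x ^ 2 * k)) x = T at *
  let φ : ℝ →ₐ[ℚ] ℂ := Complex.ofRealAm.restrictScalars ℚ
  have hxM : (x : ℂ) ∈ M := hM x (by
    have : aeval (φ x) f₁ = 0 := by rw [aeval_algHom_apply, h0, map_zero]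
    exact this)
  have hTM : T.map φ ≤ M := by
    rw [map_le_iff_le_comap]
    refine hTle.trans (adj_le ?_ hs)
    rw [adjoin_simple_le_iff]
    exact hxM
  have hT' : Module.finrank ℚ (T.map φ) = 64 := by
    rw [← hT]
    exact (T.equivMap φ).toLinearEquiv.finrank_eq.symm
  -- The tower of degree 64 is real, so the imaginary unit doubles it.
  have h128 : Module.finrank ℚ (adj (T.map φ) Complex.I) = 128 := by
    rw [finrank_adj_sq, hT']
    · rw [Complex.I_sq]; exact neg_mem (one_mem _)
    · rintro ⟨y, -, hy⟩
      have := congrArg Complex.im hy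
      simp [φ] at this
  have h1 : 128 ∣ Module.finrank ℚ M := by
    rw [← h128]
    exact finrank_dvd_of_le_right (adj_le hTM hI)
  have h3 : 3 ∣ Module.finrank ℚ M := by
    have hirr : Irreducible (X ^ 3 - C 6 : ℚ[X]) := by
      refine X_pow_sub_C_irreducible_of_prime Nat.prime_three fun b hb => ?_
      exact ((generic_bot (E := ℂ)) (algebraMap ℚ _ b)).1 (by rw [← map_pow, hb]; simp)
    have hmon : (X ^ 3 - C 6 : ℚ[X]).Monic := monic_X_pow_sub_C _ three_ne_zero
    have hev : aeval c (X ^ 3 - C 6 : ℚ[X]) = 0 := by simp [hc]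
    have hfin : Module.finrank ℚ ℚ⟮c⟯ = 3 := by
      rw [adjoin.finrank ⟨_, hmon, hev⟩, ← minpoly.eq_of_irreducible_of_monic hirr hev hmon,
        natDegree_X_pow_sub_C]
    rw [← hfin]
    exact finrank_dvd_of_le_right (adjoin_simple_le_iff.mpr hcM)
  have : Nat.Coprime 128 3 := by decide
  exact this.mul_dvd_of_dvd_of_dvd h1 h3

end


/-! ### Distinctness of the roots and recovery of the generators -/

namespace RootData

section
variable {L : Type*} [Field L] (D : RootData L)

/-- The sign of the square root of `2` that belongs to a root. -/
def sign (e : Fin 2) : L := if e = 0 then D.r else -D.r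

lemma sign_sq (e : Fin 2) : D.sign e ^ 2 = 2 := by
  unfold sign
  split_ifs
  · exact D.sq_r
  · rw [neg_sq, D.sq_r]

variable [CharZero L]

lemma B_zero_sq (j : Fin 4) : D.B 0 j ^ 2 = D.k 0 * D.k j := by
  have := D.B_mul 0 j 0
  rwa [B_self, D.B_symm j 0, ← sq, mul_comm (D.k j)] at this

lemma T_pow (e : Fin 2) : D.T e ^ 4 = 6 * (D.sign e - 1) * D.k 0 ^ 2 := by
  have hx : D.x ^ 4 * D.k 0 ^ 2 = 6 * (D.r - 1) := D.pow_x
  have h0 := D.k_ne_zero 0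
  have hx0 := D.x_ne_zero
  have hr := D.sq_r
  fin_cases e
  · simp only [T, sign, Fin.zero_eta, Matrix.cons_val_zero, if_true]
    linear_combination D.k 0 ^ 2 * hx
  · have h1 := D.T_one_pow
    rw [eq_div_iff (pow_ne_zero 4 hx0)] at h1
    simp only [Fin.mk_one, sign, one_ne_zero, if_false]
    refine mul_right_cancel₀ (pow_ne_zero 4 hx0) ?_
    linear_combination h1 - 6 * (-D.r - 1) * hx + 36 * hr

lemma root_pow (p : Fin 2 × Fin 4 × Fin 4) :
    D.root p ^ 4 * D.k p.2.1 ^ 2 = 6 * (D.sign p.1 - 1) := by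
  obtain ⟨e, j, m⟩ := p
  have h1 : D.B 0 j ^ 4 = D.k 0 ^ 2 * D.k j ^ 2 := by
    rw [show D.B 0 j ^ 4 = (D.B 0 j ^ 2) ^ 2 by ring, B_zero_sq, mul_pow]
  have h2 : (D.I ^ (m : ℕ)) ^ 4 = 1 := by rw [← pow_mul, mul_comm, pow_mul, pow_four_I, one_pow]
  simp only [root]
  rw [mul_pow, h2, one_mul, div_pow, h1, T_pow]
  have h0 := D.k_ne_zero 0
  have hj := D.k_ne_zero j
  field_simp

lemma aeval_root [Algebra ℚ L] (p : Fin 2 × Fin 4 × Fin 4) :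
    Polynomial.aeval (D.root p) f₁ = 0 :=
  aeval_f₁_eq_zero (D.sign_sq p.1) (D.quartic_k p.2.1) (D.root_pow p)

lemma c_ne_zero : D.c ≠ 0 := by
  intro h
  have := D.cube_c
  rw [h] at this
  norm_num at this

lemma w_ne_zero : D.w ≠ 0 := by
  intro h
  have := D.sq_w
  rw [h] at this
  norm_num at this

lemma w_ne_one : D.w ≠ 1 := by
  intro h
  have := D.sq_w
  rw [h] at this
  norm_num at this

lemma sq_ne : D.a ^ 2 ≠ D.b ^ 2 ∧ D.b ^ 2 ≠ D.d ^ 2 ∧ D.a ^ 2 ≠ D.d ^ 2 := by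
  have hc := D.c_ne_zero
  have hw := D.w_ne_zero
  have h1 := D.w_ne_one
  rw [D.sq_a, D.sq_b, D.sq_d]
  refine ⟨fun h => ?_, fun h => ?_, fun h => ?_⟩
  · have : D.c * (D.w - 1) = 0 := by linear_combination (1 / 2) * h
    exact (mul_ne_zero hc (sub_ne_zero.mpr h1)) this
  · have : D.c * (D.w * (D.w - 1)) = 0 := by linear_combination (1 / 2) * h
    exact (mul_ne_zero hc (mul_ne_zero hw (sub_ne_zero.mpr h1))) this
  · have : D.c * (D.w - 1) = 0 := by
      linear_combination (-1 / 2) * D.w * h + D.c * D.cube_w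
    exact (mul_ne_zero hc (sub_ne_zero.mpr h1)) this

lemma k_injective : Function.Injective D.k := by
  obtain ⟨h1, h2, h3⟩ := D.sq_ne
  have key : ∀ i j, i < j → D.k i ≠ D.k j := by
    intro i j hij h
    fin_cases i <;> fin_cases j <;> first | exact absurd hij (by decide) | skip
    all_goals simp [k] at h
    · exact h2 (by linear_combination (1 / 2) * (D.b - D.d) * h)
    · exact h3 (by linear_combination (1 / 2) * (D.a - D.d) * h)
    · exact h1 (by linear_combination (1 / 2) * (D.a - D.b) * h)
    · exact h1 (by linear_combination (1 / 2) * (D.a + D.b) * h)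
    · exact h3 (by linear_combination (1 / 2) * (D.a + D.d) * h)
    · exact h2 (by linear_combination (1 / 2) * (D.b + D.d) * h)
  intro i j h
  rcases lt_trichotomy i j with hij | hij | hij
  · exact absurd h (key _ _ hij)
  · exact hij
  · exact absurd h.symm (key _ _ hij)

lemma r_ne_zero : D.r ≠ 0 := by
  intro h
  have := D.sq_r
  rw [h] at this
  norm_num at this

lemma sign_injective : Function.Injective D.sign := by
  have h : D.r ≠ -D.r := by
    intro h
    exact D.r_ne_zero (by linear_combination (1 / 2) * h)
  intro e e' he
  fin_cases e <;> fin_cases e' <;> simp [sign] at he ⊢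
  · exact h he
  · exact h he.symm

lemma isPrimitiveRoot_I : IsPrimitiveRoot D.I 4 := by
  have h2 : D.I ^ 2 ≠ 1 := by rw [D.sq_I]; norm_num
  refine ⟨D.pow_four_I, fun l hl => ?_⟩
  rw [← pow_I_mod] at hl
  have hlt := Nat.mod_lt l (show 4 > 0 by norm_num)
  rw [Nat.dvd_iff_mod_eq_zero]
  interval_cases h : l % 4
  · rfl
  · rw [pow_one] at hl; rw [hl] at h2; norm_num at h2
  · exact absurd hl h2
  · have h3 : D.I = -1 := by linear_combination D.I * D.sq_I - hl
    rw [h3] at h2; norm_num at h2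

lemma pow_I_injective {m n : Fin 4} (h : D.I ^ (m : ℕ) = D.I ^ (n : ℕ)) : m = n :=
  Fin.ext (D.isPrimitiveRoot_I.pow_inj m.2 n.2 h)

/-- The fourth power `Y` of a root determines the sign of `r` by `linear_in_r`, then `k²`, then `k`;
what remains is the power of `I`. -/
lemma root_injective : Function.Injective D.root := by
  rintro ⟨e, j, m⟩ ⟨e', j', m'⟩ h
  have h1 := D.root_pow (e, j, m)
  have h2 := D.root_pow (e', j', m')
  rw [← h] at h2
  generalize hY : D.root (e, j, m) ^ 4 = Y at h1 h2
  have l1 := linear_in_r (D.sign_sq e) (D.quartic_k j) h1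
  have l2 := linear_in_r (D.sign_sq e') (D.quartic_k j') h2
  have hne : Y ^ 3 + 6 * Y ^ 2 + 20 * Y + 18 ≠ 0 := by
    intro h0
    rw [h0, mul_zero] at l1
    -- A Bézout relation between the quartic and the cubic in `Y` of `linear_in_r`: they have no
    -- common zero in characteristic 0.
    have : (405831429 : L) = 0 := by
      linear_combination -(38221117 + 13398618 * Y + 2837402 * Y ^ 2) * l1 +
        (-73006602 - 54301077 * Y + 3625794 * Y ^ 2 - 2837402 * Y ^ 3) * h0
    norm_num at this
  obtain rfl : e = e' := by
    apply D.sign_injective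
    have : 6 * (D.sign e - 1) = 6 * (D.sign e' - 1) := mul_right_cancel₀ hne (l1.trans l2.symm)
    linear_combination (1 / 6) * this
  have hY0 : Y ≠ 0 := by
    intro h0
    rw [h0, zero_mul] at h1
    have h3 : D.sign e = 1 := by linear_combination (-1 / 6) * h1
    have h4 := D.sign_sq e
    rw [h3] at h4
    norm_num at h4
  obtain rfl : j = j' := by
    apply D.k_injective
    have hk2 : D.k j ^ 2 = D.k j' ^ 2 := mul_left_cancel₀ hY0 (h1.trans h2.symm)
    have q1 := D.quartic_k j
    have q2 := D.quartic_k j'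
    generalize D.k j = k at *
    generalize D.k j' = k' at *
    have h0 : 12 - 4 * k ^ 2 ≠ 0 := by
      intro h0
      have h2 : k ^ 2 = 3 := by linear_combination (-1 / 4) * h0
      have : (3 : L) = 0 := by linear_combination -q1 + (k ^ 2 + 3 - 4 * k) * h2
      norm_num at this
    refine mul_right_cancel₀ h0 ?_
    linear_combination q1 - q2 + (4 * k' - (k ^ 2 + k' ^ 2)) * hk2
  have : D.I ^ (m : ℕ) = D.I ^ (m' : ℕ) :=
    mul_right_cancel₀ (div_ne_zero (D.T_ne_zero e) (D.B_ne_zero 0 j)) h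
  rw [D.pow_I_injective this]

/-- The elements in the data are rational in the ratios of the roots. -/
lemma mem_of_root_mem {F : Type*} [Field F] [Algebra F L] (M : IntermediateField F L) {z : L}
    (hz : z ≠ 0) (h : ∀ p, z * D.root p ∈ M) :
    D.I ∈ M ∧ D.w ∈ M ∧ D.c ∈ M ∧ D.r ∈ M ∧ D.a ∈ M ∧ D.b ∈ M ∧ D.d ∈ M := by
  have hdiv (p q) : D.root p / D.root q ∈ M := by
    have := div_mem (h p) (h q)
    rwa [mul_div_mul_left _ _ hz] at this
  have hx := D.x_ne_zero
  have hk0 := D.k_ne_zero 0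
  have hI : D.I ∈ M := by
    have h1 : D.root (0, 0, 1) = D.I * D.root (0, 0, 0) := by simp [root]
    have h2 := hdiv (0, 0, 1) (0, 0, 0)
    rwa [h1, root_zero, mul_div_cancel_right₀ _ hx] at h2
  have hr : D.r ∈ M := by
    have h1 : D.root (1, 0, 0) ^ 4 * D.k 0 ^ 2 = 6 * (-D.r - 1) := D.root_pow (1, 0, 0)
    have h2 : D.root (0, 0, 0) ^ 4 * D.k 0 ^ 2 = 6 * (D.r - 1) := D.root_pow (0, 0, 0)
    have h3 := pow_mem (hdiv (1, 0, 0) (0, 0, 0)) 4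
    -- The quotient of `-r - 1` by `r - 1` is `-(r + 1)²`.
    have h4 : (D.root (1, 0, 0) / D.root (0, 0, 0)) ^ 4 = -(3 + 2 * D.r) := by
      rw [div_pow, div_eq_iff (by rw [root_zero]; exact pow_ne_zero 4 hx)]
      refine mul_right_cancel₀ (pow_ne_zero 2 hk0) ?_
      linear_combination h1 + (3 + 2 * D.r) * h2 + 12 * D.sq_r
    rw [h4] at h3
    have h5 : D.r = (-(-(3 + 2 * D.r)) - 3) / 2 := by ring
    rw [h5]
    exact div_mem (sub_mem (neg_mem h3) (ofNat_mem M 3)) (ofNat_mem M 2)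
  have hkk (j) : D.k j / D.k 0 ∈ M := by
    have h1 := pow_mem (hdiv (0, 0, 0) (0, j, 0)) 2
    have h2 : (D.root (0, 0, 0) / D.root (0, j, 0)) ^ 2 = D.k j / D.k 0 := by
      have h3 : D.root (0, 0, 0) / D.root (0, j, 0) = D.B 0 j / D.k 0 := by
        simp only [root, B_self]
        have := D.T_ne_zero 0
        have := D.B_ne_zero 0 j
        field_simp
      rw [h3, div_pow, B_zero_sq]
      field_simp
    rwa [h2] at h1
  have hk0' : D.k 0 ∈ M := by
    -- Only ratios of the `k` are known so far; their sum fixes the scale.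
    have h1 : D.k 0 + D.k 1 + D.k 2 + D.k 3 = 4 := by simp [k]; ring
    have h2 := div_mem (ofNat_mem M 4) (add_mem (add_mem (add_mem (hkk 0) (hkk 1)) (hkk 2)) (hkk 3))
    rw [← add_div, ← add_div, ← add_div, h1] at h2
    rwa [div_div_cancel₀ (by norm_num)] at h2
  have hk (j) : D.k j ∈ M := by
    have := mul_mem (hkk j) hk0'
    rwa [div_mul_cancel₀ _ hk0] at this
  have ha : D.a ∈ M := by
    have h1 : D.a = D.k 0 + D.k 1 - 2 := by simp [k]; ring
    rw [h1]
    exact sub_mem (add_mem (hk 0) (hk 1)) (ofNat_mem M 2)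
  have hb : D.b ∈ M := by
    have h1 : D.b = D.k 0 + D.k 2 - 2 := by simp [k]; ring
    rw [h1]
    exact sub_mem (add_mem (hk 0) (hk 2)) (ofNat_mem M 2)
  have hd : D.d ∈ M := by
    have h1 : D.d = D.k 0 + D.k 3 - 2 := by simp [k]; ring
    rw [h1]
    exact sub_mem (add_mem (hk 0) (hk 3)) (ofNat_mem M 2)
  have hc : D.c ∈ M := by
    have h1 : D.c = (4 - D.a ^ 2) / 2 := by rw [D.sq_a]; ring
    rw [h1]
    exact div_mem (sub_mem (ofNat_mem M 4) (pow_mem ha 2)) (ofNat_mem M 2)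
  have hw : D.w ∈ M := by
    have hc0 := D.c_ne_zero
    have h1 : D.w = (4 - D.b ^ 2) / 2 / D.c := by
      rw [D.sq_b]
      field_simp
      ring
    rw [h1]
    exact div_mem (div_mem (sub_mem (ofNat_mem M 4) (pow_mem hb 2)) (ofNat_mem M 2)) hc
  exact ⟨hI, hw, hc, hr, ha, hb, hd⟩

end

end RootData


/-! ### At most 384 systems of generators -/

section
variable {L : Type*} [Field L]

open Classical in
/-- A chosen `n`-th root, if there is one. -/
noncomputable def chosenRoot (n : ℕ) (z : L) : L := if h : ∃ y, y ^ n = z then h.choose else 0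

lemma exists_eq_mul_chosenRoot {n : ℕ} [NeZero n] {ζ : L} (hζ : IsPrimitiveRoot ζ n) {y z : L}
    (hz : z ≠ 0) (hy : y ^ n = z) : ∃ m : Fin n, y = ζ ^ (m : ℕ) * chosenRoot n z := by
  have h : ∃ y, y ^ n = z := ⟨y, hy⟩
  have hc : chosenRoot n z ^ n = z := by
    rw [chosenRoot, dif_pos h]
    exact h.choose_spec
  have hc0 : chosenRoot n z ≠ 0 := by
    intro h0
    rw [h0, zero_pow (NeZero.ne n)] at hc
    exact hz hc.symm
  obtain ⟨i, hi, h1⟩ := hζ.eq_pow_of_pow_eq_one (ξ := y / chosenRoot n z)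
    (by rw [div_pow, hy, hc, div_self hz])
  exact ⟨⟨i, hi⟩, by rw [h1, div_mul_cancel₀ _ hc0]⟩

end

namespace RootData

section
variable {L : Type*} [Field L] [CharZero L] (D : RootData L)

lemma isPrimitiveRoot_w : IsPrimitiveRoot D.w 3 :=
  haveI : Fact (Nat.Prime 3) := ⟨Nat.prime_three⟩
  orderOf_eq_prime D.cube_w D.w_ne_one ▸ IsPrimitiveRoot.orderOf D.w

lemma isPrimitiveRoot_neg_one : IsPrimitiveRoot (-1 : L) 2 := 
  IsPrimitiveRoot.neg_one 0 (by norm_num)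

lemma a_ne_zero : D.a ≠ 0 := by
  intro h
  have := D.mul_abd
  rw [h] at this
  norm_num at this

lemma b_ne_zero : D.b ≠ 0 := by
  intro h
  have := D.mul_abd
  rw [h] at this
  norm_num at this

lemma d_eq : D.d = -4 / (D.a * D.b) := by
  rw [eq_div_iff (mul_ne_zero D.a_ne_zero D.b_ne_zero), ← D.mul_abd]
  ring

/-- Each generator is determined by the earlier ones up to a root of unity, and `d` is `-4 / (a b)`.
The chosen roots depend only on the radicand, so equal exponents give equal data. -/
lemma exists_code : ∃ m : Fin 2 × Fin 2 × Fin 3 × Fin 2 × Fin 2 × Fin 2 × Fin 4,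
    D.I = (-1) ^ (m.1 : ℕ) * chosenRoot 2 (-1) ∧
    2 * D.w + 1 = (-1) ^ (m.2.1 : ℕ) * chosenRoot 2 (-3) ∧
    D.c = D.w ^ (m.2.2.1 : ℕ) * chosenRoot 3 6 ∧
    D.r = (-1) ^ (m.2.2.2.1 : ℕ) * chosenRoot 2 2 ∧
    D.a = (-1) ^ (m.2.2.2.2.1 : ℕ) * chosenRoot 2 (4 - 2 * D.c) ∧
    D.b = (-1) ^ (m.2.2.2.2.2.1 : ℕ) * chosenRoot 2 (4 - 2 * (D.w * D.c)) ∧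
    D.x = D.I ^ (m.2.2.2.2.2.2 : ℕ) * chosenRoot 4 (6 * (D.r - 1) / (1 + (D.a + D.b + D.d) / 2) ^ 2) := by
  have hn := isPrimitiveRoot_neg_one (L := L)
  have h7 : D.x ^ 4 = 6 * (D.r - 1) / (1 + (D.a + D.b + D.d) / 2) ^ 2 :=
    (eq_div_iff (pow_ne_zero 2 (D.k_ne_zero 0))).mpr D.pow_x
  obtain ⟨m₁, h₁⟩ := exists_eq_mul_chosenRoot hn (by norm_num) D.sq_I
  obtain ⟨m₂, h₂⟩ := exists_eq_mul_chosenRoot hn (y := 2 * D.w + 1) (z := -3) (by norm_num)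
    (by linear_combination 4 * D.sq_w)
  obtain ⟨m₃, h₃⟩ := exists_eq_mul_chosenRoot D.isPrimitiveRoot_w (by norm_num) D.cube_c
  obtain ⟨m₄, h₄⟩ := exists_eq_mul_chosenRoot hn (by norm_num) D.sq_r
  obtain ⟨m₅, h₅⟩ := exists_eq_mul_chosenRoot hn
    (D.sq_a ▸ pow_ne_zero 2 D.a_ne_zero) D.sq_a
  obtain ⟨m₆, h₆⟩ := exists_eq_mul_chosenRoot hn
    (D.sq_b ▸ pow_ne_zero 2 D.b_ne_zero) D.sq_b
  obtain ⟨m₇, h₇⟩ := exists_eq_mul_chosenRoot D.isPrimitiveRoot_I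
    (h7 ▸ pow_ne_zero 4 D.x_ne_zero) h7
  exact ⟨⟨m₁, m₂, m₃, m₄, m₅, m₆, m₇⟩, h₁, h₂, h₃, h₄, h₅, h₆, h₇⟩

/-- The choices that determine the data. -/
noncomputable def code : Fin 2 × Fin 2 × Fin 3 × Fin 2 × Fin 2 × Fin 2 × Fin 4 :=
  D.exists_code.choose

lemma code_injective : Function.Injective (code (L := L)) := by
  intro D D' h
  have hs := D.exists_code.choose_spec
  have hs' := D'.exists_code.choose_spec
  change D.exists_code.choose = D'.exists_code.choose at h
  generalize D.exists_code.choose = m at h hs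
  generalize D'.exists_code.choose = m' at h hs'
  subst h
  obtain ⟨h₁, h₂, h₃, h₄, h₅, h₆, h₇⟩ := hs
  obtain ⟨h₁', h₂', h₃', h₄', h₅', h₆', h₇'⟩ := hs'
  have eI : D.I = D'.I := h₁.trans h₁'.symm
  have ew : D.w = D'.w := by linear_combination (1 / 2) * (h₂.trans h₂'.symm)
  have ec : D.c = D'.c := by rw [h₃, h₃', ew]
  have er : D.r = D'.r := h₄.trans h₄'.symm
  have ea : D.a = D'.a := by rw [h₅, h₅', ec]
  have eb : D.b = D'.b := by rw [h₆, h₆', ec, ew]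
  have ed : D.d = D'.d := by rw [d_eq, d_eq, ea, eb]
  have ex : D.x = D'.x := by rw [h₇, h₇', eI, er, ea, eb, ed]
  exact RootData.ext eI ew ec er ea eb ed ex

instance : Finite (RootData L) := Finite.of_injective _ code_injective

lemma card_le : Nat.card (RootData L) ≤ 384 := by
  refine (Nat.card_le_card_of_injective _ code_injective).trans ?_
  simp

end

section
variable {L M : Type*} [Field L] [Field M] (D : RootData L)

/-- The image of the data under a homomorphism. -/
def map (τ : L →+* M) : RootData M where
  I := τ D.I
  w := τ D.w
  c := τ D.c
  r := τ D.r
  a := τ D.a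
  b := τ D.b
  d := τ D.d
  x := τ D.x
  sq_I := by rw [← map_pow, D.sq_I, map_neg, map_one]
  sq_w := by rw [← map_pow, ← map_one τ, ← map_add, ← map_add, D.sq_w, map_zero]
  cube_c := by rw [← map_pow, D.cube_c, map_ofNat]
  sq_r := by rw [← map_pow, D.sq_r, map_ofNat]
  sq_a := by rw [← map_pow, D.sq_a]; simp [map_ofNat]
  sq_b := by rw [← map_pow, D.sq_b]; simp [map_ofNat]
  sq_d := by rw [← map_pow, D.sq_d]; simp [map_ofNat]
  mul_abd := by rw [← map_mul, ← map_mul, D.mul_abd]; simp [map_ofNat]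
  pow_x := by
    have := congrArg τ D.pow_x
    simpa [map_ofNat] using this

lemma map_k (τ : L →+* M) (j : Fin 4) : (D.map τ).k j = τ (D.k j) := by
  fin_cases j <;> simp [k, map, map_ofNat]

lemma map_B (τ : L →+* M) (i j : Fin 4) : (D.map τ).B i j = τ (D.B i j) := by
  fin_cases i <;> fin_cases j <;> simp [B, map_k] <;> simp [map, map_ofNat]

lemma map_T (τ : L →+* M) (e : Fin 2) : (D.map τ).T e = τ (D.T e) := by
  fin_cases e <;> simp [T, map_k] <;> simp [map, map_ofNat]

lemma map_root (τ : L →+* M) (p : Fin 2 × Fin 4 × Fin 4) : (D.map τ).root p = τ (D.root p) := by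
  simp only [root, map_T, map_B, map_mul, map_pow, map_div₀]
  rfl

end

lemma exists_complex : Nonempty (RootData ℂ) := by
  have hroot (n : ℕ) (hn : 0 < n) (z : ℂ) : ∃ y, y ^ n = z := IsAlgClosed.exists_pow_nat_eq z hn
  obtain ⟨I, hI⟩ := hroot 2 two_pos (-1)
  obtain ⟨s, hs⟩ := hroot 2 two_pos (-3)
  obtain ⟨c, hc⟩ := hroot 3 three_pos 6
  obtain ⟨r, hr⟩ := hroot 2 two_pos 2
  obtain ⟨w, hw⟩ : ∃ w : ℂ, w ^ 2 + w + 1 = 0 := ⟨(s - 1) / 2, by linear_combination (1 / 4) * hs⟩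
  obtain ⟨a, ha⟩ := hroot 2 two_pos (4 - 2 * c)
  obtain ⟨b, hb⟩ := hroot 2 two_pos (4 - 2 * (w * c))
  have hw3 : w ^ 3 = 1 := by linear_combination (w - 1) * hw
  have hprod : (4 - 2 * c) * (4 - 2 * (w * c)) * (4 - 2 * (w ^ 2 * c)) = 16 := by
    linear_combination (-32 * c + 16 * c ^ 2 * w) * hw - 8 * hc - 8 * c ^ 3 * hw3
  have ha0 : a ≠ 0 := by
    rintro rfl
    rw [← ha] at hprod
    norm_num at hprod
  have hb0 : b ≠ 0 := by
    rintro rfl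
    rw [← hb] at hprod
    norm_num at hprod
  have hd : (-4 / (a * b)) ^ 2 = 4 - 2 * (w ^ 2 * c) := by
    rw [div_pow, div_eq_iff (pow_ne_zero 2 (mul_ne_zero ha0 hb0)), mul_pow, ha, hb]
    linear_combination -hprod
  have habd : a * b * (-4 / (a * b)) = -4 := mul_div_cancel₀ _ (mul_ne_zero ha0 hb0)
  generalize -4 / (a * b) = d at hd habd
  -- Otherwise `a`, `b`, `d` have elementary symmetric functions -2, -4, -4, and the sum of the
  -- squared pairwise products would be `16 - 16 = 0`, while the radicands give 48.
  have hk : 1 + (a + b + d) / 2 ≠ 0 := by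
    intro h0
    have h1 : a ^ 2 + b ^ 2 + d ^ 2 = 12 := by
      linear_combination ha + hb + hd - 2 * c * hw
    have h2 : a * b + b * d + a * d = -4 := by
      linear_combination (-1 / 2) * h1 + (a + b + d - 2) * h0
    have h3 : a ^ 2 * b ^ 2 + b ^ 2 * d ^ 2 + a ^ 2 * d ^ 2 = 48 := by
      rw [ha, hb, hd]
      linear_combination (-16 * c + 4 * w * c ^ 2) * hw
    have : (48 : ℂ) = 0 := by
      linear_combination (a * b + b * d + a * d - 4) * h2 - h3 - 4 * h0 * a * b * d + 4 * habd
    norm_num at this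
  obtain ⟨x, hx⟩ := hroot 4 four_pos (6 * (r - 1) / (1 + (a + b + d) / 2) ^ 2)
  exact ⟨⟨I, w, c, r, a, b, d, x, hI, hw, hc, hr, ha, hb, hd, habd,
    (eq_div_iff (pow_ne_zero 2 hk)).mp hx⟩⟩

end RootData


/-! ### Automorphisms and systems of generators -/

open Polynomial IntermediateField

namespace RootData

/-- The data in an intermediate field that contains them. -/
def restrict {F L : Type*} [Field F] [Field L] [Algebra F L] (D : RootData L)
    (M : IntermediateField F L)
    (h : D.I ∈ M ∧ D.w ∈ M ∧ D.c ∈ M ∧ D.r ∈ M ∧ D.a ∈ M ∧ D.b ∈ M ∧ D.d ∈ M) (hx : D.x ∈ M) :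
    RootData M where
  I := ⟨D.I, h.1⟩
  w := ⟨D.w, h.2.1⟩
  c := ⟨D.c, h.2.2.1⟩
  r := ⟨D.r, h.2.2.2.1⟩
  a := ⟨D.a, h.2.2.2.2.1⟩
  b := ⟨D.b, h.2.2.2.2.2.1⟩
  d := ⟨D.d, h.2.2.2.2.2.2⟩
  x := ⟨D.x, hx⟩
  sq_I := Subtype.ext D.sq_I
  sq_w := Subtype.ext D.sq_w
  cube_c := Subtype.ext D.cube_c
  sq_r := Subtype.ext D.sq_r
  sq_a := Subtype.ext D.sq_a
  sq_b := Subtype.ext D.sq_b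
  sq_d := Subtype.ext D.sq_d
  mul_abd := Subtype.ext D.mul_abd
  pow_x := Subtype.ext D.pow_x

section
variable {L : Type*} [Field L] [Algebra ℚ L] (D : RootData L)

lemma map_map (τ τ' : L ≃ₐ[ℚ] L) :
    D.map ((τ * τ' : L ≃ₐ[ℚ] L) : L →+* L) = (D.map (τ' : L →+* L)).map (τ : L →+* L) := rfl

variable [CharZero L]

lemma root_mem_rootSet (p : Fin 2 × Fin 4 × Fin 4) : D.root p ∈ f₁.rootSet L :=
  mem_rootSet.mpr ⟨monic_f₁.ne_zero, D.aeval_root p⟩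

lemma bijective_root : Function.Bijective fun i : Fin 32 =>
    (⟨D.root (label i), D.root_mem_rootSet _⟩ : f₁.rootSet L) := by
  refine Function.Injective.bijective_of_nat_card_le
    (fun i j h => label_injective (D.root_injective (congrArg Subtype.val h))) ?_
  have h := ncard_rootSet_le f₁ L
  rw [natDegree_f₁, ← Nat.card_coe_set_eq] at h
  simpa using h

/-- The roots of `f₁`, numbered by `1, …, 32`. -/
noncomputable def rootEquiv : Fin 32 ≃ f₁.rootSet L := Equiv.ofBijective _ D.bijective_root

lemma coe_rootEquiv (i : Fin 32) : (D.rootEquiv i : L) = D.root (label i) := rfl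

/-- The roots are rational expressions in the generators, so `τ` fixes all of them, and they
generate the splitting field. -/
lemma eq_one_of_map_eq [f₁.IsSplittingField ℚ L] {τ : L ≃ₐ[ℚ] L}
    (h : D.map (τ : L →+* L) = D) : τ = 1 := by
  have : (τ : L →ₐ[ℚ] L) = AlgHom.id ℚ L := by
    refine AlgHom.ext_of_adjoin_eq_top (IsSplittingField.adjoin_rootSet L f₁) fun x hx => ?_
    obtain ⟨i, hi⟩ := D.rootEquiv.surjective ⟨x, hx⟩
    have h1 : x = D.root (label i) := by rw [← coe_rootEquiv, hi]
    have h2 := D.map_root (τ : L →+* L) (label i)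
    rw [h] at h2
    rw [h1]
    exact h2.symm
  ext x
  exact DFunLike.congr_fun this x

lemma map_injective [f₁.IsSplittingField ℚ L] :
    Function.Injective fun τ : L ≃ₐ[ℚ] L => D.map (τ : L →+* L) := by
  intro τ τ' h
  have h1 := congrArg (fun E => E.map ((τ'⁻¹ : L ≃ₐ[ℚ] L) : L →+* L)) h
  simp only [← map_map, inv_mul_cancel] at h1
  exact (inv_mul_eq_one.mp (D.eq_one_of_map_eq (h1.trans rfl))).symm

end

end RootData

instance isGalois_of_isSplittingField {L : Type*} [Field L] [Algebra ℚ L]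
    [f₁.IsSplittingField ℚ L] : IsGalois ℚ L :=
  IsGalois.of_separable_splitting_field irreducible_f₁.separable


/-! ### The degree 384 and the Galois group as a permutation group -/

open Polynomial IntermediateField

namespace RootData

section
variable {L : Type*} [Field L] (D : RootData L)

/-- A primitive eighth root of unity. -/
def zeta : L := (1 + D.I) / D.r

variable [CharZero L]

lemma zeta_pow : D.zeta ^ 4 = -1 := by
  have hr := D.r_ne_zero
  rw [zeta, div_pow, div_eq_iff (pow_ne_zero 4 hr)]
  linear_combination (D.I ^ 2 + 4 * D.I + 5) * D.sq_I + (D.r ^ 2 + 2) * D.sq_r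

lemma zeta_ne_zero : D.zeta ≠ 0 := by
  intro h
  have := D.zeta_pow
  rw [h] at this
  norm_num at this

end

section
variable {L : Type*} [Field L] [Algebra ℚ L] [CharZero L]
  [f₁.IsSplittingField ℚ L]

lemma finrank_eq (D : RootData L) (h : 384 ∣ Module.finrank ℚ L) : Module.finrank ℚ L = 384 := by
  have : FiniteDimensional ℚ L := IsSplittingField.finiteDimensional L f₁
  refine Nat.dvd_antisymm ?_ h
  have h1 := (Nat.card_le_card_of_injective _ D.map_injective).trans card_le
  rw [IsGalois.card_aut_eq_finrank] at h1
  obtain ⟨m, hm⟩ := h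
  have h2 : 0 < Module.finrank ℚ L := Module.finrank_pos
  obtain rfl : m = 1 := by omega
  exact ⟨1, by omega⟩

/-- The 384 automorphisms move `D` to distinct systems and there are at most 384 systems, so every
system is reached. -/
lemma exists_map_eq (D : RootData L) (h : Module.finrank ℚ L = 384) (E : RootData L) :
    ∃ τ : L ≃ₐ[ℚ] L, D.map (τ : L →+* L) = E := by
  have : FiniteDimensional ℚ L := IsSplittingField.finiteDimensional L f₁
  refine (D.map_injective.bijective_of_nat_card_le ?_).2 E
  rw [IsGalois.card_aut_eq_finrank, h]
  exact card_le

end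

section
variable {L : Type*} [Field L] [Algebra ℚ L] [CharZero L] (D : RootData L)

/-- The action of the Galois group on the numbered roots. -/
noncomputable def rootAction : (L ≃ₐ[ℚ] L) →* Equiv.Perm (Fin 32) where
  toFun τ := D.rootEquiv.symm.permCongr (τ.toEquiv.subtypeEquiv fun x => by
    simp only [mem_rootSet, ne_eq, monic_f₁.ne_zero, not_false_eq_true, true_and,
      AlgEquiv.toEquiv_eq_coe, EquivLike.coe_coe, aeval_algHom_apply, map_eq_zero_iff _ τ.injective])
  map_one' := by
    ext i
    simp
  map_mul' τ τ' := by
    apply Equiv.ext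
    intro i
    apply D.rootEquiv.injective
    simp

lemma rootEquiv_rootAction (τ : L ≃ₐ[ℚ] L) (i : Fin 32) :
    (D.rootEquiv (D.rootAction τ i) : L) = τ (D.rootEquiv i) := by
  simp [rootAction]

lemma rootAction_eq {τ : L ≃ₐ[ℚ] L} {σ : Equiv.Perm (Fin 32)} {E : RootData L}
    (h : D.map (τ : L →+* L) = E) (hE : ∀ p, E.root (label p) = D.root (label (σ p))) :
    D.rootAction τ = σ := by
  refine Equiv.ext fun i => D.rootEquiv.injective (Subtype.ext ?_)
  rw [rootEquiv_rootAction, coe_rootEquiv, coe_rootEquiv, ← hE, ← h, map_root]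
  rfl

lemma rootAction_injective [f₁.IsSplittingField ℚ L] : Function.Injective D.rootAction := by
  rw [injective_iff_map_eq_one]
  intro τ h
  have : (τ : L →ₐ[ℚ] L) = AlgHom.id ℚ L := by
    refine AlgHom.ext_of_adjoin_eq_top (IsSplittingField.adjoin_rootSet L f₁) fun x hx => ?_
    obtain ⟨i, hi⟩ := D.rootEquiv.surjective ⟨x, hx⟩
    have h1 := D.rootEquiv_rootAction τ i
    rw [h, Equiv.Perm.one_apply, hi] at h1
    exact h1.symm
  exact AlgEquiv.ext fun x => DFunLike.congr_fun this x

/-- The four explicit systems of generators are reached by automorphisms, which act as the four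
generators of the permutation group; equality follows from the orders. -/
lemma range_rootAction [f₁.IsSplittingField ℚ L] (h : Module.finrank ℚ L = 384) :
    D.rootAction.range = G32T9403 := by
  have : FiniteDimensional ℚ L := IsSplittingField.finiteDimensional L f₁
  symm
  apply Subgroup.eq_of_le_of_card_ge
  · rw [G32T9403, Subgroup.closure_le]
    rintro σ (rfl | rfl | rfl | rfl)
    · obtain ⟨τ, hτ⟩ := D.exists_map_eq h D.rotate
      exact ⟨τ, D.rootAction_eq hτ D.root_rotate⟩
    · obtain ⟨τ, hτ⟩ := D.exists_map_eq h (D.conjugate 1 (by norm_num))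
      exact ⟨τ, D.rootAction_eq hτ fun p => D.root_conjugate_neg p _⟩
    · obtain ⟨τ, hτ⟩ := D.exists_map_eq h (D.conjugate (-1) (by norm_num))
      exact ⟨τ, D.rootAction_eq hτ fun p => D.root_conjugate p _⟩
    · obtain ⟨τ, hτ⟩ := D.exists_map_eq h D.exchange
      exact ⟨τ, D.rootAction_eq hτ D.root_exchange⟩
  · rw [Nat.card_congr (MonoidHom.ofInjective D.rootAction_injective).symm.toEquiv,
      IsGalois.card_aut_eq_finrank, h, card_G32T9403]

/-- The isomorphism of the Galois group with the permutation group. -/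
noncomputable def galEquiv [f₁.IsSplittingField ℚ L] (h : Module.finrank ℚ L = 384) :
    (L ≃ₐ[ℚ] L) ≃* G32T9403 :=
  (MonoidHom.ofInjective D.rootAction_injective).trans
    (MulEquiv.subgroupCongr (D.range_rootAction h))

lemma coe_galEquiv [f₁.IsSplittingField ℚ L] (h : Module.finrank ℚ L = 384) (τ : L ≃ₐ[ℚ] L) :
    (D.galEquiv h τ : Equiv.Perm (Fin 32)) = D.rootAction τ := rfl

lemma aeval_zeta_mul_root (p : Fin 2 × Fin 4 × Fin 4) : aeval (D.zeta * D.root p) f₂ = 0 := by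
  rw [aeval_f₂_mul D.zeta_pow, aeval_root]

end

end RootData


/-! ### The two number fields of degree 32 -/

open Polynomial IntermediateField

lemma forall_adjoinRoot_iff {F L : Type*} [Field F] [Field L] [Algebra F L] {f : F[X]}
    (ι : AdjoinRoot f →ₐ[F] L) (τ : L ≃ₐ[F] L) :
    (∀ y, τ (ι y) = ι y) ↔ τ (ι (AdjoinRoot.root f)) = ι (AdjoinRoot.root f) := by
  refine ⟨fun h => h _, fun h y => ?_⟩
  have : (τ : L →ₐ[F] L).comp ι = ι := AdjoinRoot.algHom_ext h
  exact DFunLike.congr_fun this y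

lemma finrank_adjoinRoot {F : Type*} [Field F] {f : F[X]} (hf : f ≠ 0) :
    Module.finrank F (AdjoinRoot f) = f.natDegree := by
  rw [(AdjoinRoot.powerBasis hf).finrank, AdjoinRoot.powerBasis_dim]

lemma exists_algHom {F L : Type*} [Field F] [Field L] [Algebra F L] {f : F[X]} {x : L}
    (h : aeval x f = 0) : ∃ ι : AdjoinRoot f →ₐ[F] L, ι (AdjoinRoot.root f) = x :=
  ⟨AdjoinRoot.liftAlgHom f (Algebra.ofId F L) x h, AdjoinRoot.liftAlgHom_root _ _ _ _⟩

lemma card_fixingSubgroup_fieldRange_mul {F K L : Type*} [Field F] [Field K] [Field L] [Algebra F K]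
    [Algebra F L] [FiniteDimensional F L] [IsGalois F L] (ι : K →ₐ[F] L) :
    Nat.card ι.fieldRange.fixingSubgroup * Module.finrank F K = Module.finrank F L := by
  rw [IsGalois.card_fixingSubgroup_eq_finrank, (AlgHom.equivFieldRange ι).toLinearEquiv.finrank_eq,
    mul_comm, Module.finrank_mul_finrank]

namespace RootData

section
variable {L : Type*} [Field L] [Algebra ℚ L] [CharZero L] [f₁.IsSplittingField ℚ L]
  (D : RootData L) (h : Module.finrank ℚ L = 384)

lemma galEquiv_mem_subH₁_iff (τ : L ≃ₐ[ℚ] L) :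
    D.galEquiv h τ ∈ subH₁ ↔ τ (D.rootEquiv 0) = D.rootEquiv 0 := by
  rw [mem_subH₁_iff, coe_galEquiv, ← rootEquiv_rootAction, Subtype.coe_inj,
    D.rootEquiv.injective.eq_iff]

-- The automorphism of `σ₀` multiplies the root of number 30 by `I` and `zeta` by `-I`, and that of
-- `σ₂` fixes both. So this root of `f₂` is fixed by the second subgroup.
include h in
lemma fixes_of_mem_closure {τ : L ≃ₐ[ℚ] L}
    (hτ : D.rootAction τ ∈ Subgroup.closure {σ₀, σ₂}) :
    τ (D.zeta * D.rootEquiv 30) = D.zeta * D.rootEquiv 30 := by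
  let K := MulAction.stabilizer (L ≃ₐ[ℚ] L) (D.zeta * D.rootEquiv 30)
  have hz (τ : L ≃ₐ[ℚ] L) : τ D.zeta = (D.map (τ : L →+* L)).zeta := by
    simp [zeta, map]
  have hle : Subgroup.closure {σ₀, σ₂} ≤ K.map D.rootAction := by
    rw [Subgroup.closure_le]
    rintro σ (rfl | rfl)
    · obtain ⟨τ, hτ⟩ := D.exists_map_eq h D.rotate
      have hact := D.rootAction_eq hτ D.root_rotate
      refine ⟨τ, ?_, hact⟩
      change τ _ = _
      rw [map_mul, hz, hτ, ← rootEquiv_rootAction, hact, show σ₀ 30 = 31 by decide +kernel]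
      rw [coe_rootEquiv, coe_rootEquiv, show label 31 = (1, 0, 1) by decide +kernel,
        show label 30 = (1, 0, 0) by decide +kernel]
      have h1 : D.root (1, 0, 1) = D.I * D.root (1, 0, 0) := by simp [root]
      rw [h1, zeta, zeta, ← mul_assoc]
      congr 1
      simp only [rotate]
      rw [div_mul_eq_mul_div]
      congr 1
      linear_combination -D.sq_I
    · obtain ⟨τ, hτ⟩ := D.exists_map_eq h (D.conjugate (-1) (by norm_num))
      have hact := D.rootAction_eq hτ fun p => D.root_conjugate p _
      refine ⟨τ, ?_, hact⟩
      change τ _ = _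
      rw [map_mul, hz, hτ, ← rootEquiv_rootAction, hact, show σ₂ 30 = 30 by decide +kernel]
      rfl
  obtain ⟨τ', h1, h2⟩ := hle hτ
  rw [← D.rootAction_injective h2]
  exact h1

/-- The second subgroup fixes the image of the field; both groups have order 12, by irreducibility
of `f₂`. -/
lemma galEquiv_mem_subH₂_iff {ι : AdjoinRoot f₂ →ₐ[ℚ] L}
    (hι : ι (AdjoinRoot.root f₂) = D.zeta * D.rootEquiv 30) (τ : L ≃ₐ[ℚ] L) :
    D.galEquiv h τ ∈ subH₂ ↔ ∀ y, τ (ι y) = ι y := by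
  have hfd : FiniteDimensional ℚ L := IsSplittingField.finiteDimensional L f₁
  have : Fact (Irreducible f₂) := ⟨irreducible_f₂⟩
  let K := ι.fieldRange.fixingSubgroup.map (D.galEquiv h).toMonoidHom
  have hK : Nat.card K = 12 := by
    have h2 := card_fixingSubgroup_fieldRange_mul ι
    rw [h, finrank_adjoinRoot monic_f₂.ne_zero, natDegree_f₂] at h2
    rw [Nat.card_congr ((ι.fieldRange.fixingSubgroup).equivMapOfInjective _
      (D.galEquiv h).injective).symm.toEquiv]
    omega
  have hmem (τ : L ≃ₐ[ℚ] L) : D.galEquiv h τ ∈ K ↔ ∀ y, τ (ι y) = ι y := by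
    rw [Subgroup.mem_map_equiv, MulEquiv.symm_apply_apply, IntermediateField.mem_fixingSubgroup_iff]
    simp
  have hle : subH₂ ≤ K := by
    intro g hg
    obtain ⟨τ, rfl⟩ := (D.galEquiv h).surjective g
    rw [hmem, forall_adjoinRoot_iff, hι]
    exact D.fixes_of_mem_closure h (Subgroup.mem_subgroupOf.mp hg)
  rw [← hmem, Subgroup.eq_of_le_of_card_ge hle (by rw [hK, card_of_index index_subH₂])]

-- An isomorphism would place a root of `f₁` that generates the second field in `L`. Its stabilizer
-- is a conjugate of the first subgroup, which would then equal the second one.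
include D h in
lemma isEmpty_ringEquiv : IsEmpty (AdjoinRoot f₁ ≃+* AdjoinRoot f₂) := by
  have : Fact (Irreducible f₂) := ⟨irreducible_f₂⟩
  refine ⟨fun φ => ?_⟩
  obtain ⟨ι, hι⟩ := exists_algHom (D.aeval_zeta_mul_root (label 30))
  have hφ : aeval (ι (φ (AdjoinRoot.root f₁))) f₁ = 0 := by
    have h1 : aeval (AdjoinRoot.root f₁) f₁ = 0 := by simp
    have h2 := aeval_algHom_apply (ι.comp ((φ : AdjoinRoot f₁ →+* AdjoinRoot f₂).toRatAlgHom))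
      (AdjoinRoot.root f₁) f₁
    rw [h1, map_zero] at h2
    exact h2
  obtain ⟨i, hi⟩ := D.rootEquiv.surjective ⟨_, mem_rootSet.mpr ⟨monic_f₁.ne_zero, hφ⟩⟩
  obtain ⟨g, hg, rfl⟩ := exists_apply_zero i
  refine not_conj_subH₁_subH₂ ⟨g, hg⟩ (Subgroup.ext fun g' => ?_)
  obtain ⟨τ, hτ⟩ := (D.galEquiv h).surjective ⟨g, hg⟩
  obtain ⟨τ', rfl⟩ := (D.galEquiv h).surjective g'
  rw [← hτ, Subgroup.mem_map_equiv, D.galEquiv_mem_subH₂_iff h hι]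
  have h3 : (MulAut.conj (D.galEquiv h τ)).symm (D.galEquiv h τ') =
      D.galEquiv h (τ⁻¹ * τ' * τ) := by simp
  have h4 : τ (D.rootEquiv 0) = ι (φ (AdjoinRoot.root f₁)) := by
    rw [← rootEquiv_rootAction, ← coe_galEquiv D h, hτ, hi]
  rw [h3, galEquiv_mem_subH₁_iff, AlgEquiv.mul_apply, AlgEquiv.mul_apply, h4,
    AlgEquiv.aut_inv, AlgEquiv.symm_apply_eq, h4]
  exact (forall_adjoinRoot_iff
    (ι.comp ((φ : AdjoinRoot f₁ →+* AdjoinRoot f₂).toRatAlgHom)) τ').symm.trans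
      (φ.surjective.forall (p := fun y => τ' (ι y) = ι y)).symm

-- Normality gives the splitting. Conversely, the ratios of the roots of `f₂` are ratios of roots of
-- `f₁`; they generate `I` and `r`, hence `zeta`, hence the roots of `f₁`.
include D in
lemma isSplittingField_f₂ : f₂.IsSplittingField ℚ L := by
  rw [isSplittingField_iff_intermediateField]
  have h1 := D.aeval_zeta_mul_root (label 0)
  have hmem (p) : D.zeta * D.root p ∈ adjoin ℚ (f₂.rootSet L) :=
    subset_adjoin _ _ (mem_rootSet.mpr ⟨monic_f₂.ne_zero, D.aeval_zeta_mul_root p⟩)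
  constructor
  · rw [minpoly.eq_of_irreducible_of_monic irreducible_f₂ h1 monic_f₂]
    exact Normal.splits inferInstance _
  · obtain ⟨hI, -, -, hr, -⟩ := D.mem_of_root_mem _ D.zeta_ne_zero hmem
    have hz : D.zeta ∈ adjoin ℚ (f₂.rootSet L) := div_mem (add_mem (one_mem _) hI) hr
    rw [eq_top_iff, ← (isSplittingField_iff_intermediateField (p := f₁)).mp inferInstance |>.2,
      adjoin_le_iff]
    intro x hx
    obtain ⟨i, hi⟩ := D.rootEquiv.surjective ⟨x, hx⟩
    have h2 : x = D.root (label i) := by rw [← coe_rootEquiv, hi]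
    have h3 := div_mem (hmem (label i)) hz
    rw [mul_div_cancel_left₀ _ D.zeta_ne_zero] at h3
    rwa [h2]

end

end RootData

lemma exists_splittingField : ∃ (L : IntermediateField ℚ ℂ), f₁.IsSplittingField ℚ L ∧
    Nonempty (RootData L) ∧ 384 ∣ Module.finrank ℚ L := by
  obtain ⟨D⟩ := RootData.exists_complex
  let L := adjoin ℚ (f₁.rootSet ℂ)
  have hL (x : ℂ) (hx : aeval x f₁ = 0) : x ∈ L :=
    subset_adjoin _ _ (mem_rootSet.mpr ⟨monic_f₁.ne_zero, hx⟩)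
  have hmem := D.mem_of_root_mem L one_ne_zero fun p => by
    rw [one_mul]; exact hL _ (D.aeval_root p)
  have hx : D.x ∈ L := D.root_zero ▸ hL _ (D.aeval_root _)
  refine ⟨L, adjoin_rootSet_isSplittingField (IsAlgClosed.splits _), ⟨D.restrict L hmem hx⟩,
    dvd_finrank_of_mem L ?_ ?_ hL D.cube_c hmem.2.2.1⟩
  · have h1 : Complex.I ^ 2 = D.I ^ 2 := by rw [D.sq_I, Complex.I_sq]
    rcases sq_eq_sq_iff_eq_or_eq_neg.mp h1 with h2 | h2 <;> rw [h2]
    · exact hmem.1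
    · exact neg_mem hmem.1
  -- The splitting field contains `√3` because `2 w + 1` is a square root of -3.
  · have h1 : ((√3 : ℝ) : ℂ) ^ 2 = (D.I * (2 * D.w + 1)) ^ 2 := by
      rw [← Complex.ofReal_pow, Real.sq_sqrt (by norm_num), mul_pow, D.sq_I]
      push_cast
      linear_combination 4 * D.sq_w
    have h2 : D.I * (2 * D.w + 1) ∈ L :=
      mul_mem hmem.1 (add_mem (mul_mem (ofNat_mem L 2) hmem.2.1) (one_mem _))
    rcases sq_eq_sq_iff_eq_or_eq_neg.mp h1 with h3 | h3 <;> rw [h3]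
    · exact h2
    · exact neg_mem h2

lemma number_fields :
    Irreducible f₁ ∧ Irreducible f₂ ∧
      Module.finrank ℚ (AdjoinRoot f₁) = 32 ∧ Module.finrank ℚ (AdjoinRoot f₂) = 32 ∧
      IsEmpty (AdjoinRoot f₁ ≃+* AdjoinRoot f₂) ∧
      ∃ (L : Type) (_ : Field L) (_ : Algebra ℚ L),
        f₁.IsSplittingField ℚ L ∧ f₂.IsSplittingField ℚ L ∧ Module.finrank ℚ L = 384 ∧
        ∃ (θ : (L ≃ₐ[ℚ] L) ≃* G32T9403) (r : Fin 32 ≃ f₁.rootSet L)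
          (ι₁ : AdjoinRoot f₁ →ₐ[ℚ] L) (ι₂ : AdjoinRoot f₂ →ₐ[ℚ] L),
          (∀ (τ : L ≃ₐ[ℚ] L) (i : Fin 32),
            (r ((θ τ : Equiv.Perm (Fin 32)) i) : L) = τ (r i : L)) ∧
          (∀ τ : L ≃ₐ[ℚ] L, θ τ ∈ subH₁ ↔ ∀ y, τ (ι₁ y) = ι₁ y) ∧
          (∀ τ : L ≃ₐ[ℚ] L, θ τ ∈ subH₂ ↔ ∀ y, τ (ι₂ y) = ι₂ y) := by
  obtain ⟨L, hL, ⟨D⟩, hdvd⟩ := exists_splittingField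
  have h := D.finrank_eq hdvd
  obtain ⟨ι₁, hι₁⟩ := exists_algHom (D.aeval_root (label 0))
  obtain ⟨ι₂, hι₂⟩ := exists_algHom (D.aeval_zeta_mul_root (label 30))
  refine ⟨irreducible_f₁, irreducible_f₂, ?_, ?_, D.isEmpty_ringEquiv h, L, inferInstance,
    inferInstance, hL, D.isSplittingField_f₂, h, D.galEquiv h, D.rootEquiv, ι₁, ι₂,
    fun τ i => D.rootEquiv_rootAction τ i, fun τ => ?_, D.galEquiv_mem_subH₂_iff h hι₂⟩
  · rw [finrank_adjoinRoot monic_f₁.ne_zero, natDegree_f₁]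
  · rw [finrank_adjoinRoot monic_f₂.ne_zero, natDegree_f₂]
  · rw [forall_adjoinRoot_iff, hι₁]
    exact D.galEquiv_mem_subH₁_iff h τ

end IntegralEquivalence

theorem mainTheorem5 :
    -- the group and its two classes of core-free subgroups of index 32
    (Nat.card G32T9403 = 384 ∧ MulAction.IsPretransitive G32T9403 (Fin 32)) ∧
    (subH₁.index = 32 ∧ subH₁.normalCore = ⊥ ∧ Nonempty (subH₁ ≃* DihedralGroup 6)) ∧
    (subH₂.index = 32 ∧ subH₂.normalCore = ⊥ ∧ Nonempty (subH₂ ≃* DihedralGroup 6)) ∧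
    (∀ g : G32T9403, subH₁.map (MulAut.conj g).toMonoidHom ≠ subH₂) ∧
    (∀ K : Subgroup G32T9403, K.index = 32 → K.normalCore = ⊥ →
      ∃ g : G32T9403, subH₁.map (MulAut.conj g).toMonoidHom = K ∨
        subH₂.map (MulAut.conj g).toMonoidHom = K) ∧
    -- the homomorphisms and their factored determinant, for either choice of sign
    (∀ s : ℤˣ, ∃ (e₁ : G32T9403 ⧸ subH₁ ≃ Fin 32) (e₂ : G32T9403 ⧸ subH₂ ≃ Fin 32)
      (c : Fin 8 ≃ DoubleCoset.Quotient (subH₁ : Set G32T9403) (subH₂ : Set G32T9403)),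
      (∀ k, numRightCosets (c k) = ![2, 2, 2, 2, 3, 3, 6, 12] k) ∧
      (∀ M : Matrix (Fin 32) (Fin 32) ℤ,
        (∃ φ : PermHom subH₁ subH₂, homMatrix e₁ e₂ φ = M) ↔
          ∃ x : Fin 8 → ℤ, ∀ a b : G32T9403,
            M (e₁ a) (e₂ b) = x (c.symm (DoubleCoset.mk subH₁ subH₂ (a⁻¹ * b)))) ∧
      (∀ (M : Matrix (Fin 32) (Fin 32) ℤ) (x : Fin 8 → ℤ),
        (∀ a b : G32T9403,
          M (e₁ a) (e₂ b) = x (c.symm (DoubleCoset.mk subH₁ subH₂ (a⁻¹ * b)))) →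
        M.det = s * detForm x)) ∧
    -- determinants `2 ^ 32` and `3 ^ 12`, but never `1` or `-1`
    (detForm ![1, 1, 0, -1, 0, 0, 0, 0] = 2 ^ 32 ∧
      detForm ![0, 0, 0, 0, 1, 0, 0, 0] = 3 ^ 12) ∧
    (∃ (e₁ : G32T9403 ⧸ subH₁ ≃ Fin 32) (e₂ : G32T9403 ⧸ subH₂ ≃ Fin 32)
      (φ ψ : PermHom subH₁ subH₂),
      (homMatrix e₁ e₂ φ).det = 2 ^ 32 ∧ (homMatrix e₁ e₂ ψ).det = 3 ^ 12) ∧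
    detGcd subH₁ subH₂ = 1 ∧
    LocallyIntegrallyEquivalent subH₁ subH₂ ∧
    (∀ x : Fin 8 → ℤ, detForm x ≠ 1 ∧ detForm x ≠ -1) ∧
    ¬ IntegrallyEquivalent subH₁ subH₂ ∧
    -- local integral equivalence of subgroups of a finite group does not imply integral equivalence
    (¬ ∀ (Γ : Type) [Group Γ] [Finite Γ] (A B : Subgroup Γ),
      LocallyIntegrallyEquivalent A B → IntegrallyEquivalent A B) ∧
    -- realization by number fields of degree 32
    (Irreducible f₁ ∧ Irreducible f₂ ∧
      Module.finrank ℚ (AdjoinRoot f₁) = 32 ∧ Module.finrank ℚ (AdjoinRoot f₂) = 32 ∧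
      IsEmpty (AdjoinRoot f₁ ≃+* AdjoinRoot f₂) ∧
      ∃ (L : Type) (_ : Field L) (_ : Algebra ℚ L),
        f₁.IsSplittingField ℚ L ∧ f₂.IsSplittingField ℚ L ∧ Module.finrank ℚ L = 384 ∧
        ∃ (θ : (L ≃ₐ[ℚ] L) ≃* G32T9403) (r : Fin 32 ≃ f₁.rootSet L)
          (ι₁ : AdjoinRoot f₁ →ₐ[ℚ] L) (ι₂ : AdjoinRoot f₂ →ₐ[ℚ] L),
          (∀ (τ : L ≃ₐ[ℚ] L) (i : Fin 32),
            (r ((θ τ : Equiv.Perm (Fin 32)) i) : L) = τ (r i : L)) ∧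
          (∀ τ : L ≃ₐ[ℚ] L, θ τ ∈ subH₁ ↔ ∀ y, τ (ι₁ y) = ι₁ y) ∧
          (∀ τ : L ≃ₐ[ℚ] L, θ τ ∈ subH₂ ↔ ∀ y, τ (ι₂ y) = ι₂ y)) := by
  refine ⟨⟨card_G32T9403, inferInstance⟩,
    ⟨index_subH₁, normalCore_subH₁, nonempty_subH₁_mulEquiv⟩,
    ⟨index_subH₂, normalCore_subH₂, nonempty_subH₂_mulEquiv⟩,
    not_conj_subH₁_subH₂, exists_conj_eq, exists_orderings, ⟨detForm_two, detForm_three⟩,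
    exists_homMatrix_two_three, detGcd_eq_one, locallyIntegrallyEquivalent, detForm_ne,
    not_integrallyEquivalent, not_forall_integrallyEquivalent, number_fields⟩
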